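/- Let $k \ge 2$ be a fixed integer. For $n \ge k+1$ let $N = \binom n2$, let $e_1, \dots, e_N$ be a uniformly random ordering of the edges of the complete graph on $[n]=\{1,\dots,n\}$, and, for $0 \le m \le N$, let $\mathcal G(n,m)$ be the graph on $[n]$ with edge set $\{e_1,\dots,e_m\}$. Independently of the ordering and of each other, the edges $e$ choose colour sets $c(e)$, each uniformly distributed over all $k$-element subsets of a set $W$ of $n-1$ colours. A rainbow spanning tree of $\mathcal G(n,m)$ is a spanning tree of $\mathcal G(n,m)$ together with a choice, for each of its edges $e$, of one colour from $c(e)$ such that the chosen colours are pairwise different. Let $m_{\mathcal C}$, $m_{\mathcal N}$ and $m_{\mathcal R}$ be the smallest $m \in \{0,\dots,N\}$ (if there is one) such that, respectively, $\mathcal G(n,m)$ is connected; every colour of $W$ belongs to $c(e_i)$ for some $i \le m$; $\mathcal G(n,m)$ has a rainbow spanning tree. Then, with probability tending to $1$ as $n \to \infty$, the three times $m_{\mathcal R}$, $m_{\mathcal C}$, $m_{\mathcal N}$ are all defined and $$m_{\mathcal R} = \max\{m_{\mathcal C}, m_{\mathcal N}\}.$$ -/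

import Mathlib

open Filter Topology MeasureTheory ProbabilityTheory

/-- The edges of the complete graph `K_n` on the vertex set `Fin n`. -/
abbrev KEdge (n : ℕ) : Type := ((⊤ : SimpleGraph (Fin n)).edgeSet : Set (Sym2 (Fin n)))

/-- The orderings `e_1, …, e_N` of all edges of `K_n`, where `N = n.choose 2`
(indexed from `0`, so that the edge `e_i` is the value at `i - 1`). -/
def EdgeOrder (n : ℕ) : Type := Fin (n.choose 2) ≃ KEdge n

/-- The `k`-element subsets of the colour set `W`, which is `Fin (n - 1)`. -/
def ColourSet (n k : ℕ) : Type := {S : Finset (Fin (n - 1)) // S.card = k}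

instance (n : ℕ) : MeasurableSpace (EdgeOrder n) := ⊤

instance (n k : ℕ) : MeasurableSpace (ColourSet n k) := ⊤

/-- An outcome: an ordering of the edges of `K_n`, and a set of `k` colours for every edge. -/
abbrev Outcome (n k : ℕ) : Type := EdgeOrder n × (KEdge n → ColourSet n k)

/-- The law of the coloured graph process: the ordering of the edges is uniformly random, the
colour sets of the edges are uniformly random, and all these choices are independent. It is a
probability measure as soon as there are at least `k` colours. -/
noncomputable def processLaw (n k : ℕ) : Measure (Outcome n k) :=
  (uniformOn (Set.univ : Set (EdgeOrder n))).prod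
    (Measure.pi fun _ : KEdge n => uniformOn (Set.univ : Set (ColourSet n k)))

namespace Outcome

variable {n k : ℕ}

/-- The set `E_m` of the first `m` edges. -/
def edges (ω : Outcome n k) (m : ℕ) : Set (KEdge n) :=
  {e | ∃ i : Fin (n.choose 2), (i : ℕ) < m ∧ ω.1.toFun i = e}

/-- The set `c(e)` of the colours chosen by the edge `e`. -/
def colours (ω : Outcome n k) (e : KEdge n) : Finset (Fin (n - 1)) := (ω.2 e).val

/-- The graph `𝒢(n, m)`, with the first `m` edges. -/
def graph (ω : Outcome n k) (m : ℕ) : SimpleGraph (Fin n) :=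
  SimpleGraph.fromEdgeSet (Subtype.val '' ω.edges m)

/-- `𝒢(n, m)` is connected. -/
def IsConn (ω : Outcome n k) (m : ℕ) : Prop := (ω.graph m).Connected

/-- `𝒢(n, m)` contains edges in every colour. -/
def AllColours (ω : Outcome n k) (m : ℕ) : Prop :=
  ∀ w : Fin (n - 1), ∃ e ∈ ω.edges m, w ∈ ω.colours e

/-- `𝒢(n, m)` has a rainbow spanning tree: a spanning tree whose edges can be given pairwise
different colours, each edge `e` receiving a colour from its own set `c(e)`. -/
def HasRainbowTree (ω : Outcome n k) (m : ℕ) : Prop :=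
  ∃ T : SimpleGraph (Fin n), T ≤ ω.graph m ∧ T.IsTree ∧
    ∃ f : KEdge n → Fin (n - 1),
      Set.InjOn f {e | (e : Sym2 (Fin n)) ∈ T.edgeSet} ∧
      ∀ e : KEdge n, (e : Sym2 (Fin n)) ∈ T.edgeSet → f e ∈ ω.colours e

end Outcome

/-- The first time `m ∈ {0, …, n.choose 2}` at which `E m` occurs exists and is equal to `t`. -/
def IsFirstTime (n : ℕ) (E : ℕ → Prop) (t : ℕ) : Prop :=
  IsLeast {m : ℕ | m ≤ n.choose 2 ∧ E m} t

/-!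
By Rado's theorem, applied to the cycle matroid of `𝒢(n, m)`, a rainbow spanning tree fails to
exist exactly when some set `I` of colours satisfies `n < κ(I) + #I`, where `κ(I)` is the number of
components left by the edges that have a colour in `I`. For `#I = 1` this says that a colour is
missing, and for `I = W` that the graph is disconnected, so when `m = max m_C m_N` a minimal
violating `I` has `1 < #I < n - 1`.

With high probability this `m` lies between a time `m₀` just below the connectivity threshold and a
time `m₁ = O(n log n)`. A violating `I` then forces one of three obstructions, according to its
size. If `I` is small, its colours are confined to at most `(3 #I + d) / 2` vertices, which span
`#I - 1` edges with a colour in `I`, `d` of them with two. If both `I` and its complement are large,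
half of the components left by `I` form a large cut that `I` avoids. If `I` consists of all but `j`
colours, with `j` small, then some cut contains at least `j + 1` edges, and all of them take their
colours from the `j` others. As every edge has at least two colours, this costs a factor
`(j / (n - 1)) ^ 2` for each of these edges, and a union bound makes each obstruction unlikely.
-/

section Placements

open Finset

lemma card_filter_symm_mem {α β : Type*} [Fintype α] [DecidableEq β] (σ : β ≃ α)
    (J : Finset β) : #{y | σ.symm y ∈ J} = #J :=
  card_bij (fun y _ => σ.symm y) (by simp) (by simp) fun i hi => ⟨σ i, by simpa using hi, by simp⟩

/-- The elements of `T` occupy `#T` of the positions in `J`. -/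
lemma card_compl_filter_symm_mem {α β : Type*} [Fintype α] [DecidableEq α] [DecidableEq β]
    {σ : β ≃ α} {T : Finset α} {J : Finset β} (hT : ∀ x ∈ T, σ.symm x ∈ J) :
    #{y ∈ Tᶜ | σ.symm y ∈ J} = #J - #T := by
  have hsub : T ⊆ ({y | σ.symm y ∈ J} : Finset α) := fun x hx => by simpa using hT x hx
  rw [← card_filter_symm_mem σ J, ← card_sdiff_of_subset hsub]
  congr 1
  ext y
  simp [and_comm]

variable {α β : Type*} [Fintype α] [Fintype β] [DecidableEq α] [DecidableEq β]

/-- The placements of the elements of `α` at the positions `β` for which every `x ∈ S` stands at a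
position of `A x`. -/
def placements (S : Finset α) (A : α → Finset β) : Finset (β ≃ α) :=
  {σ | ∀ x ∈ S, σ.symm x ∈ A x}

lemma mem_placements {S : Finset α} {A : α → Finset β} {σ : β ≃ α} :
    σ ∈ placements S A ↔ ∀ x ∈ S, σ.symm x ∈ A x := by
  simp [placements]

lemma placements_congr {S : Finset α} {A A' : α → Finset β} (h : ∀ x ∈ S, A x = A' x) :
    placements S A = placements S A' := by
  ext σ
  simp +contextual [mem_placements, h]

lemma card_placements_insert_eq_card_filter {S : Finset α} (A : α → Finset β) {x y : α}
    (hx : x ∉ S) (hy : y ∉ S) :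
    #(placements (insert x S) A) = #{σ ∈ placements S A | σ.symm y ∈ A x} := by
  have hfix : ∀ z ∈ S, Equiv.swap x y z = z := fun z hz =>
    Equiv.swap_apply_of_ne_of_ne (fun h => hx (h ▸ hz)) (fun h => hy (h ▸ hz))
  refine card_bij' (fun σ _ => σ.trans (Equiv.swap x y)) (fun σ _ => σ.trans (Equiv.swap x y))
    (fun σ hσ => ?_) (fun σ hσ => ?_) (fun σ _ => by ext; simp) (fun σ _ => by ext; simp)
  · rw [mem_placements] at hσ
    simp only [mem_filter, mem_placements, Equiv.symm_trans_apply, Equiv.symm_swap,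
      Equiv.swap_apply_right]
    exact ⟨fun z hz => (hfix z hz).symm ▸ hσ z (mem_insert_of_mem hz), hσ x (mem_insert_self _ _)⟩
  · simp only [mem_filter, mem_placements] at hσ
    simp only [mem_placements, Equiv.symm_trans_apply, Equiv.symm_swap, forall_mem_insert,
      Equiv.swap_apply_left]
    exact ⟨hσ.2, fun z hz => (hfix z hz).symm ▸ hσ.1 z hz⟩

/-- Exchanging `x` with any `y ∉ S` leaves the constraints on `S` intact. -/
lemma card_placements_insert_mul (S : Finset α) (A : α → Finset β) {x : α} (hx : x ∉ S) :
    #(placements (insert x S) A) * #Sᶜ = ∑ σ ∈ placements S A, #{y ∈ Sᶜ | σ.symm y ∈ A x} := by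
  calc #(placements (insert x S) A) * #Sᶜ
      = ∑ y ∈ Sᶜ, #{σ ∈ placements S A | σ.symm y ∈ A x} := by
        rw [mul_comm, ← smul_eq_mul, ← sum_const]
        exact sum_congr rfl fun y hy =>
          card_placements_insert_eq_card_filter A hx (mem_compl.1 hy)
    _ = ∑ σ ∈ placements S A, #{y ∈ Sᶜ | σ.symm y ∈ A x} := by
        simp only [card_filter]
        exact sum_comm

lemma card_placements_insert_le {S : Finset α} {A : α → Finset β} {x : α} (hx : x ∉ S) {r : ℝ}
    (hr : ∀ σ ∈ placements S A, (#{y ∈ Sᶜ | σ.symm y ∈ A x} : ℝ) ≤ r * #Sᶜ) :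
    (#(placements (insert x S) A) : ℝ) ≤ r * #(placements S A) := by
  have hpos : (0 : ℝ) < #Sᶜ := by exact_mod_cast card_pos.2 ⟨x, mem_compl.2 hx⟩
  refine le_of_mul_le_mul_right ?_ hpos
  calc (#(placements (insert x S) A) : ℝ) * #Sᶜ
      = ∑ σ ∈ placements S A, (#{y ∈ Sᶜ | σ.symm y ∈ A x} : ℝ) := by
        exact_mod_cast card_placements_insert_mul S A hx
    _ ≤ #(placements S A) * (r * #Sᶜ) := by
        rw [← nsmul_eq_mul]
        exact sum_le_card_nsmul _ _ _ hr
    _ = r * #(placements S A) * #Sᶜ := by ring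

theorem card_placements_const_mul_descFactorial (T : Finset α) (J : Finset β) :
    #(placements T fun _ => J) * (Fintype.card α).descFactorial #T =
      Fintype.card (β ≃ α) * (#J).descFactorial #T := by
  induction T using Finset.induction_on with
  | empty => simp [placements]
  | insert x T hx ih =>
    have hstep : #(placements (insert x T) fun _ => J) * (Fintype.card α - #T) =
        #(placements T fun _ => J) * (#J - #T) := by
      rw [← card_compl, card_placements_insert_mul T _ hx, ← smul_eq_mul, ← sum_const]
      exact sum_congr rfl fun σ hσ => card_compl_filter_symm_mem (mem_placements.1 hσ)
    rw [card_insert_of_notMem hx, Nat.descFactorial_succ, Nat.descFactorial_succ, ← mul_assoc,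
      hstep, mul_right_comm, ih]
    ring

end Placements

section DescRatio

/-- The probability that `t` given elements of an `N`-set in uniformly random order all fall
into `J` given places. -/
noncomputable def descRatio (N J t : ℕ) : ℝ := (J.descFactorial t : ℝ) / N.descFactorial t

lemma descRatio_nonneg (N J t : ℕ) : 0 ≤ descRatio N J t := by
  unfold descRatio; positivity

lemma descRatio_succ (N J t : ℕ) :
    descRatio N J (t + 1) = descRatio N J t * ((J - t : ℕ) / (N - t : ℕ)) := by
  simp only [descRatio, Nat.descFactorial_succ, Nat.cast_mul]
  rw [mul_comm ((J - t : ℕ) : ℝ), mul_comm ((N - t : ℕ) : ℝ), mul_div_mul_comm]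

lemma sub_div_sub_le_div {N J : ℕ} (hJ : J ≤ N) (t : ℕ) :
    ((J - t : ℕ) : ℝ) / (N - t : ℕ) ≤ J / N := by
  rcases le_or_gt J t with hJt | htJ
  · rw [Nat.sub_eq_zero_of_le hJt, Nat.cast_zero, zero_div]
    positivity
  · have htN : (0 : ℝ) < (N - t : ℕ) := by exact_mod_cast Nat.sub_pos_of_lt (htJ.trans_le hJ)
    have hN : (0 : ℝ) < N := by exact_mod_cast (Nat.zero_le t).trans_lt (htJ.trans_le hJ)
    have hJN : (J : ℝ) ≤ N := by exact_mod_cast hJ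
    rw [div_le_div_iff₀ htN hN, Nat.cast_sub htJ.le, Nat.cast_sub (htJ.le.trans hJ)]
    nlinarith [(Nat.cast_nonneg t : (0 : ℝ) ≤ t)]

lemma descRatio_le_pow {N J : ℕ} (hJ : J ≤ N) (t : ℕ) : descRatio N J t ≤ ((J : ℝ) / N) ^ t := by
  induction t with
  | zero => simp [descRatio]
  | succ t ih =>
    rw [descRatio_succ, pow_succ]
    exact mul_le_mul ih (sub_div_sub_le_div hJ t) (by positivity) (by positivity)

lemma pow_le_descRatio {N J t q : ℕ} (hJ : J ≤ N) (ht : t ≤ q + 1) :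
    (((J - q : ℕ) : ℝ) / (N - q : ℕ)) ^ t ≤ descRatio N J t := by
  induction t with
  | zero => simp [descRatio]
  | succ t ih =>
    have hfactor := sub_div_sub_le_div (Nat.sub_le_sub_right hJ t) (q - t)
    rw [Nat.sub_sub, Nat.sub_sub, Nat.add_sub_cancel' (by omega)] at hfactor
    rw [descRatio_succ, pow_succ]
    exact mul_le_mul (ih (by omega)) hfactor (by positivity) (descRatio_nonneg N J t)

lemma descRatio_add_le {N J : ℕ} (hJ : J ≤ N) (s t : ℕ) :
    descRatio N J (s + t) ≤ descRatio N J s * descRatio N J t := by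
  induction t with
  | zero => simp [descRatio]
  | succ t ih =>
    have hfactor := sub_div_sub_le_div (Nat.sub_le_sub_right hJ t) s
    rw [Nat.sub_sub, Nat.sub_sub, add_comm t s] at hfactor
    rw [← add_assoc, descRatio_succ, descRatio_succ, ← mul_assoc]
    exact mul_le_mul ih hfactor (by positivity)
      (mul_nonneg (descRatio_nonneg N J s) (descRatio_nonneg N J t))

end DescRatio

section EarlyLate

open Finset

variable {α β : Type*} [Fintype α] [Fintype β] [DecidableEq α] [DecidableEq β]

lemma card_placements_const (T : Finset α) (J : Finset β) :
    (#(placements T fun _ => J) : ℝ) =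
      Fintype.card (β ≃ α) * descRatio (Fintype.card α) #J #T := by
  have hpos : (0 : ℝ) < (Fintype.card α).descFactorial #T := by
    exact_mod_cast Nat.descFactorial_pos.2 (card_le_univ T)
  rw [descRatio, mul_div_assoc', eq_div_iff hpos.ne']
  exact_mod_cast card_placements_const_mul_descFactorial T J

/-- The positions available to one more element that must stay out of `J₀`, when `t` elements are
placed freely and `q` outside `J₀`. -/
lemma sub_sub_le_exp_mul {N m t q : ℕ} (ht : t ≤ m) (hm : m ≤ N) (hqt : q + t < N) :
    ((N - m - q : ℕ) : ℝ) ≤ Real.exp (-((m - t) / N)) * (N - (q + t) : ℕ) := by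
  have hN : (0 : ℝ) < N := by exact_mod_cast (Nat.zero_le _).trans_lt hqt
  have htm : (t : ℝ) ≤ m := by exact_mod_cast ht
  have hmN : (m : ℝ) ≤ N := by exact_mod_cast hm
  have hqtN : ((q + t : ℕ) : ℝ) ≤ N := by exact_mod_cast hqt.le
  set a : ℝ := (m - t) / N
  have ha0 : 0 ≤ a := div_nonneg (by linarith) hN.le
  have ha1 : a ≤ 1 := (div_le_one hN).2 (by linarith [(Nat.cast_nonneg t : (0 : ℝ) ≤ t)])
  refine le_trans ?_ (mul_le_mul_of_nonneg_right (Real.add_one_le_exp (-a)) (Nat.cast_nonneg _))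
  rw [Nat.cast_sub hqt.le]
  rcases le_or_gt (m + q) N with hle | hgt
  · have haN : a * N = m - t := div_mul_cancel₀ _ hN.ne'
    rw [Nat.sub_sub, Nat.cast_sub hle]
    push_cast
    nlinarith [mul_nonneg ha0 (by positivity : (0 : ℝ) ≤ (q : ℝ) + t)]
  · rw [Nat.sub_sub, Nat.sub_eq_zero_of_le hgt.le, Nat.cast_zero]
    exact mul_nonneg (by linarith) (by linarith)

theorem card_placements_early_late_le {T Q : Finset α} (hTQ : Disjoint T Q) {J₀ J₁ : Finset β}
    (ht : #T ≤ #J₀) (hN : Fintype.card β = Fintype.card α) :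
    (#(placements (Q ∪ T) fun x => if x ∈ T then J₁ else J₀ᶜ) : ℝ) ≤
      Fintype.card (β ≃ α) * ((#J₁ : ℝ) / Fintype.card α) ^ #T *
        Real.exp (-((#J₀ - #T) / Fintype.card α)) ^ #Q := by
  induction Q using Finset.induction_on with
  | empty =>
    rw [empty_union, placements_congr (A' := fun _ => J₁) fun x hx => if_pos hx,
      card_placements_const, card_empty, pow_zero, mul_one]
    gcongr
    exact descRatio_le_pow (hN ▸ card_le_univ J₁) _
  | insert x Q hx ih =>
    obtain ⟨hxT, hTQ⟩ := disjoint_insert_right.1 hTQ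
    have hxS : x ∉ Q ∪ T := by simp [hx, hxT]
    have hcard : #(Q ∪ T) = #Q + #T := card_union_of_disjoint hTQ.symm
    have hlt : #Q + #T < Fintype.card α :=
      hcard ▸ card_lt_univ_of_notMem hxS
    have hfree : ∀ σ ∈ placements (Q ∪ T) fun x => if x ∈ T then J₁ else J₀ᶜ,
        (#{y ∈ (Q ∪ T)ᶜ | σ.symm y ∈ if x ∈ T then J₁ else J₀ᶜ} : ℝ) ≤
          Real.exp (-((#J₀ - #T) / Fintype.card α)) * #(Q ∪ T)ᶜ := fun σ hσ => by
      have hlate : ∀ y ∈ Q, σ.symm y ∈ J₀ᶜ := fun y hy => by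
        simpa [disjoint_right.1 hTQ hy] using mem_placements.1 hσ y (mem_union_left _ hy)
      refine le_trans ?_ (card_compl (Q ∪ T) ▸ hcard ▸ sub_sub_le_exp_mul ht
        (hN ▸ card_le_univ J₀) hlt)
      rw [← hN, ← card_compl, ← card_compl_filter_symm_mem hlate, if_neg hxT]
      gcongr
      exact subset_union_left
    rw [insert_union, card_insert_of_notMem hx, pow_succ, ← mul_assoc, mul_comm _ (Real.exp _)]
    exact (card_placements_insert_le hxS hfree).trans (by gcongr; exact ih hTQ)

end EarlyLate

section UniformReal

lemma uniformOn_univ_real_eq {Ω : Type*} [Fintype Ω] [MeasurableSpace Ω]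
    [MeasurableSingletonClass Ω] (S : Set Ω) [DecidablePred (· ∈ S)] :
    (uniformOn (Set.univ : Set Ω)).real S =
      ((Finset.univ.filter (· ∈ S)).card : ℝ) / Fintype.card Ω := by
  have hS : S = (Finset.univ.filter (· ∈ S) : Finset Ω) := by ext; simp
  conv_lhs => rw [hS]
  rw [measureReal_def, uniformOn_univ, Measure.count_apply_finset]
  simp

lemma measureReal_prod_eq_integral {Ω Ω' : Type*} [MeasurableSpace Ω] [MeasurableSpace Ω']
    (μ : Measure Ω) [IsFiniteMeasure μ] (ν : Measure Ω') [SFinite ν] {S : Set (Ω × Ω')}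
    (hS : MeasurableSet S) :
    (μ.prod ν).real S = ∫ y, μ.real {x | (x, y) ∈ S} ∂ν := by
  rw [measureReal_def, Measure.prod_apply_symm hS]
  exact (integral_toReal (measurable_measure_prodMk_right hS).aemeasurable
    (.of_forall fun _ => measure_lt_top _ _)).symm

end UniformReal

section EdgeOrderLaw

open Finset

noncomputable instance (n : ℕ) : Fintype (EdgeOrder n) :=
  inferInstanceAs (Fintype (Fin (n.choose 2) ≃ KEdge n))

instance (n : ℕ) : MeasurableSingletonClass (EdgeOrder n) := ⟨fun _ => trivial⟩

lemma card_KEdge (n : ℕ) : Fintype.card (KEdge n) = n.choose 2 := by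
  have h := SimpleGraph.card_edgeFinset_top_eq_card_choose_two (V := Fin n)
  rwa [Fintype.card_fin, SimpleGraph.edgeFinset_card] at h

instance (n : ℕ) : Nonempty (EdgeOrder n) :=
  ⟨(Fintype.equivFinOfCardEq (card_KEdge n)).symm⟩

/-- The position, counted from `0`, of the edge `e` in the ordering `σ`. -/
def EdgeOrder.position {n : ℕ} (σ : EdgeOrder n) (e : KEdge n) : Fin (n.choose 2) :=
  Equiv.symm (α := Fin (n.choose 2)) σ e

variable {n : ℕ}

lemma uniformOn_position_mem_real (S : Finset (KEdge n))
    (A : KEdge n → Finset (Fin (n.choose 2))) :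
    (uniformOn (Set.univ : Set (EdgeOrder n))).real {σ | ∀ e ∈ S, σ.position e ∈ A e} =
      (#(placements S A) : ℝ) / Fintype.card (Fin (n.choose 2) ≃ KEdge n) := by
  classical
  rw [uniformOn_univ_real_eq]
  congr! 2

lemma card_filter_val_lt {N m : ℕ} (hm : m ≤ N) : #{i : Fin N | (i : ℕ) < m} = m := by
  rw [Fin.card_filter_val_lt, min_eq_right hm]

lemma card_edgeOrder_pos (n : ℕ) : (0 : ℝ) < Fintype.card (Fin (n.choose 2) ≃ KEdge n) :=
  Nat.cast_pos.2 (Fintype.card_pos_iff.2 (inferInstanceAs (Nonempty (EdgeOrder n))))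

lemma uniformOn_late_real (Q : Finset (KEdge n)) {m : ℕ} (hm : m ≤ n.choose 2) :
    (uniformOn (Set.univ : Set (EdgeOrder n))).real {σ | ∀ e ∈ Q, m ≤ (σ.position e : ℕ)} =
      descRatio (n.choose 2) (n.choose 2 - m) #Q := by
  have h := uniformOn_position_mem_real Q fun _ =>
    ({i : Fin (n.choose 2) | (i : ℕ) < m} : Finset _)ᶜ
  rw [card_placements_const, mul_div_cancel_left₀ _ (card_edgeOrder_pos n).ne', card_KEdge,
    card_compl, Fintype.card_fin, card_filter_val_lt hm] at h
  simpa using h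

lemma uniformOn_early_late_real_le {T Q : Finset (KEdge n)} (hTQ : Disjoint T Q) {m₀ m₁ : ℕ}
    (hT : #T ≤ m₀) (hm₀ : m₀ ≤ n.choose 2) (hm₁ : m₁ ≤ n.choose 2) :
    (uniformOn (Set.univ : Set (EdgeOrder n))).real
        {σ | (∀ e ∈ T, (σ.position e : ℕ) < m₁) ∧ ∀ e ∈ Q, m₀ ≤ (σ.position e : ℕ)} ≤
      ((m₁ : ℝ) / (n.choose 2 : ℕ)) ^ #T *
        Real.exp (-((m₀ - #T) / (n.choose 2 : ℕ))) ^ #Q := by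
  set J₀ : Finset (Fin (n.choose 2)) := {i | (i : ℕ) < m₀}
  set J₁ : Finset (Fin (n.choose 2)) := {i | (i : ℕ) < m₁}
  have hJ₀ : #J₀ = m₀ := card_filter_val_lt hm₀
  have hJ₁ : #J₁ = m₁ := card_filter_val_lt hm₁
  have hcount := card_placements_early_late_le hTQ (J₁ := J₁) (hT.trans hJ₀.ge)
    (by rw [Fintype.card_fin, card_KEdge])
  rw [card_KEdge, hJ₀, hJ₁, mul_assoc, ← div_le_iff₀' (card_edgeOrder_pos n),
    ← uniformOn_position_mem_real] at hcount
  refine (measureReal_mono fun σ hσ e he => ?_).trans hcount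
  split_ifs with heT
  · simpa [J₁] using hσ.1 e heT
  · simpa [J₀] using hσ.2 e ((mem_union.1 he).resolve_right heT)

end EdgeOrderLaw

section PaletteLaw

open Finset

noncomputable instance (n k : ℕ) : Fintype (ColourSet n k) :=
  inferInstanceAs (Fintype {S : Finset (Fin (n - 1)) // S.card = k})

instance (n k : ℕ) : MeasurableSingletonClass (ColourSet n k) := ⟨fun _ => trivial⟩

lemma card_colourSet (n k : ℕ) : Fintype.card (ColourSet n k) = (n - 1).choose k := by
  have h : Fintype.card (ColourSet n k) =
      Fintype.card {S : Finset (Fin (n - 1)) // S.card = k} := rfl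
  rw [h, Fintype.card_finset_len, Fintype.card_fin]

variable {n k : ℕ}

lemma nonempty_colourSet (hk : k ≤ n - 1) : Nonempty (ColourSet n k) :=
  Fintype.card_pos_iff.1 ((card_colourSet n k).symm ▸ Nat.choose_pos hk)

/-- The probability that a uniformly random `k`-set of colours has the property `P`. -/
noncomputable def colourProb (n k : ℕ) (P : Finset (Fin (n - 1)) → Prop) : ℝ :=
  (uniformOn (Set.univ : Set (ColourSet n k))).real {a | P a.val}

lemma colourProb_false : colourProb n k (fun _ => False) = 0 := measureReal_empty

lemma colourProb_nonneg (P : Finset (Fin (n - 1)) → Prop) : 0 ≤ colourProb n k P :=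
  measureReal_nonneg

lemma colourProb_eq_card_div (P : Finset (Fin (n - 1)) → Prop) [DecidablePred P] :
    colourProb n k P = (#{S ∈ powersetCard k univ | P S} : ℝ) / (n - 1).choose k := by
  classical
  rw [colourProb, uniformOn_univ_real_eq, card_colourSet]
  congr 2
  refine card_bij (fun a _ => a.val) (fun a ha => ?_) (fun a _ b _ h => Subtype.ext h)
    fun S hS => ?_
  · rw [mem_filter, mem_powersetCard_univ]
    exact ⟨a.2, (mem_filter.1 ha).2⟩
  · rw [mem_filter, mem_powersetCard_univ] at hS
    exact ⟨⟨S, hS.1⟩, mem_filter.2 ⟨mem_univ _, hS.2⟩, rfl⟩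

lemma choose_div_choose_eq_descRatio (M J k : ℕ) :
    (J.choose k : ℝ) / M.choose k = descRatio M J k := by
  rw [descRatio, Nat.descFactorial_eq_factorial_mul_choose,
    Nat.descFactorial_eq_factorial_mul_choose, Nat.cast_mul, Nat.cast_mul,
    mul_div_mul_left _ _ (by positivity)]

lemma colourProb_disjoint_le (I : Finset (Fin (n - 1))) :
    colourProb n k (fun S => Disjoint S I) ≤ (((n - 1 - #I : ℕ) : ℝ) / (n - 1 : ℕ)) ^ k := by
  have hsets : ({S ∈ powersetCard k (univ : Finset (Fin (n - 1))) | Disjoint S I} : Finset _) =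
      powersetCard k Iᶜ := by
    ext S
    rw [mem_filter, mem_powersetCard_univ, mem_powersetCard, subset_compl_iff_disjoint_right,
      and_comm]
  rw [colourProb_eq_card_div, hsets, card_powersetCard, card_compl, Fintype.card_fin,
    choose_div_choose_eq_descRatio]
  exact descRatio_le_pow (Nat.sub_le _ _) k

lemma colourProb_disjoint_le_sq (hk : 2 ≤ k) (I : Finset (Fin (n - 1))) :
    colourProb n k (fun S => Disjoint S I) ≤ (((n - 1 - #I : ℕ) : ℝ) / (n - 1 : ℕ)) ^ 2 :=
  (colourProb_disjoint_le I).trans <| pow_le_pow_of_le_one (by positivity)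
    (div_le_one_of_le₀ (by exact_mod_cast Nat.sub_le _ _) (by positivity)) hk

/-- The `k`-sets containing `A` correspond to the `(k - #A)`-subsets of `Aᶜ`. -/
lemma card_powersetCard_filter_superset_le {W : Type*} [Fintype W] [DecidableEq W]
    (A : Finset W) (k : ℕ) :
    #{S ∈ powersetCard k (univ : Finset W) | A ⊆ S} ≤ (Fintype.card W - #A).choose (k - #A) := by
  rw [← card_compl, ← card_powersetCard]
  refine card_le_card_of_injOn (· \ A) (fun S hS => ?_) fun S hS S' hS' h => ?_
  · obtain ⟨hSk, hAS⟩ := mem_filter.1 hS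
    exact mem_powersetCard.2 ⟨fun x hx => mem_compl.2 (mem_sdiff.1 hx).2,
      by rw [card_sdiff_of_subset hAS, mem_powersetCard_univ.1 hSk]⟩
  · rw [← sdiff_union_of_subset (mem_filter.1 hS).2, show S \ A = S' \ A from h,
      sdiff_union_of_subset (mem_filter.1 hS').2]

lemma colourProb_superset_le (hkn : k ≤ n - 1) {A : Finset (Fin (n - 1))} (hA : #A ≤ k) :
    colourProb n k (fun S => A ⊆ S) ≤ ((k : ℝ) / (n - 1 : ℕ)) ^ #A := by
  have hcount := card_powersetCard_filter_superset_le A k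
  have hchoose := Nat.choose_mul (n := n - 1) hA
  have hpos : (0 : ℝ) < (n - 1).choose k := by exact_mod_cast Nat.choose_pos hkn
  have hposA : (0 : ℝ) < (n - 1).choose #A := by exact_mod_cast Nat.choose_pos (hA.trans hkn)
  refine le_trans ?_ (descRatio_le_pow hkn #A)
  rw [Fintype.card_fin] at hcount
  rw [colourProb_eq_card_div, ← choose_div_choose_eq_descRatio, div_le_div_iff₀ hpos hposA]
  calc (#{S ∈ powersetCard k univ | A ⊆ S} : ℝ) * (n - 1).choose #A
      ≤ ((n - 1 - #A).choose (k - #A) : ℕ) * (n - 1).choose #A := by gcongr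
    _ = k.choose #A * (n - 1).choose k := by
        rw [mul_comm, mul_comm (k.choose #A : ℝ)]
        exact_mod_cast hchoose.symm

lemma colourProb_le_sum {ι : Type*} {s : Finset ι} {P : Finset (Fin (n - 1)) → Prop}
    {Q : ι → Finset (Fin (n - 1)) → Prop} (h : ∀ S, P S → ∃ i ∈ s, Q i S) :
    colourProb n k P ≤ ∑ i ∈ s, colourProb n k (Q i) := by
  have hsub : {a : ColourSet n k | P a.val} ⊆ ⋃ i ∈ s, {a : ColourSet n k | Q i a.val} :=
    fun a ha => by simpa using h a.val ha
  exact (measureReal_mono hsub (measure_ne_top _ _)).trans (measureReal_biUnion_finset_le s _)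

lemma colourProb_not_disjoint_le (hk : 1 ≤ k) (hkn : k ≤ n - 1) (I : Finset (Fin (n - 1))) :
    colourProb n k (fun S => ¬ Disjoint S I) ≤ (k * #I : ℝ) / (n - 1 : ℕ) := by
  calc colourProb n k (fun S => ¬ Disjoint S I)
      ≤ ∑ w ∈ I, colourProb n k (fun S => {w} ⊆ S) := colourProb_le_sum fun S hS => by
        obtain ⟨w, hwS, hwI⟩ := not_disjoint_iff.1 hS
        exact ⟨w, hwI, singleton_subset_iff.2 hwS⟩
    _ ≤ #I • ((k : ℝ) / (n - 1 : ℕ)) := sum_le_card_nsmul _ _ _ fun w _ => by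
        simpa using colourProb_superset_le hkn (A := {w}) (by simpa using hk)
    _ = (k * #I : ℝ) / (n - 1 : ℕ) := by rw [nsmul_eq_mul]; ring

lemma colourProb_two_le_card_inter_le (hk : 2 ≤ k) (hkn : k ≤ n - 1) (I : Finset (Fin (n - 1))) :
    colourProb n k (fun S => 2 ≤ #(S ∩ I)) ≤ ((k * #I : ℝ) / (n - 1 : ℕ)) ^ 2 := by
  calc colourProb n k (fun S => 2 ≤ #(S ∩ I))
      ≤ ∑ w ∈ I.offDiag, colourProb n k (fun S => {w.1, w.2} ⊆ S) :=
        colourProb_le_sum fun S hS => by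
          obtain ⟨a, ha, b, hb, hab⟩ := one_lt_card.1 hS
          rw [mem_inter] at ha hb
          exact ⟨(a, b), mem_offDiag.2 ⟨ha.2, hb.2, hab⟩, by simp [insert_subset_iff, ha.1, hb.1]⟩
    _ ≤ #I.offDiag • ((k : ℝ) / (n - 1 : ℕ)) ^ 2 := sum_le_card_nsmul _ _ _ fun w hw => by
        have hpair : #{w.1, w.2} = 2 := card_pair (mem_offDiag.1 hw).2.2
        simpa only [hpair] using colourProb_superset_le hkn (hpair.trans_le hk)
    _ ≤ (#I : ℝ) ^ 2 * ((k : ℝ) / (n - 1 : ℕ)) ^ 2 := by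
        rw [nsmul_eq_mul, offDiag_card]
        gcongr
        rw [sq]
        exact_mod_cast Nat.sub_le _ _
    _ = ((k * #I : ℝ) / (n - 1 : ℕ)) ^ 2 := by ring

end PaletteLaw

section ProcessLaw

open Finset

lemma integral_pi_finset_prod {ι X : Type*} [Fintype ι] [MeasurableSpace X] (μ : Measure X)
    [IsProbabilityMeasure μ] (S : Finset ι) (f : ι → X → ℝ) :
    ∫ c, ∏ i ∈ S, f i (c i) ∂Measure.pi (fun _ : ι => μ) = ∏ i ∈ S, ∫ x, f i x ∂μ := by
  classical
  have hext (g : ι → ℝ) : ∏ i ∈ S, g i = ∏ i, if i ∈ S then g i else 1 := by simp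
  have hite (i : ι) (x : X) : (if i ∈ S then f i x else 1) = (if i ∈ S then f i else 1) x := by
    split_ifs <;> rfl
  simp_rw [hext, hite]
  rw [integral_fintype_prod_eq_prod]
  exact prod_congr rfl fun i _ => by split_ifs <;> simp

lemma exp_neg_le_quadratic {z : ℝ} (hz : 0 ≤ z) : Real.exp (-z) ≤ 1 - z + z ^ 2 / 2 := by
  have hexp := Real.quadratic_le_exp_of_nonneg hz
  have hpos : 0 < 1 - z + z ^ 2 / 2 := by nlinarith [sq_nonneg (z - 1)]
  rw [Real.exp_neg, inv_le_iff_one_le_mul₀ (Real.exp_pos z)]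
  nlinarith [mul_le_mul_of_nonneg_left hexp hpos.le, sq_nonneg (z ^ 2)]

variable {n k : ℕ}

lemma isProbabilityMeasure_processLaw (hk : k ≤ n - 1) :
    IsProbabilityMeasure (processLaw n k) := by
  have := nonempty_colourSet hk
  unfold processLaw
  infer_instance

lemma mem_edges_iff {ω : Outcome n k} {m : ℕ} {e : KEdge n} :
    e ∈ ω.edges m ↔ (ω.1.position e : ℕ) < m := by
  refine ⟨?_, fun h => ⟨_, h, Equiv.apply_symm_apply (α := Fin (n.choose 2)) ω.1 e⟩⟩
  rintro ⟨i, hi, rfl⟩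
  have hpos : ω.1.position (ω.1.toFun i) = i :=
    Equiv.symm_apply_apply (α := Fin (n.choose 2)) ω.1 i
  rwa [hpos]

lemma processLaw_real_order (hk : k ≤ n - 1) (A : Set (EdgeOrder n)) :
    (processLaw n k).real {ω | ω.1 ∈ A} = (uniformOn (Set.univ : Set (EdgeOrder n))).real A := by
  have := nonempty_colourSet hk
  have hA : {ω : Outcome n k | ω.1 ∈ A} = A ×ˢ Set.univ := by ext; simp
  rw [processLaw, hA, measureReal_prod_prod, probReal_univ, mul_one]

open Classical in
lemma integral_ite_le_exp (hk : k ≤ n - 1) (G : Finset (Fin (n - 1)) → Prop) {z : ℝ}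
    (hz : 0 ≤ z) :
    ∫ a : ColourSet n k, (if G a.val then 1 else Real.exp (-z)) ∂uniformOn Set.univ ≤
      Real.exp (-((1 - colourProb n k G) * (z - z ^ 2 / 2))) := by
  have := nonempty_colourSet hk
  have hle : colourProb n k G ≤ 1 := measureReal_le_one
  have hind (a : ColourSet n k) : (if G a.val then (1 : ℝ) else Real.exp (-z)) =
      Real.exp (-z) + (1 - Real.exp (-z)) * {a : ColourSet n k | G a.val}.indicator 1 a := by
    by_cases h : G a.val <;> simp [h]
  calc ∫ a : ColourSet n k, (if G a.val then 1 else Real.exp (-z)) ∂uniformOn Set.univ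
      = Real.exp (-z) + (1 - Real.exp (-z)) * colourProb n k G := by
        simp_rw [hind]
        rw [integral_add .of_finite .of_finite, integral_const, probReal_univ, one_smul,
          integral_const_mul, integral_indicator_one (Set.toFinite _).measurableSet, colourProb]
    _ ≤ 1 - (1 - colourProb n k G) * (z - z ^ 2 / 2) := by
        nlinarith [exp_neg_le_quadratic hz]
    _ ≤ Real.exp (-((1 - colourProb n k G) * (z - z ^ 2 / 2))) := Real.one_sub_le_exp_neg _

open Classical in
lemma uniformOn_early_good_real_le {T R : Finset (KEdge n)} (hTR : Disjoint T R) {m₀ m₁ : ℕ}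
    (hT : #T ≤ m₀) (hm₀ : m₀ ≤ n.choose 2) (hm₁ : m₁ ≤ n.choose 2) (P G : KEdge n → Prop) :
    (uniformOn (Set.univ : Set (EdgeOrder n))).real
        {σ | (∀ e ∈ T, (σ.position e : ℕ) < m₁ ∧ P e) ∧
          ∀ e ∈ R, (σ.position e : ℕ) < m₀ → G e} ≤
      ((m₁ : ℝ) / (n.choose 2 : ℕ)) ^ #T * ((∏ e ∈ T, if P e then 1 else 0) *
        ∏ e ∈ R, if G e then 1 else Real.exp (-((m₀ - #T) / (n.choose 2 : ℕ)))) := by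
  by_cases hP : ∀ e ∈ T, P e
  · have hTQ : Disjoint T {e ∈ R | ¬ G e} := hTR.mono_right (filter_subset _ _)
    rw [prod_congr rfl fun e he => if_pos (hP e he), prod_const_one, one_mul, prod_ite,
      prod_const_one, one_mul, prod_const]
    refine le_trans (measureReal_mono fun σ hσ => ?_)
      (uniformOn_early_late_real_le hTQ hT hm₀ hm₁)
    refine ⟨fun e he => (hσ.1 e he).1, fun e he => not_lt.1 fun hlt => ?_⟩
    exact (mem_filter.1 he).2 (hσ.2 e (mem_filter.1 he).1 hlt)
  · have hempty : {σ : EdgeOrder n | (∀ e ∈ T, (σ.position e : ℕ) < m₁ ∧ P e) ∧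
        ∀ e ∈ R, (σ.position e : ℕ) < m₀ → G e} = ∅ :=
      Set.eq_empty_of_forall_notMem fun σ hσ => hP fun e he => (hσ.1 e he).2
    rw [hempty, measureReal_empty]
    positivity

/-- Edges outside `T` may be exposed one at a time, each being early with probability at least
`z` and independently bad; hence the exponential factor. -/
theorem processLaw_real_early_good_le (hk : k ≤ n - 1) {T R : Finset (KEdge n)}
    (hTR : Disjoint T R) {m₀ m₁ : ℕ} (hT : #T ≤ m₀) (hm₀ : m₀ ≤ n.choose 2)
    (hm₁ : m₁ ≤ n.choose 2) (P : KEdge n → Finset (Fin (n - 1)) → Prop)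
    (G : Finset (Fin (n - 1)) → Prop) {z : ℝ} (hz : z = (m₀ - #T) / (n.choose 2 : ℕ)) :
    (processLaw n k).real {ω | (∀ e ∈ T, e ∈ ω.edges m₁ ∧ P e (ω.colours e)) ∧
        ∀ e ∈ R, e ∈ ω.edges m₀ → G (ω.colours e)} ≤
      ((m₁ : ℝ) / (n.choose 2 : ℕ)) ^ #T * (∏ e ∈ T, colourProb n k (P e)) *
        Real.exp (-(#R * (1 - colourProb n k G) * (z - z ^ 2 / 2))) := by
  classical
  have := nonempty_colourSet hk
  have hz₀ : 0 ≤ z := hz ▸ div_nonneg (sub_nonneg.2 (Nat.cast_le.2 hT)) (Nat.cast_nonneg _)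
  let g (e : KEdge n) (a : ColourSet n k) : ℝ :=
    if e ∈ T then if P e a.val then 1 else 0 else if G a.val then 1 else Real.exp (-z)
  have hgT {e : KEdge n} (he : e ∈ T) (a : ColourSet n k) : g e a = if P e a.val then 1 else 0 :=
    if_pos he
  have hgR {e : KEdge n} (he : e ∈ R) (a : ColourSet n k) :
      g e a = if G a.val then 1 else Real.exp (-z) := if_neg fun heT => disjoint_left.1 hTR heT he
  have hslice (c : KEdge n → ColourSet n k) := by
    have h := uniformOn_early_good_real_le hTR hT hm₀ hm₁ (fun e => P e (c e).val)
      fun e => G (c e).val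
    rwa [← hz, ← prod_congr rfl fun e he => hgT he (c e),
      ← prod_congr rfl fun e he => hgR he (c e), ← prod_union hTR] at h
  have hintT {e : KEdge n} (he : e ∈ T) :
      ∫ a, g e a ∂uniformOn Set.univ = colourProb n k (P e) :=
    (integral_congr_ae (.of_forall (hgT he))).trans <|
      integral_indicator_one (s := {a : ColourSet n k | P e a.val}) (Set.toFinite _).measurableSet
  have hintR {e : KEdge n} (he : e ∈ R) : ∫ a, g e a ∂uniformOn Set.univ ≤
      Real.exp (-((1 - colourProb n k G) * (z - z ^ 2 / 2))) :=
    (integral_congr_ae (.of_forall (hgR he))).trans_le (integral_ite_le_exp hk G hz₀)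
  simp_rw [mem_edges_iff]
  calc (processLaw n k).real _
      = ∫ c, (uniformOn (Set.univ : Set (EdgeOrder n))).real _ ∂_ :=
        measureReal_prod_eq_integral _ _ (Set.toFinite _).measurableSet
    _ ≤ ∫ c, ((m₁ : ℝ) / (n.choose 2 : ℕ)) ^ #T * ∏ e ∈ T ∪ R, g e (c e)
          ∂Measure.pi fun _ : KEdge n => uniformOn Set.univ :=
        integral_mono .of_finite .of_finite hslice
    _ = ((m₁ : ℝ) / (n.choose 2 : ℕ)) ^ #T * ((∏ e ∈ T, colourProb n k (P e)) *
          ∏ e ∈ R, ∫ a, g e a ∂uniformOn Set.univ) := by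
        rw [integral_const_mul, integral_pi_finset_prod, prod_union hTR,
          prod_congr rfl fun e he => hintT he]
    _ ≤ ((m₁ : ℝ) / (n.choose 2 : ℕ)) ^ #T * ((∏ e ∈ T, colourProb n k (P e)) *
          ∏ _e ∈ R, Real.exp (-((1 - colourProb n k G) * (z - z ^ 2 / 2)))) := by
        gcongr with e he
        · exact prod_nonneg fun e _ => colourProb_nonneg _
        · exact hintR he
    _ = _ := by
        rw [prod_const, ← Real.exp_nat_mul]
        ring_nf

lemma processLaw_real_forall_early_good_le (hk : k ≤ n - 1) (R : Finset (KEdge n)) {m : ℕ}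
    (hm : m ≤ n.choose 2) (G : Finset (Fin (n - 1)) → Prop) {z : ℝ}
    (hz : z = m / (n.choose 2 : ℕ)) :
    (processLaw n k).real {ω | ∀ e ∈ R, e ∈ ω.edges m → G (ω.colours e)} ≤
      Real.exp (-(#R * (1 - colourProb n k G) * (z - z ^ 2 / 2))) := by
  have hle := processLaw_real_early_good_le (z := z) hk (disjoint_empty_left R)
    (Nat.zero_le m) hm hm (fun _ _ => True) G (by rw [hz, card_empty, Nat.cast_zero, sub_zero])
  simpa only [notMem_empty, false_imp_iff, implies_true, true_and, card_empty, pow_zero,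
    prod_empty, one_mul] using hle

end ProcessLaw

section Rado

open Finset

variable {α W : Type*} [DecidableEq α]

section UpdateErase

variable [DecidableEq W]

lemma biUnion_union_subset_update_erase (A : W → Finset α) {I J : Finset W} {w : W} (hI : w ∈ I)
    (hJ : w ∈ J) {x y : α} (hxy : x ≠ y) :
    (I ∪ J).biUnion A ⊆ I.biUnion (Function.update A w ((A w).erase x)) ∪
      J.biUnion (Function.update A w ((A w).erase y)) := by
  intro a ha
  obtain ⟨v, hv, hav⟩ := mem_biUnion.1 ha
  rw [mem_union, mem_biUnion, mem_biUnion]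
  by_cases hvw : v = w
  · subst hvw
    by_cases hax : a = x
    · exact .inr ⟨v, hJ, by simp [hav, hax ▸ hxy]⟩
    · exact .inl ⟨v, hI, by simp [hav, hax]⟩
  · exact (mem_union.1 hv).imp (fun hv => ⟨v, hv, by simpa [hvw] using hav⟩)
      fun hv => ⟨v, hv, by simpa [hvw] using hav⟩

lemma biUnion_erase_subset_update (A : W → Finset α) {I J : Finset W} (hIJ : I ⊆ J) (w : W)
    (B : Finset α) :
    (I.erase w).biUnion A ⊆ J.biUnion (Function.update A w B) := by
  intro a ha
  obtain ⟨v, hv, hav⟩ := mem_biUnion.1 ha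
  obtain ⟨hvw, hvI⟩ := mem_erase.1 hv
  exact mem_biUnion.2 ⟨v, hIJ hvI, by simpa [hvw] using hav⟩

lemma biUnion_update_of_notMem (A : W → Finset α) {I : Finset W} {w : W} (hw : w ∉ I)
    (B : Finset α) : I.biUnion (Function.update A w B) = I.biUnion A :=
  biUnion_congr rfl fun _ hv => Function.update_of_ne (ne_of_mem_of_not_mem hv hw) _ _

lemma card_le_biUnion_update_erase_or {r : Finset α → ℕ} (hmono : Monotone r)
    (hsub : ∀ A B, r (A ∪ B) + r (A ∩ B) ≤ r A + r B) {A : W → Finset α}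
    (hA : ∀ I : Finset W, #I ≤ r (I.biUnion A)) {w : W} {x y : α} (hxy : x ≠ y) :
    (∀ I : Finset W, #I ≤ r (I.biUnion (Function.update A w ((A w).erase x)))) ∨
      ∀ I : Finset W, #I ≤ r (I.biUnion (Function.update A w ((A w).erase y))) := by
  by_contra! hcon
  obtain ⟨⟨I, hI⟩, J, hJ⟩ := hcon
  have hmem {K : Finset W} {B : Finset α} (hK : r (K.biUnion (Function.update A w B)) < #K) :
      w ∈ K := by
    by_contra hw
    rw [biUnion_update_of_notMem A hw] at hK
    exact (hA K).not_gt hK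
  have hunion := (hA (I ∪ J)).trans <| hmono <|
    biUnion_union_subset_update_erase A (hmem hI) (hmem hJ) hxy
  have hinter := (hA ((I ∩ J).erase w)).trans <| hmono <| subset_inter
    (biUnion_erase_subset_update A (inter_subset_left (s₁ := I) (s₂ := J)) w ((A w).erase x))
    (biUnion_erase_subset_update A inter_subset_right w ((A w).erase y))
  rw [card_erase_of_mem (mem_inter.2 ⟨hmem hI, hmem hJ⟩)] at hinter
  have hIJ := card_union_add_card_inter I J
  have hr := hsub (I.biUnion (Function.update A w ((A w).erase x)))
    (J.biUnion (Function.update A w ((A w).erase y)))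
  omega

end UpdateErase

/-- **Rado's theorem** on independent transversals, for a monotone submodular function. -/
theorem exists_transversal_of_submodular [Finite W] {r : Finset α → ℕ} (hmono : Monotone r)
    (hempty : r ∅ = 0) (hsub : ∀ A B, r (A ∪ B) + r (A ∩ B) ≤ r A + r B) (A : W → Finset α)
    (hA : ∀ I : Finset W, #I ≤ r (I.biUnion A)) :
    ∃ f : W → α, (∀ w, f w ∈ A w) ∧ ∀ I : Finset W, #I ≤ r (I.image f) := by
  classical
  have := Fintype.ofFinite W
  induction hs : ∑ w, #(A w) using Nat.strong_induction_on generalizing A with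
  | _ s ih =>
  have hne (w : W) : (A w).Nonempty := by
    by_contra hw
    simpa [not_nonempty_iff_eq_empty.1 hw, hempty] using hA {w}
  by_cases hone : ∀ w, #(A w) ≤ 1
  · choose f hf using hne
    have hAf (w : W) : A w = {f w} :=
      eq_singleton_iff_unique_mem.2 ⟨hf w, fun x hx => card_le_one.1 (hone w) x hx _ (hf w)⟩
    refine ⟨f, hf, fun I => ?_⟩
    rw [← biUnion_singleton, ← biUnion_congr rfl fun w _ => hAf w]
    exact hA I
  push Not at hone
  obtain ⟨w, hw⟩ := hone
  obtain ⟨x, hx, y, hy, hxy⟩ := one_lt_card.1 hw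
  have herase {z : α} (hz : z ∈ A w)
      (h : ∀ I : Finset W, #I ≤ r (I.biUnion (Function.update A w ((A w).erase z)))) :
      ∃ f : W → α, (∀ w, f w ∈ A w) ∧ ∀ I : Finset W, #I ≤ r (I.image f) := by
    have hle : Function.update A w ((A w).erase z) ≤ A :=
      update_le_self_iff.2 (erase_subset _ _)
    have hlt : ∑ v, #(Function.update A w ((A w).erase z) v) < s := hs ▸
      sum_lt_sum (fun v _ => card_le_card (hle v))
        ⟨w, mem_univ _, by simpa only [Function.update_self] using card_erase_lt_of_mem hz⟩
    obtain ⟨f, hf, hr⟩ := ih _ hlt _ h rfl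
    exact ⟨f, fun v => hle v (hf v), hr⟩
  exact (card_le_biUnion_update_erase_or hmono hsub hA hxy).elim (herase hx) (herase hy)

end Rado

section CutSpace

open Finset

lemma finrank_fun_eq_natCard {α : Type*} [Finite α] : Module.finrank ℚ (α → ℚ) = Nat.card α := by
  have := Fintype.ofFinite α
  rw [Module.finrank_fintype_fun_eq_card, Nat.card_eq_fintype_card]

variable {V : Type*} {G : SimpleGraph V}

/-- The rational functions on the vertices that are constant along every edge of `E`; the dimension
of this space is the number of components of the graph with edge set `E`. -/
def cutSpace (E : Finset G.edgeSet) : Submodule ℚ (V → ℚ) where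
  carrier := {g | ∀ e ∈ E, ∀ x ∈ (e : Sym2 V), ∀ y ∈ (e : Sym2 V), g x = g y}
  add_mem' hg hh e he x hx y hy := congrArg₂ (· + ·) (hg e he x hx y hy) (hh e he x hx y hy)
  zero_mem' _ _ _ _ _ _ := rfl
  smul_mem' c _ hg e he x hx y hy := congrArg (c • ·) (hg e he x hx y hy)

lemma mem_cutSpace {E : Finset G.edgeSet} {g : V → ℚ} : g ∈ cutSpace E ↔
    ∀ e ∈ E, ∀ x ∈ (e : Sym2 V), ∀ y ∈ (e : Sym2 V), g x = g y := Iff.rfl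

lemma one_mem_cutSpace (E : Finset G.edgeSet) : (fun _ => 1 : V → ℚ) ∈ cutSpace E :=
  fun _ _ _ _ _ _ => rfl

/-- The number of components of the graph with edge set `E`, encoded as a dimension so that its
supermodularity is the dimension formula. -/
noncomputable def numComps (E : Finset G.edgeSet) : ℕ := Module.finrank ℚ (cutSpace E)

lemma cutSpace_anti {E F : Finset G.edgeSet} (h : E ⊆ F) : cutSpace F ≤ cutSpace E :=
  fun _ hg e he => hg e (h he)

lemma cutSpace_empty : cutSpace (∅ : Finset G.edgeSet) = ⊤ := by
  ext g
  simp [mem_cutSpace]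

lemma cutSpace_union [DecidableEq G.edgeSet] (E F : Finset G.edgeSet) :
    cutSpace (E ∪ F) = cutSpace E ⊓ cutSpace F := by
  ext g
  simp only [Submodule.mem_inf, mem_cutSpace, mem_union, or_imp, forall_and]

lemma numComps_le_one {E : Finset G.edgeSet}
    (h : ∀ g ∈ cutSpace E, ∀ x y : V, g x = g y) : numComps E ≤ 1 := by
  refine finrank_le_one (⟨_, one_mem_cutSpace E⟩ : cutSpace E) fun g => ?_
  rcases isEmpty_or_nonempty V with hV | ⟨⟨x⟩⟩
  · exact ⟨0, Subsingleton.elim _ _⟩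
  · refine ⟨g.1 x, Subtype.ext (funext fun y => ?_)⟩
    simpa using h g.1 g.2 x y

variable [Finite V]

lemma numComps_anti {E F : Finset G.edgeSet} (h : E ⊆ F) : numComps F ≤ numComps E :=
  Submodule.finrank_mono (cutSpace_anti h)

lemma numComps_le_card (E : Finset G.edgeSet) : numComps E ≤ Nat.card V :=
  (Submodule.finrank_le _).trans_eq finrank_fun_eq_natCard

lemma numComps_empty : numComps (∅ : Finset G.edgeSet) = Nat.card V := by
  rw [numComps, cutSpace_empty, finrank_top, finrank_fun_eq_natCard]

lemma eq_of_numComps_le_one {E : Finset G.edgeSet} (h : numComps E ≤ 1) {g : V → ℚ}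
    (hg : g ∈ cutSpace E) (x y : V) : g x = g y := by
  obtain ⟨v, hv⟩ := finrank_le_one_iff.1 h
  obtain ⟨a, ha⟩ := hv ⟨_, one_mem_cutSpace E⟩
  obtain ⟨b, hb⟩ := hv ⟨g, hg⟩
  have hav (z : V) : a * v.1 z = 1 := congrFun (congrArg Subtype.val ha) z
  have hbv (z : V) : b * v.1 z = g z := congrFun (congrArg Subtype.val hb) z
  have ha₀ : a ≠ 0 := left_ne_zero_of_mul_eq_one (hav x)
  rw [← hbv x, ← hbv y, mul_left_cancel₀ ha₀ ((hav x).trans (hav y).symm)]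

lemma numComps_add_le [DecidableEq G.edgeSet] (E F : Finset G.edgeSet) :
    numComps E + numComps F ≤ numComps (E ∪ F) + numComps (E ∩ F) := by
  have hdim := Submodule.finrank_sup_add_finrank_inf_eq (cutSpace E) (cutSpace F)
  have hsup : cutSpace E ⊔ cutSpace F ≤ cutSpace (E ∩ F) :=
    sup_le (cutSpace_anti inter_subset_left) (cutSpace_anti inter_subset_right)
  rw [← cutSpace_union] at hdim
  have hinter := Submodule.finrank_mono hsup
  unfold numComps
  omega

lemma card_le_numComps_singleton_add_one (e : G.edgeSet) :
    Nat.card V ≤ numComps {e} + 1 := by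
  obtain ⟨e, he⟩ := e
  induction e using Sym2.ind with
  | _ a b =>
  let φ : (V → ℚ) →ₗ[ℚ] ℚ := LinearMap.proj a - LinearMap.proj (R := ℚ) (φ := fun _ => ℚ) b
  have hker : LinearMap.ker φ ≤ cutSpace {⟨s(a, b), he⟩} := by
    intro g hg
    have hab : g a = g b := by simpa [φ, sub_eq_zero] using hg
    rintro e he x hx y hy
    rw [mem_singleton.1 he, Sym2.mem_iff] at hx hy
    rcases hx with rfl | rfl <;> rcases hy with rfl | rfl <;> simp only [hab]
  have hdim := LinearMap.finrank_range_add_finrank_ker φ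
  have hrange := Submodule.finrank_le (LinearMap.range φ)
  have hcut := Submodule.finrank_mono hker
  rw [finrank_fun_eq_natCard] at hdim
  rw [Module.finrank_self] at hrange
  unfold numComps
  omega

lemma numComps_le_insert [DecidableEq G.edgeSet] (E : Finset G.edgeSet) (e : G.edgeSet) :
    numComps E ≤ numComps (insert e E) + 1 := by
  have hadd := numComps_add_le E {e}
  have hsingle := card_le_numComps_singleton_add_one e
  have hinter := numComps_le_card (E ∩ {e})
  rw [union_comm, ← insert_eq] at hadd
  omega

lemma numComps_le_union [DecidableEq G.edgeSet] (E X : Finset G.edgeSet) :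
    numComps E ≤ numComps (E ∪ X) + #X := by
  induction X using Finset.induction_on with
  | empty => simp
  | insert e X he ih =>
    have hinsert := numComps_le_insert (E ∪ X) e
    rw [union_insert, card_insert_of_notMem he]
    omega

lemma exists_spanningForest (E : Finset G.edgeSet) :
    ∃ T ⊆ E, #T + numComps E = Nat.card V ∧ cutSpace T = cutSpace E := by
  classical
  induction E using Finset.induction_on with
  | empty => exact ⟨∅, subset_rfl, by simp [numComps_empty], rfl⟩
  | insert e E he ih =>
    obtain ⟨T, hT, hcard, hspace⟩ := ih
    by_cases h : cutSpace (insert e E) = cutSpace E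
    · refine ⟨T, hT.trans (subset_insert _ _), ?_, hspace.trans h.symm⟩
      rwa [numComps, h]
    · have hlt : numComps (insert e E) < numComps E :=
        Submodule.finrank_lt_finrank_of_lt (lt_of_le_of_ne (cutSpace_anti (subset_insert _ _)) h)
      have hle := numComps_le_insert E e
      refine ⟨insert e T, insert_subset_insert _ hT, ?_, ?_⟩
      · rw [card_insert_of_notMem fun h => he (hT h)]
        omega
      · rw [insert_eq, insert_eq, cutSpace_union, cutSpace_union, hspace]

end CutSpace

section GraphOf

open Finset

variable {V : Type*} {G : SimpleGraph V}

/-- The graph on `V` whose edges are the elements of `E`. -/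
def graphOf (E : Finset G.edgeSet) : SimpleGraph V :=
  SimpleGraph.fromEdgeSet (Subtype.val '' (E : Set G.edgeSet))

lemma graphOf_edgeSet (E : Finset G.edgeSet) :
    (graphOf E).edgeSet = Subtype.val '' (E : Set G.edgeSet) := by
  rw [graphOf, SimpleGraph.edgeSet_fromEdgeSet, sdiff_eq_left, Set.disjoint_left]
  rintro _ ⟨e, -, rfl⟩ h
  exact SimpleGraph.not_isDiag_of_mem_edgeSet _ e.2 h

lemma exists_mem_of_graphOf_adj {E : Finset G.edgeSet} {x y : V} (h : (graphOf E).Adj x y) :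
    ∃ e ∈ E, (e : Sym2 V) = s(x, y) := by
  rw [graphOf, SimpleGraph.fromEdgeSet_adj] at h
  exact h.1

lemma graphOf_reachable_of_mem {E : Finset G.edgeSet} {e : G.edgeSet} (he : e ∈ E) {x y : V}
    (hx : x ∈ (e : Sym2 V)) (hy : y ∈ (e : Sym2 V)) : (graphOf E).Reachable x y := by
  by_cases hxy : x = y
  · rw [hxy]
  · have hadj : (graphOf E).Adj x y := (SimpleGraph.fromEdgeSet_adj _).2
      ⟨⟨e, he, (Sym2.mem_and_mem_iff hxy).1 ⟨hx, hy⟩⟩, hxy⟩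
    exact hadj.reachable

lemma eq_of_mem_cutSpace_of_reachable {E : Finset G.edgeSet} {g : V → ℚ} (hg : g ∈ cutSpace E)
    {x y : V} (h : (graphOf E).Reachable x y) : g x = g y := by
  obtain ⟨p⟩ := h
  induction p with
  | nil => rfl
  | cons hadj _ ih =>
    obtain ⟨e, he, hxy⟩ := exists_mem_of_graphOf_adj hadj
    rw [← ih]
    exact hg e he _ (by simp [hxy]) _ (by simp [hxy])

variable [Finite V]

lemma connected_of_numComps_le_one [Nonempty V] {E : Finset G.edgeSet} (h : numComps E ≤ 1) :
    (graphOf E).Connected := by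
  classical
  refine (SimpleGraph.connected_iff _).2 ⟨fun x y => ?_, inferInstance⟩
  have hind : (fun z => if (graphOf E).Reachable x z then 1 else 0 : V → ℚ) ∈ cutSpace E := by
    intro e he a ha b hb
    have hab := graphOf_reachable_of_mem he ha hb
    have hiff : (graphOf E).Reachable x a ↔ (graphOf E).Reachable x b :=
      ⟨fun h => h.trans hab, fun h => h.trans hab.symm⟩
    simp only [hiff]
  simpa using eq_of_numComps_le_one h hind x y

lemma numComps_le_card_connectedComponent (E : Finset G.edgeSet) :
    numComps E ≤ Nat.card (graphOf E).ConnectedComponent := by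
  let φ : cutSpace E →ₗ[ℚ] ((graphOf E).ConnectedComponent → ℚ) :=
    (LinearMap.funLeft ℚ ℚ Quot.out).comp (cutSpace E).subtype
  have hφ : Function.Injective φ := fun g h hgh => Subtype.ext <| funext fun x => by
    have hx : (graphOf E).Reachable x ((graphOf E).connectedComponentMk x).out :=
      SimpleGraph.ConnectedComponent.exact (Quot.out_eq _).symm
    rw [eq_of_mem_cutSpace_of_reachable g.2 hx, eq_of_mem_cutSpace_of_reachable h.2 hx]
    exact congrFun hgh _
  have hdim := LinearMap.finrank_le_finrank_of_injective hφ
  rwa [finrank_fun_eq_natCard] at hdim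

end GraphOf

section Cuts

open Finset

variable {V : Type*} {G : SimpleGraph V} [Fintype G.edgeSet]

open Classical in
/-- The edges of `G` between `U` and its complement. -/
noncomputable def cutEdges (U : Finset V) : Finset G.edgeSet :=
  {e | (∃ x ∈ (e : Sym2 V), x ∈ U) ∧ ∃ x ∈ (e : Sym2 V), x ∉ U}

lemma mem_cutEdges {U : Finset V} {e : G.edgeSet} : e ∈ cutEdges U ↔
    (∃ x ∈ (e : Sym2 V), x ∈ U) ∧ ∃ x ∈ (e : Sym2 V), x ∉ U := by
  simp [cutEdges]

lemma mem_cutEdges_of_eq {U : Finset V} {e : G.edgeSet} {a b : V} (he : (e : Sym2 V) = s(a, b)) :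
    e ∈ cutEdges U ↔ ¬ (a ∈ U ↔ b ∈ U) := by
  rw [mem_cutEdges, he]
  simp only [Sym2.mem_iff, exists_eq_or_imp, exists_eq_left]
  tauto

lemma exists_mem_cutEdges_of_connected {E : Finset G.edgeSet} (h : (graphOf E).Connected)
    {U : Finset V} {x y : V} (hx : x ∈ U) (hy : y ∉ U) : ∃ e ∈ E, e ∈ cutEdges U := by
  obtain ⟨p⟩ := h.preconnected x y
  obtain ⟨d, -, hfst, hsnd⟩ := p.exists_boundary_dart (U : Set V) hx hy
  obtain ⟨e, he, heq⟩ := exists_mem_of_graphOf_adj d.adj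
  exact ⟨e, he, (mem_cutEdges_of_eq heq).2 fun hiff => hsnd (hiff.1 hfst)⟩

lemma mem_cutEdges_symmDiff [DecidableEq V] {U A : Finset V} {e : G.edgeSet} :
    e ∈ cutEdges (symmDiff U A) ↔ ¬ (e ∈ cutEdges U ↔ e ∈ cutEdges A) := by
  obtain ⟨⟨a, b⟩, he⟩ := e
  have hab (S : Finset V) : (⟨s(a, b), he⟩ : G.edgeSet) ∈ cutEdges S ↔ ¬ (a ∈ S ↔ b ∈ S) :=
    mem_cutEdges_of_eq rfl
  rw [show (⟨Quot.mk _ (a, b), he⟩ : G.edgeSet) = ⟨s(a, b), he⟩ from rfl, hab, hab, hab,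
    mem_symmDiff, mem_symmDiff]
  tauto

section Complement

variable [Fintype V] [DecidableEq V]

lemma cutEdges_compl (U : Finset V) : (cutEdges Uᶜ : Finset G.edgeSet) = cutEdges U := by
  ext e
  simp only [mem_cutEdges, mem_compl, not_not]
  exact and_comm

lemma exists_cutEdges_eq_of_two_mul_card_le (U : Finset V) :
    ∃ U' : Finset V, (cutEdges U' : Finset G.edgeSet) = cutEdges U ∧
      2 * #U' ≤ Fintype.card V ∧ min #U #Uᶜ ≤ #U' := by
  have hsum := card_add_card_compl U
  rcases le_total #U #Uᶜ with hle | hle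
  · exact ⟨U, rfl, by omega, min_le_left _ _⟩
  · exact ⟨Uᶜ, cutEdges_compl U, by omega, min_le_right _ _⟩

end Complement

lemma card_cutEdges_top [Fintype V] [Fintype (⊤ : SimpleGraph V).edgeSet] (U : Finset V) :
    #(cutEdges U : Finset (⊤ : SimpleGraph V).edgeSet) = #U * (Fintype.card V - #U) := by
  classical
  rw [← card_compl, ← card_product]
  have hne {p : V × V} (hp : p ∈ U ×ˢ Uᶜ) : p.1 ≠ p.2 :=
    ne_of_mem_of_not_mem (mem_product.1 hp).1 (mem_compl.1 (mem_product.1 hp).2)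
  refine (card_bij (fun p hp => ⟨s(p.1, p.2), by simpa using hne hp⟩) ?_ ?_ ?_).symm
  · intro p hp
    rw [mem_product, mem_compl] at hp
    exact (mem_cutEdges_of_eq rfl).2 fun hiff => hp.2 (hiff.1 hp.1)
  · intro p hp q hq h
    rw [mem_product, mem_compl] at hp hq
    rcases Sym2.eq_iff.1 (congrArg Subtype.val h) with ⟨h₁, h₂⟩ | ⟨h₁, -⟩
    · exact Prod.ext h₁ h₂
    · exact absurd (h₁ ▸ hp.1) hq.2
  · intro e he
    obtain ⟨⟨x, hx, hxU⟩, y, hy, hyU⟩ := mem_cutEdges.1 he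
    exact ⟨(x, y), by simp [hxU, hyU], Subtype.ext
      ((Sym2.mem_and_mem_iff (ne_of_mem_of_not_mem hxU hyU)).1 ⟨hx, hy⟩).symm⟩

lemma numComps_union_le_one_of_maximal [Finite V] [DecidableEq G.edgeSet] {E F : Finset G.edgeSet}
    (hF : (graphOf F).Connected) {U : Finset V} (hU : Disjoint E (cutEdges U))
    (hmax : ∀ U' : Finset V, Disjoint E (cutEdges U') →
      #(cutEdges U' ∩ F) ≤ #(cutEdges U ∩ F)) :
    numComps (E ∪ cutEdges U ∩ F) ≤ 1 := by
  refine numComps_le_one fun g hg x y => ?_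
  classical
  have := Fintype.ofFinite V
  by_contra hxy
  let A : Finset V := {z | g z = g x}
  have hA {e : G.edgeSet} (he : e ∈ E ∪ cutEdges U ∩ F) : e ∉ cutEdges A := by
    rw [mem_cutEdges]
    rintro ⟨⟨a, ha, haA⟩, b, hb, hbA⟩
    exact hbA (mem_filter_univ b |>.2 ((hg e he b hb a ha).trans (mem_filter_univ a |>.1 haA)))
  obtain ⟨f, hfF, hfA⟩ := exists_mem_cutEdges_of_connected hF (U := A) (x := x) (y := y)
    (by simp [A]) (by simpa [A] using Ne.symm hxy)
  have hfU : f ∉ cutEdges U := fun h => hA (mem_union_right _ (mem_inter.2 ⟨h, hfF⟩)) hfA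
  have hdisj : Disjoint E (cutEdges (symmDiff U A)) := disjoint_left.2 fun e he =>
    mem_cutEdges_symmDiff.not.2 <| not_not.2 <|
      iff_of_false (disjoint_left.1 hU he) (hA (mem_union_left _ he))
  have hsub : insert f (cutEdges U ∩ F) ⊆ cutEdges (symmDiff U A) ∩ F := by
    refine insert_subset (mem_inter.2 ⟨mem_cutEdges_symmDiff.2 ?_, hfF⟩) fun e he => ?_
    · exact fun hiff => hfU (hiff.2 hfA)
    · obtain ⟨heU, heF⟩ := mem_inter.1 he
      exact mem_inter.2 ⟨mem_cutEdges_symmDiff.2 fun hiff =>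
        hA (mem_union_right _ he) (hiff.1 heU), heF⟩
  have hcard := (card_le_card hsub).trans (hmax _ hdisj)
  rw [card_insert_of_notMem fun h => hfU (mem_inter.1 h).1] at hcard
  omega

theorem exists_cut_many_crossing [Fintype V] [DecidableEq G.edgeSet] {E F : Finset G.edgeSet}
    (hF : (graphOf F).Connected) (hE : 2 ≤ numComps E) :
    ∃ U : Finset V, 1 ≤ #U ∧ 2 * #U ≤ Fintype.card V ∧ Disjoint E (cutEdges U) ∧
      numComps E ≤ #(cutEdges U ∩ F) + 1 := by
  classical
  obtain ⟨U, hU, hmax⟩ := exists_max_image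
    ({U | Disjoint E (cutEdges U)} : Finset (Finset V)) (fun U => #(cutEdges U ∩ F))
    ⟨∅, by simp [disjoint_left, mem_cutEdges]⟩
  simp only [mem_filter_univ] at hU hmax
  have hone := numComps_union_le_one_of_maximal hF hU hmax
  have hunion := numComps_le_union E (cutEdges U ∩ F)
  obtain ⟨U', hcut, hhalf, -⟩ := exists_cutEdges_eq_of_two_mul_card_le (G := G) U
  have hne : 0 < #(cutEdges U' ∩ F) := by
    rw [hcut]
    omega
  obtain ⟨e, he⟩ := card_pos.1 hne
  obtain ⟨⟨x, -, hx⟩, -⟩ := mem_cutEdges.1 (mem_inter.1 he).1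
  exact ⟨U', card_pos.2 ⟨x, hx⟩, hhalf, hcut ▸ hU, by rw [hcut]; omega⟩

open Classical in
lemma card_le_card_preimage_connectedComponentMk [Fintype V] (H : SimpleGraph V)
    (S : Finset H.ConnectedComponent) : #S ≤ #{x | H.connectedComponentMk x ∈ S} := by
  refine card_le_card_of_surjOn H.connectedComponentMk fun c hc => ?_
  induction c using SimpleGraph.ConnectedComponent.ind with | _ x
  exact ⟨x, by simpa using hc, rfl⟩

/-- Half of the components make up a cut that respects `E`. -/
theorem exists_balanced_cut [Fintype V] (E : Finset G.edgeSet) :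
    ∃ U : Finset V, numComps E ≤ 2 * #U + 1 ∧ 2 * #U ≤ Fintype.card V ∧
      Disjoint E (cutEdges U) := by
  classical
  have := Fintype.ofFinite (graphOf E).ConnectedComponent
  have hcard := numComps_le_card_connectedComponent E
  obtain ⟨S, -, hS⟩ := exists_subset_card_eq
    (s := (univ : Finset (graphOf E).ConnectedComponent))
    (n := Fintype.card (graphOf E).ConnectedComponent / 2) (Nat.div_le_self _ _)
  let U : Finset V := {x | (graphOf E).connectedComponentMk x ∈ S}
  have hU : #S ≤ #U := card_le_card_preimage_connectedComponentMk _ S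
  have hUc : #Sᶜ ≤ #Uᶜ := by
    convert card_le_card_preimage_connectedComponentMk (graphOf E) Sᶜ using 2
    ext x
    simp [U]
  have hcut : Disjoint E (cutEdges U) := by
    refine disjoint_left.2 fun e he heU => ?_
    obtain ⟨⟨x, hx, hxU⟩, y, hy, hyU⟩ := mem_cutEdges.1 heU
    have hxy := SimpleGraph.ConnectedComponent.sound (graphOf_reachable_of_mem he hx hy)
    simp only [U, mem_filter_univ, hxy] at hxU hyU
    exact hyU hxU
  obtain ⟨U', hU', hhalf, hmin⟩ := exists_cutEdges_eq_of_two_mul_card_le (G := G) U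
  rw [Nat.card_eq_fintype_card] at hcard
  rw [card_compl] at hUc
  exact ⟨U', by omega, hhalf, hU' ▸ hcut⟩

end Cuts

section Rainbow

open Finset

section Transversal

variable {V : Type*} [Finite V] {G : SimpleGraph V}

lemma isTree_graphOf_of_card_le {F : Finset G.edgeSet} (hconn : (graphOf F).Connected)
    (hF : #F + 1 ≤ Nat.card V) : (graphOf F).IsTree := by
  have hcard : Nat.card (graphOf F).edgeSet = #F := by
    rw [graphOf_edgeSet, Nat.card_image_of_injective Subtype.val_injective]
    simp
  have hle := hconn.card_vert_le_card_edgeSet_add_one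
  exact SimpleGraph.isTree_iff_connected_and_card.2 ⟨hconn, by omega⟩

/-- Rado's theorem for the cycle matroid, whose rank function is
`E ↦ Nat.card V - numComps E`. -/
theorem exists_tree_transversal {W : Type*} [Fintype W] [DecidableEq G.edgeSet]
    (hW : Nat.card V = Fintype.card W + 1) (A : W → Finset G.edgeSet)
    (hA : ∀ I : Finset W, numComps (I.biUnion A) + #I ≤ Nat.card V) :
    ∃ f : W → G.edgeSet, (∀ w, f w ∈ A w) ∧ Function.Injective f ∧
      (graphOf (univ.image f)).IsTree := by
  classical
  have hle := numComps_le_card (G := G)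
  obtain ⟨f, hfA, hf⟩ := exists_transversal_of_submodular
    (r := fun E : Finset G.edgeSet => Nat.card V - numComps E)
    (fun E F hEF => Nat.sub_le_sub_left (numComps_anti hEF) _) (by simp [numComps_empty])
    (fun E F => by
      have hadd := numComps_add_le E F
      have := hle E
      have := hle F
      have := hle (E ∪ F)
      have := hle (E ∩ F)
      omega) A (fun I => by
      have := hA I
      omega)
  have hrank := hf univ
  have hcomps := hle (univ.image f)
  have himage : #(univ.image f) ≤ Fintype.card W := card_image_le
  rw [card_univ] at hrank
  have : Nonempty V := (Nat.card_pos_iff.1 (by omega)).1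
  have htree : (graphOf (univ.image f)).IsTree :=
    isTree_graphOf_of_card_le (connected_of_numComps_le_one (by omega)) (by omega)
  refine ⟨f, hfA, fun v w hvw => ?_, htree⟩
  have hone := hf ({v, w} : Finset W)
  by_contra hne
  rw [card_pair hne, image_insert, image_singleton, hvw, pair_eq_singleton] at hone
  have := card_le_numComps_singleton_add_one (f w)
  omega

end Transversal

variable {n k : ℕ}

open Classical in
/-- The set `E_m` of the first `m` edges, as a finset. -/
noncomputable def firstEdges (ω : Outcome n k) (m : ℕ) : Finset (KEdge n) := {e | e ∈ ω.edges m}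

lemma mem_firstEdges {ω : Outcome n k} {m : ℕ} {e : KEdge n} :
    e ∈ firstEdges ω m ↔ e ∈ ω.edges m := by simp [firstEdges]

lemma edges_mono (ω : Outcome n k) : Monotone ω.edges := fun _ _ h e he => by
  rw [mem_edges_iff] at he ⊢
  exact he.trans_le h

lemma graphOf_firstEdges (ω : Outcome n k) (m : ℕ) : graphOf (firstEdges ω m) = ω.graph m := by
  simp [graphOf, Outcome.graph, firstEdges]

lemma edgeSet_graph (ω : Outcome n k) (m : ℕ) :
    (ω.graph m).edgeSet = Subtype.val '' ω.edges m := by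
  simp [← graphOf_firstEdges, graphOf_edgeSet, firstEdges]

/-- The edges among the first `m` that have a colour in `I`. -/
noncomputable def colouredEdges (ω : Outcome n k) (m : ℕ) (I : Finset (Fin (n - 1))) :
    Finset (KEdge n) := {e ∈ firstEdges ω m | ¬ Disjoint (ω.colours e) I}

lemma mem_colouredEdges {ω : Outcome n k} {m : ℕ} {I : Finset (Fin (n - 1))} {e : KEdge n} :
    e ∈ colouredEdges ω m I ↔ e ∈ ω.edges m ∧ ¬ Disjoint (ω.colours e) I := by
  simp [colouredEdges, mem_firstEdges]

lemma mem_colouredEdges_singleton {ω : Outcome n k} {m : ℕ} {w : Fin (n - 1)} {e : KEdge n} :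
    e ∈ colouredEdges ω m {w} ↔ e ∈ ω.edges m ∧ w ∈ ω.colours e := by
  rw [mem_colouredEdges, disjoint_singleton_right, not_not]

open Classical in
lemma biUnion_colouredEdges_singleton (ω : Outcome n k) (m : ℕ) (I : Finset (Fin (n - 1))) :
    I.biUnion (fun w => colouredEdges ω m {w}) = colouredEdges ω m I := by
  ext e
  simp only [mem_biUnion, mem_colouredEdges_singleton]
  rw [mem_colouredEdges, not_disjoint_iff]
  tauto

theorem hasRainbowTree_of_numComps (hn : 2 ≤ n) (ω : Outcome n k) (m : ℕ)
    (h : ∀ I : Finset (Fin (n - 1)), numComps (colouredEdges ω m I) + #I ≤ n) :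
    ω.HasRainbowTree m := by
  classical
  have : Nonempty (Fin (n - 1)) := ⟨⟨0, by omega⟩⟩
  obtain ⟨f, hf, hinj, htree⟩ := exists_tree_transversal
    (by simp only [Nat.card_eq_fintype_card, Fintype.card_fin]; omega)
    (fun w => colouredEdges ω m {w})
    (fun I => by
      rw [biUnion_colouredEdges_singleton, Nat.card_eq_fintype_card, Fintype.card_fin]
      exact h I)
  have hmem {e : KEdge n} (he : (e : Sym2 (Fin n)) ∈ (graphOf (univ.image f)).edgeSet) :
      ∃ w, f w = e := by
    rw [graphOf_edgeSet, Subtype.val_injective.mem_set_image] at he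
    simpa using he
  have hcoloured (w : Fin (n - 1)) := mem_colouredEdges_singleton.1 (hf w)
  refine ⟨_, SimpleGraph.fromEdgeSet_mono (Set.image_mono fun e he => ?_), htree,
    Function.invFun f, fun e he e' he' heq => ?_, fun e he => ?_⟩
  · obtain ⟨w, -, rfl⟩ := mem_image.1 (mem_coe.1 he)
    exact (hcoloured w).1
  · obtain ⟨w, rfl⟩ := hmem he
    obtain ⟨w', rfl⟩ := hmem he'
    rw [Function.leftInverse_invFun hinj w, Function.leftInverse_invFun hinj w'] at heq
    rw [heq]
  · obtain ⟨w, rfl⟩ := hmem he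
    rw [Function.leftInverse_invFun hinj w]
    exact (hcoloured w).2

lemma isConn_of_hasRainbowTree {ω : Outcome n k} {m : ℕ} (h : ω.HasRainbowTree m) : ω.IsConn m :=
  let ⟨_, hT, htree, _⟩ := h
  htree.connected.mono hT

lemma allColours_of_hasRainbowTree {ω : Outcome n k} {m : ℕ} (h : ω.HasRainbowTree m) :
    ω.AllColours m := by
  obtain ⟨T, hT, htree, f, hinj, hf⟩ := h
  let ι (e : T.edgeSet) : KEdge n := ⟨e, SimpleGraph.edgeSet_mono le_top e.2⟩
  have hι : Function.Injective (f ∘ ι) := fun e e' heq =>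
    Subtype.ext (congrArg Subtype.val (hinj e.2 e'.2 heq : ι e = ι e') :)
  have hcard := (SimpleGraph.isTree_iff_connected_and_card.1 htree).2
  rw [Nat.card_eq_fintype_card (α := Fin n), Fintype.card_fin] at hcard
  have hbij := hι.bijective_of_nat_card_le
    (by rw [Nat.card_eq_fintype_card (α := Fin (n - 1)), Fintype.card_fin]; omega)
  intro w
  obtain ⟨e, rfl⟩ := hbij.surjective w
  refine ⟨ι e, ?_, hf _ e.2⟩
  have he := SimpleGraph.edgeSet_mono hT e.2
  rwa [edgeSet_graph, ← Subtype.coe_mk (p := (· ∈ (⊤ : SimpleGraph (Fin n)).edgeSet)) e (ι e).2,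
    Subtype.val_injective.mem_set_image] at he

end Rainbow

section MinimalViolation

open Finset

section Cover

variable {V : Type*} {G : SimpleGraph V}

lemma exists_mem_of_cutSpace_le {T E : Finset G.edgeSet} (h : cutSpace T ≤ cutSpace E)
    {e : G.edgeSet} (he : e ∈ E) {x : V} (hx : x ∈ (e : Sym2 V)) :
    ∃ f ∈ T, x ∈ (f : Sym2 V) := by
  classical
  by_contra! hT
  have hsingle : (Pi.single x 1 : V → ℚ) ∈ cutSpace T := fun f hf a ha b hb => by
    rw [Pi.single_eq_of_ne (ne_of_mem_of_not_mem ha (hT f hf)),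
      Pi.single_eq_of_ne (ne_of_mem_of_not_mem hb (hT f hf))]
  have heq := h hsingle e he x hx _ (Sym2.other_mem hx)
  have hne : Sym2.Mem.other hx ≠ x := Sym2.other_ne (G.not_isDiag_of_mem_edgeSet e.2) hx
  rw [Pi.single_eq_same, Pi.single_eq_of_ne hne] at heq
  exact one_ne_zero heq

lemma mem_of_isolated_of_cutSpace_le {T E E' : Finset G.edgeSet} (hT : cutSpace T ≤ cutSpace E)
    (hE' : cutSpace E' ≤ cutSpace E) (hsub : E' ⊆ E) {e : G.edgeSet} (he : e ∈ E)
    (hiso : ∀ x ∈ (e : Sym2 V), ∀ f ∈ T, f ≠ e → x ∉ (f : Sym2 V)) : e ∈ E' := by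
  classical
  obtain ⟨a, ha⟩ : ∃ a, a ∈ (e : Sym2 V) := ⟨_, Sym2.out_fst_mem _⟩
  obtain ⟨f, hf, haf⟩ := exists_mem_of_cutSpace_le hE' he ha
  have hind : (fun z => if z ∈ (e : Sym2 V) then 1 else 0 : V → ℚ) ∈ cutSpace T := by
    intro g hg x hx y hy
    by_cases hge : g = e
    · exact if_congr (iff_of_true (hge ▸ hx) (hge ▸ hy)) rfl rfl
    · exact if_congr (iff_of_false (fun h => hiso x h g hg hge hx)
        fun h => hiso y h g hg hge hy) rfl rfl
  have heq := hT hind f (hsub hf) a haf _ (Sym2.other_mem haf)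
  have hother : Sym2.Mem.other haf ∈ (e : Sym2 V) := by
    by_contra hnot
    exact one_ne_zero ((if_pos ha).symm.trans (heq.trans (if_neg hnot)))
  have hne := Sym2.other_ne (G.not_isDiag_of_mem_edgeSet f.2) haf
  have hfe : f = e := Subtype.ext <|
    ((Sym2.mem_and_mem_iff hne).1 ⟨Sym2.other_mem haf, haf⟩).trans
      ((Sym2.mem_and_mem_iff hne).1 ⟨hother, ha⟩).symm
  exact hfe ▸ hf

/-- Every vertex of degree one lies on an edge of `T`, and an edge outside `D` has at most one such
end, so `S` has at most `#T + #D` vertices of degree one. -/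
lemma two_mul_card_cover_le {T D : Finset G.edgeSet} (hD : D ⊆ T) {S : Finset V}
    (hS : ∀ x ∈ S, ∃ e ∈ T, x ∈ (e : Sym2 V))
    (h : ∀ e ∈ T, e ∉ D → ∃ x ∈ (e : Sym2 V), ∃ f ∈ T, f ≠ e ∧ x ∈ (f : Sym2 V)) :
    2 * #S ≤ 3 * #T + #D := by
  classical
  let deg (x : V) : ℕ := #(T.filter fun e : G.edgeSet => x ∈ (e : Sym2 V))
  have hsum (S' : Finset V) : ∑ x ∈ S', deg x = ∑ e ∈ T, #{x ∈ S' | x ∈ (e : Sym2 V)} := by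
    simp only [deg, card_filter]
    exact sum_comm
  have hends (S' : Finset V) (e : G.edgeSet) :
      ({x ∈ S' | x ∈ (e : Sym2 V)} : Finset V) ⊆ (e : Sym2 V).toFinset :=
    fun x hx => Sym2.mem_toFinset.2 (mem_filter.1 hx).2
  have htwo (e : G.edgeSet) : #(e : Sym2 V).toFinset = 2 :=
    Sym2.card_toFinset_of_not_isDiag _ (G.not_isDiag_of_mem_edgeSet e.2)
  let leaves : Finset V := {x ∈ S | deg x = 1}
  have hleaf {e : G.edgeSet} (he : e ∈ T) :
      #{x ∈ leaves | x ∈ (e : Sym2 V)} ≤ 1 + if e ∈ D then 1 else 0 := by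
    by_cases heD : e ∈ D
    · rw [if_pos heD]
      exact (card_le_card (hends leaves e)).trans_eq (htwo e)
    · obtain ⟨x, hx, f, hf, hfe, hxf⟩ := h e he heD
      have hx_leaf : x ∉ leaves := fun hxl => (one_lt_card.2
        ⟨e, mem_filter.2 ⟨he, hx⟩, f, mem_filter.2 ⟨hf, hxf⟩, hfe.symm⟩).ne'
          (mem_filter.1 hxl).2
      have hsub := subset_erase.2 ⟨hends leaves e, fun hxl => hx_leaf (mem_filter.1 hxl).1⟩
      have hcard := card_le_card hsub
      rw [card_erase_of_mem (Sym2.mem_toFinset.2 hx), htwo] at hcard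
      rwa [if_neg heD]
  have hleaves : #leaves ≤ #T + #D :=
    calc #leaves = ∑ x ∈ leaves, deg x := by
          rw [sum_congr rfl fun x hx => (mem_filter.1 hx).2, card_eq_sum_ones]
      _ ≤ ∑ e ∈ T, (1 + if e ∈ D then 1 else 0) :=
          (hsum leaves).trans_le (sum_le_sum fun e => hleaf)
      _ = #T + #D := by
          rw [sum_add_distrib, ← card_eq_sum_ones, sum_ite_mem, inter_eq_right.2 hD,
            ← card_eq_sum_ones]
  have hall : ∑ x ∈ S, deg x ≤ 2 * #T := by
    rw [hsum, mul_comm]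
    exact sum_le_card_nsmul _ _ _ fun e _ => (card_le_card (hends S e)).trans_eq (htwo e)
  have hcount : 2 * #S ≤ ∑ x ∈ S, deg x + #leaves := by
    rw [card_filter, ← sum_add_distrib, mul_comm, ← smul_eq_mul]
    refine card_nsmul_le_sum _ _ _ fun x hx => ?_
    obtain ⟨e, he, hxe⟩ := hS x hx
    have hpos : 0 < deg x := card_pos.2 ⟨e, mem_filter.2 ⟨he, hxe⟩⟩
    split_ifs <;> omega
  omega

end Cover

variable {n k : ℕ}

lemma colouredEdges_mono (ω : Outcome n k) (m : ℕ) : Monotone (colouredEdges ω m) := by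
  intro I J hIJ e he
  rw [mem_colouredEdges] at he ⊢
  exact ⟨he.1, fun hJ => he.2 (hJ.mono_right hIJ)⟩

lemma two_le_card_colours_inter {ω : Outcome n k} {m : ℕ} {I : Finset (Fin (n - 1))} {e : KEdge n}
    (he : e ∈ colouredEdges ω m I) (h : ∀ w ∈ I, e ∈ colouredEdges ω m (I.erase w)) :
    2 ≤ #(ω.colours e ∩ I) := by
  obtain ⟨w, hw, hwI⟩ := not_disjoint_iff.1 (mem_colouredEdges.1 he).2
  obtain ⟨v, hv, hvI⟩ := not_disjoint_iff.1 (mem_colouredEdges.1 (h w hwI)).2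
  rw [mem_erase] at hvI
  exact one_lt_card.2 ⟨v, mem_inter.2 ⟨hv, hvI.2⟩, w, mem_inter.2 ⟨hw, hwI⟩, hvI.1⟩

/-- A minimal set of colours whose edges have too small a rank. Every edge of the spanning forest
`T` that is isolated in `T` survives the removal of any one colour, so it has two colours of
`I`. -/
theorem exists_sparse_witness (ω : Outcome n k) (m : ℕ) (I : Finset (Fin (n - 1)))
    (hI : n < numComps (colouredEdges ω m I) + #I)
    (hmin : ∀ w ∈ I, numComps (colouredEdges ω m (I.erase w)) + (#I - 1) ≤ n) :
    ∃ T ⊆ colouredEdges ω m I, ∃ D ⊆ T, ∃ V : Finset (Fin n), #T + 1 = #I ∧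
      (∀ e ∈ colouredEdges ω m I, ∀ x ∈ (e : Sym2 (Fin n)), x ∈ V) ∧
      (∀ e ∈ D, 2 ≤ #(ω.colours e ∩ I)) ∧ 2 * #V ≤ 3 * #T + #D := by
  classical
  have hanti (w : Fin (n - 1)) : colouredEdges ω m (I.erase w) ⊆ colouredEdges ω m I :=
    colouredEdges_mono ω m (erase_subset w I)
  have hcomps := numComps_le_card (colouredEdges ω m I)
  obtain ⟨T, hT, hTcard, hTspace⟩ := exists_spanningForest (colouredEdges ω m I)
  rw [Nat.card_eq_fintype_card, Fintype.card_fin] at hcomps hTcard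
  obtain ⟨w₀, hw₀⟩ : I.Nonempty := card_pos.1 (by omega)
  have hspace {w : Fin (n - 1)} (hw : w ∈ I) :
      cutSpace (colouredEdges ω m (I.erase w)) ≤ cutSpace (colouredEdges ω m I) := by
    refine (Submodule.eq_of_le_of_finrank_le (cutSpace_anti (hanti w)) ?_).ge
    have hw := hmin w hw
    change numComps _ ≤ numComps _
    omega
  have hw₀_min := hmin w₀ hw₀
  have hw₀_anti := numComps_anti (hanti w₀)
  refine ⟨T, hT, {e ∈ T | 2 ≤ #(ω.colours e ∩ I)}, filter_subset _ _,
    ({x | ∃ e ∈ T, x ∈ (e : Sym2 (Fin n))} : Finset (Fin n)), by omega, fun e he x hx => ?_,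
    fun e he => (mem_filter.1 he).2, two_mul_card_cover_le (filter_subset _ _)
      (fun x hx => (mem_filter_univ x).1 hx) fun e he heD => ?_⟩
  · exact (mem_filter_univ x).2 (exists_mem_of_cutSpace_le hTspace.le he hx)
  · by_contra! hiso
    exact heD (mem_filter.2 ⟨he, two_le_card_colours_inter (hT he) fun w hw =>
      mem_of_isolated_of_cutSpace_le hTspace.le (hspace hw) (hanti w) (hT he) hiso⟩)

end MinimalViolation

section Obstructions

open Finset

variable {n k : ℕ}

open Classical in
/-- The edges with both ends in `V`. -/
noncomputable def edgesInside (V : Finset (Fin n)) : Finset (KEdge n) :=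
  {e | ∀ x ∈ (e : Sym2 (Fin n)), x ∈ V}

lemma mem_edgesInside {V : Finset (Fin n)} {e : KEdge n} :
    e ∈ edgesInside V ↔ ∀ x ∈ (e : Sym2 (Fin n)), x ∈ V := by simp [edgesInside]

lemma card_edgesInside_le (V : Finset (Fin n)) : #(edgesInside V) ≤ #V ^ 2 := by
  rw [sq, ← card_product]
  refine card_le_card_of_injOn (fun e : KEdge n => Quot.out (e : Sym2 (Fin n)))
    (fun e he => ?_) ((Function.LeftInverse.injective Quot.out_eq).comp Subtype.val_injective).injOn
  have hin := mem_edgesInside.1 he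
  exact mem_product.2 ⟨hin _ (Sym2.out_fst_mem _), hin _ (Sym2.out_snd_mem _)⟩

/-- The colours `I` are confined to the vertices `V`, except on edges that arrive after time `m₀`:
the edges of `T` have arrived at time `m₁` and have a colour in `I`, those of `D` even two, and no
edge that leaves `V` has a colour in `I`. -/
def ConfinedColours (ω : Outcome n k) (m₀ m₁ : ℕ) (I : Finset (Fin (n - 1)))
    (T D : Finset (KEdge n)) (V : Finset (Fin n)) : Prop :=
  (∀ e ∈ T, e ∈ ω.edges m₁ ∧
    (if e ∈ D then 2 ≤ #(ω.colours e ∩ I) else ¬ Disjoint (ω.colours e) I)) ∧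
  ∀ e ∈ (edgesInside V)ᶜ, e ∈ ω.edges m₀ → Disjoint (ω.colours e) I

/-- The edges across the cut `U` avoid the colours `I`, except those that arrive after time `m₀`;
those in `X` have arrived at time `m₁` and avoid `I` as well. -/
def AvoidedCut (ω : Outcome n k) (m₀ m₁ : ℕ) (I : Finset (Fin (n - 1))) (U : Finset (Fin n))
    (X : Finset (KEdge n)) : Prop :=
  (∀ e ∈ X, e ∈ ω.edges m₁ ∧ Disjoint (ω.colours e) I) ∧
  ∀ e ∈ cutEdges U \ X, e ∈ ω.edges m₀ → Disjoint (ω.colours e) I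

/-- Some set of `r + 1 ≤ b` colours is confined to at most `(3 r + d) / 2` vertices. -/
def smallObstruction (n k m₀ m₁ b : ℕ) : Set (Outcome n k) :=
  {ω | ∃ r ∈ Ico 1 b, ∃ I ∈ powersetCard (r + 1) (univ : Finset (Fin (n - 1))),
    ∃ d ∈ range (r + 1), ∃ V ∈ powersetCard ((3 * r + d) / 2) (univ : Finset (Fin n)),
    ∃ T ∈ powersetCard r (edgesInside V), ∃ D ∈ powersetCard d T, ConfinedColours ω m₀ m₁ I T D V}

/-- Some set of more than `b` colours whose complement has more than `b` colours is avoided across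
a cut at least half as large as that complement. -/
def balancedObstruction (n k m₀ b : ℕ) : Set (Outcome n k) :=
  {ω | ∃ I ∈ ({I | b < #I ∧ b < n - 1 - #I} : Finset (Finset (Fin (n - 1)))),
    ∃ U ∈ ({U | n - 1 - #I + 1 ≤ 2 * #U ∧ 2 * #U ≤ n} : Finset (Finset (Fin n))),
      AvoidedCut ω m₀ m₀ I U ∅}

/-- Some set of all but `j ≤ b` colours is avoided across a cut that contains `j + 1` edges. -/
def largeObstruction (n k m₀ m₁ b : ℕ) : Set (Outcome n k) :=
  {ω | ∃ j ∈ range (b + 1), ∃ I ∈ powersetCard (n - 1 - j) (univ : Finset (Fin (n - 1))),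
    ∃ u ∈ Icc 1 (n / 2), ∃ U ∈ powersetCard u (univ : Finset (Fin n)),
    ∃ X ∈ powersetCard (j + 1) (cutEdges U), AvoidedCut ω m₀ m₁ I U X}

section Deterministic

variable {ω : Outcome n k} {m₀ m₁ b m : ℕ} {I : Finset (Fin (n - 1))}

lemma disjoint_colours_of_notMem_colouredEdges {e : KEdge n} (he : e ∈ ω.edges m)
    (h : e ∉ colouredEdges ω m I) : Disjoint (ω.colours e) I := by
  by_contra hdisj
  exact h (mem_colouredEdges.2 ⟨he, hdisj⟩)

lemma avoidedCut_of_disjoint_colouredEdges (h₀ : m₀ ≤ m) (h₁ : m ≤ m₁) {U : Finset (Fin n)}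
    (hU : Disjoint (colouredEdges ω m I) (cutEdges U)) {X : Finset (KEdge n)}
    (hX : X ⊆ cutEdges U ∩ firstEdges ω m) : AvoidedCut ω m₀ m₁ I U X := by
  refine ⟨fun e he => ?_, fun e he hearly => ?_⟩
  · obtain ⟨hcut, hfirst⟩ := mem_inter.1 (hX he)
    have harrived := mem_firstEdges.1 hfirst
    exact ⟨edges_mono ω h₁ harrived,
      disjoint_colours_of_notMem_colouredEdges harrived (disjoint_right.1 hU hcut)⟩
  · exact disjoint_colours_of_notMem_colouredEdges (edges_mono ω h₀ hearly)
      (disjoint_right.1 hU (mem_sdiff.1 he).1)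

lemma mem_smallObstruction_of_minimal (hb : 2 * b ≤ n) (h₀ : m₀ ≤ m) (h₁ : m ≤ m₁)
    (hall : ω.AllColours m) (hI : n < numComps (colouredEdges ω m I) + #I)
    (hmin : ∀ w ∈ I, numComps (colouredEdges ω m (I.erase w)) + (#I - 1) ≤ n) (hIb : #I ≤ b) :
    ω ∈ smallObstruction n k m₀ m₁ b := by
  obtain ⟨T, hT, D, hD, V, hTI, hV, hD2, hcover⟩ := exists_sparse_witness ω m I hI hmin
  have hDT := card_le_card hD
  have hTpos : 1 ≤ #T := by
    by_contra! hT0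
    obtain ⟨w, hw⟩ := card_pos.1 (by omega : 0 < #I)
    obtain ⟨e, he, hwe⟩ := hall w
    have hmem := hV e (mem_colouredEdges.2 ⟨he, not_disjoint_iff.2 ⟨w, hwe, hw⟩⟩) _
      (Sym2.out_fst_mem _)
    have hVpos := card_pos.2 ⟨_, hmem⟩
    omega
  obtain ⟨V', hVV', hV'⟩ := exists_superset_card_eq (s := V) (n := (3 * #T + #D) / 2)
    (by omega) (by rw [Fintype.card_fin]; omega)
  refine ⟨#T, mem_Ico.2 ⟨hTpos, by omega⟩, I, mem_powersetCard_univ.2 hTI.symm, #D,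
    mem_range.2 (by omega), V', mem_powersetCard_univ.2 hV', T, mem_powersetCard.2
      ⟨fun e he => mem_edgesInside.2 fun x hx => hVV' (hV e (hT he) x hx), rfl⟩,
    D, mem_powersetCard.2 ⟨hD, rfl⟩, fun e he => ?_, fun e he hearly => ?_⟩
  · obtain ⟨harrived, hcolour⟩ := mem_colouredEdges.1 (hT he)
    refine ⟨edges_mono ω h₁ harrived, ?_⟩
    split_ifs with heD
    exacts [hD2 e heD, hcolour]
  · rw [mem_compl, mem_edgesInside] at he
    exact disjoint_colours_of_notMem_colouredEdges (edges_mono ω h₀ hearly) fun hcol =>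
      he fun x hx => hVV' (hV e hcol x hx)

lemma mem_balancedObstruction (h₀ : m₀ ≤ m) (hI : n < numComps (colouredEdges ω m I) + #I)
    (hIb : b < #I) (hIb' : b < n - 1 - #I) : ω ∈ balancedObstruction n k m₀ b := by
  obtain ⟨U, hcomps, hhalf, hdisj⟩ := exists_balanced_cut (colouredEdges ω m I)
  rw [Fintype.card_fin] at hhalf
  have havoid := avoidedCut_of_disjoint_colouredEdges h₀ le_rfl hdisj (empty_subset _)
  exact ⟨I, (mem_filter_univ _).2 ⟨hIb, hIb'⟩, U, (mem_filter_univ _).2 ⟨by omega, hhalf⟩,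
    by simp, havoid.2⟩

lemma mem_largeObstruction (h₀ : m₀ ≤ m) (h₁ : m ≤ m₁) (hconn : ω.IsConn m)
    (hI : n < numComps (colouredEdges ω m I) + #I) (hn : 2 ≤ n) (hIb : n - 1 - #I ≤ b) :
    ω ∈ largeObstruction n k m₀ m₁ b := by
  have hcardI := card_le_univ I
  rw [Fintype.card_fin] at hcardI
  obtain ⟨U, hpos, hhalf, hdisj, hcross⟩ := exists_cut_many_crossing (E := colouredEdges ω m I)
    (F := firstEdges ω m) (by rwa [graphOf_firstEdges]) (by omega)
  rw [Fintype.card_fin] at hhalf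
  obtain ⟨X, hX, hXcard⟩ := exists_subset_card_eq (s := cutEdges U ∩ firstEdges ω m)
    (n := n - 1 - #I + 1) (by omega)
  exact ⟨n - 1 - #I, mem_range.2 (by omega), I, mem_powersetCard_univ.2 (by omega), #U,
    mem_Icc.2 ⟨hpos, by omega⟩, U, mem_powersetCard_univ.2 rfl, X,
    mem_powersetCard.2 ⟨hX.trans inter_subset_left, hXcard⟩,
    avoidedCut_of_disjoint_colouredEdges h₀ h₁ hdisj hX⟩

theorem hasRainbowTree_of_notMem_obstructions (hn : 2 ≤ n) (hb : 2 * b ≤ n) (h₀ : m₀ ≤ m)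
    (h₁ : m ≤ m₁) (hconn : ω.IsConn m) (hall : ω.AllColours m)
    (hsmall : ω ∉ smallObstruction n k m₀ m₁ b) (hbalanced : ω ∉ balancedObstruction n k m₀ b)
    (hlarge : ω ∉ largeObstruction n k m₀ m₁ b) : ω.HasRainbowTree m := by
  classical
  refine hasRainbowTree_of_numComps hn ω m ?_
  by_contra! hviolated
  obtain ⟨I₀, hI₀⟩ := hviolated
  obtain ⟨I, hI, hImin⟩ := exists_min_image
    {I : Finset (Fin (n - 1)) | n < numComps (colouredEdges ω m I) + #I} card
    ⟨I₀, (mem_filter_univ _).2 hI₀⟩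
  simp only [mem_filter_univ] at hI hImin
  have hmin (w : Fin (n - 1)) (hw : w ∈ I) :
      numComps (colouredEdges ω m (I.erase w)) + (#I - 1) ≤ n := by
    by_contra! hlt
    rw [← card_erase_of_mem hw] at hlt
    exact (card_erase_lt_of_mem hw).not_ge (hImin _ hlt)
  rcases le_or_gt #I b with hIb | hIb
  · exact hsmall (mem_smallObstruction_of_minimal hb h₀ h₁ hall hI hmin hIb)
  rcases le_or_gt (n - 1 - #I) b with hIb' | hIb'
  · exact hlarge (mem_largeObstruction h₀ h₁ hconn hI hn hIb')
  · exact hbalanced (mem_balancedObstruction h₀ hI hIb hIb')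

end Deterministic

end Obstructions

section UnionBounds

open Finset

section Measure

variable {Ω ι : Type*} [MeasurableSpace Ω] {μ : Measure Ω}

lemma measureReal_exists_le_sum {s : Finset ι} {p : ι → Ω → Prop} {B : ι → ℝ}
    (h : ∀ a ∈ s, μ.real {ω | p a ω} ≤ B a) : μ.real {ω | ∃ a ∈ s, p a ω} ≤ ∑ a ∈ s, B a := by
  have hUnion : {ω | ∃ a ∈ s, p a ω} = ⋃ a ∈ s, {ω | p a ω} := by ext; simp
  rw [hUnion]
  exact (measureReal_biUnion_finset_le s _).trans (sum_le_sum h)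

lemma measureReal_exists_le_card_mul {s : Finset ι} {p : ι → Ω → Prop} {B : ℝ}
    (h : ∀ a ∈ s, μ.real {ω | p a ω} ≤ B) : μ.real {ω | ∃ a ∈ s, p a ω} ≤ #s * B := by
  refine (measureReal_exists_le_sum h).trans_eq ?_
  rw [sum_const, nsmul_eq_mul]

lemma measureReal_exists_mem_powersetCard_le {S : Finset ι} {N t : ℕ} (hS : #S ≤ N)
    {p : Finset ι → Ω → Prop} {B : ℝ} (hB : 0 ≤ B)
    (h : ∀ A ⊆ S, #A = t → μ.real {ω | p A ω} ≤ B) :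
    μ.real {ω | ∃ A ∈ powersetCard t S, p A ω} ≤ N.choose t * B := by
  refine (measureReal_exists_le_card_mul fun A hA => ?_).trans
    (mul_le_mul_of_nonneg_right ?_ hB)
  · obtain ⟨hAS, hAt⟩ := mem_powersetCard.1 hA
    exact h A hAS hAt
  · rw [card_powersetCard]
    exact_mod_cast Nat.choose_le_choose t hS

end Measure

variable {n k m₀ m₁ b : ℕ}

section Obstructions

variable {μ : Measure (Outcome n k)}

lemma measureReal_smallObstruction_le {B : ℕ → ℕ → ℝ} (hB₀ : ∀ r d, 0 ≤ B r d)
    (hB : ∀ (I : Finset (Fin (n - 1))) (V : Finset (Fin n)) (T D : Finset (KEdge n)),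
      #T ∈ Ico 1 b → #I = #T + 1 → #V = (3 * #T + #D) / 2 → T ⊆ edgesInside V → D ⊆ T →
        μ.real {ω | ConfinedColours ω m₀ m₁ I T D V} ≤ B #T #D) :
    μ.real (smallObstruction n k m₀ m₁ b) ≤
      ∑ r ∈ Ico 1 b, (n - 1).choose (r + 1) * ∑ d ∈ range (r + 1), n.choose ((3 * r + d) / 2) *
        ((((3 * r + d) / 2) ^ 2).choose r * (r.choose d * B r d)) := by
  refine measureReal_exists_le_sum fun r hr => measureReal_exists_mem_powersetCard_le (by simp)
    (sum_nonneg fun d _ => by have := hB₀ r d; positivity) fun I _ hI =>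
    measureReal_exists_le_sum fun d _ => ?_
  have hBrd := hB₀ r d
  refine measureReal_exists_mem_powersetCard_le (by simp) (by positivity) fun V _ hV =>
    measureReal_exists_mem_powersetCard_le (hV ▸ card_edgesInside_le V) (by positivity)
      fun T hTV hT => measureReal_exists_mem_powersetCard_le hT.le hBrd fun D hDT hD => ?_
  subst hT hD
  exact hB I V T D hr hI hV hTV hDT

lemma measureReal_balancedObstruction_le {B : ℝ} (hB₀ : 0 ≤ B)
    (hB : ∀ (I : Finset (Fin (n - 1))) (U : Finset (Fin n)), b < #I → b < n - 1 - #I →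
      n - 1 - #I + 1 ≤ 2 * #U → 2 * #U ≤ n → μ.real {ω | AvoidedCut ω m₀ m₀ I U ∅} ≤ B) :
    μ.real (balancedObstruction n k m₀ b) ≤ 2 ^ n * (2 ^ n * B) := by
  refine (measureReal_exists_le_card_mul (B := 2 ^ n * B) fun I hI => ?_).trans ?_
  · refine (measureReal_exists_le_card_mul (B := B) fun U hU => ?_).trans ?_
    · simp only [mem_filter_univ] at hI hU
      exact hB I U hI.1 hI.2 hU.1 hU.2
    · gcongr
      exact_mod_cast (card_le_univ _).trans_eq (by simp)
  · gcongr
    exact_mod_cast (card_le_univ _).trans (by simpa using Nat.pow_le_pow_right two_pos n.pred_le)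

lemma measureReal_largeObstruction_le {B : ℕ → ℕ → ℝ} (hB₀ : ∀ j u, 0 ≤ B j u)
    (hB : ∀ j ≤ b, ∀ (I : Finset (Fin (n - 1))) (U : Finset (Fin n)) (X : Finset (KEdge n)),
      #I = n - 1 - j → #U ∈ Icc 1 (n / 2) → X ⊆ cutEdges U → #X = j + 1 →
        μ.real {ω | AvoidedCut ω m₀ m₁ I U X} ≤ B j #U) :
    μ.real (largeObstruction n k m₀ m₁ b) ≤
      ∑ j ∈ range (b + 1), (n - 1).choose (n - 1 - j) * ∑ u ∈ Icc 1 (n / 2), n.choose u *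
        ((u * (n - u)).choose (j + 1) * B j u) := by
  refine measureReal_exists_le_sum fun j hj => measureReal_exists_mem_powersetCard_le (by simp)
    (sum_nonneg fun u _ => by have := hB₀ j u; positivity) fun I _ hI =>
    measureReal_exists_le_sum fun u hu => ?_
  have hBju := hB₀ j u
  refine measureReal_exists_mem_powersetCard_le (by simp) (by positivity) fun U _ hU => ?_
  subst hU
  have hcut : #(cutEdges U : Finset (KEdge n)) ≤ #U * (n - #U) := by
    rw [card_cutEdges_top, Fintype.card_fin]
  exact measureReal_exists_mem_powersetCard_le hcut hBju fun X hXU hX =>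
    hB j (mem_range_succ_iff.1 hj) I U X hI hu hXU hX

end Obstructions

section Probability

variable {I : Finset (Fin (n - 1))} {V U : Finset (Fin n)} {T D X : Finset (KEdge n)} {z x : ℝ}

lemma sub_sq_div_two_nonneg {m t N : ℕ} (ht : t ≤ m) (hm : m ≤ N) (hz : z = (m - t) / N) :
    0 ≤ z - z ^ 2 / 2 := by
  have ht' : (t : ℝ) ≤ m := by exact_mod_cast ht
  have hm' : (m : ℝ) ≤ N := by exact_mod_cast hm
  have hz₀ : 0 ≤ z := hz ▸ div_nonneg (sub_nonneg.2 ht') (Nat.cast_nonneg N)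
  have hz₁ : z ≤ 1 := hz ▸ div_le_one_of_le₀ (by linarith [(Nat.cast_nonneg t : (0 : ℝ) ≤ t)])
    (Nat.cast_nonneg N)
  nlinarith

lemma avoidance_nonneg (n i : ℕ) : 0 ≤ 1 - (((n - 1 - i : ℕ) : ℝ) / (n - 1 : ℕ)) ^ 2 :=
  sub_nonneg.2 <| pow_le_one₀ (by positivity) <|
    div_le_one_of_le₀ (by exact_mod_cast Nat.sub_le _ _) (by positivity)

lemma prod_colourProb_le (hk : 2 ≤ k) (hkn : k ≤ n - 1) (hDT : D ⊆ T) [DecidableEq (KEdge n)] :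
    ∏ e ∈ T, colourProb n k
        (fun S => if e ∈ D then 2 ≤ #(S ∩ I) else ¬ Disjoint S I) ≤
      ((k * #I : ℝ) / (n - 1 : ℕ)) ^ (#T + #D) := by
  calc ∏ e ∈ T, colourProb n k (fun S => if e ∈ D then 2 ≤ #(S ∩ I) else ¬ Disjoint S I)
      ≤ ∏ e ∈ T, ((k * #I : ℝ) / (n - 1 : ℕ) *
          if e ∈ D then (k * #I : ℝ) / (n - 1 : ℕ) else 1) := by
        refine prod_le_prod (fun e _ => colourProb_nonneg _) fun e _ => ?_
        split_ifs
        · exact (colourProb_two_le_card_inter_le hk hkn I).trans_eq (sq _)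
        · rw [mul_one]
          exact colourProb_not_disjoint_le (by omega) hkn I
    _ = ((k * #I : ℝ) / (n - 1 : ℕ)) ^ (#T + #D) := by
        rw [prod_mul_distrib, prod_const, prod_ite_mem, inter_eq_right.2 hDT, prod_const, pow_add]

theorem processLaw_real_confinedColours_le (hk : 2 ≤ k) (hkn : k ≤ n - 1) (hT : #T ≤ m₀)
    (hm₀ : m₀ ≤ n.choose 2) (hm₁ : m₁ ≤ n.choose 2) (hTV : T ⊆ edgesInside V) (hDT : D ⊆ T)
    (hz : z = (m₀ - #T) / (n.choose 2 : ℕ))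
    (hx : x ≤ ((n.choose 2 : ℕ) - (#V : ℝ) ^ 2) *
      (1 - (((n - 1 - #I : ℕ) : ℝ) / (n - 1 : ℕ)) ^ 2) * (z - z ^ 2 / 2)) :
    (processLaw n k).real {ω | ConfinedColours ω m₀ m₁ I T D V} ≤
      ((m₁ : ℝ) / (n.choose 2 : ℕ)) ^ #T * ((k * #I : ℝ) / (n - 1 : ℕ)) ^ (#T + #D) *
        Real.exp (-x) := by
  classical
  have hz₀ := sub_sq_div_two_nonneg hT hm₀ hz
  have havoid := avoidance_nonneg n #I
  have houtside : (n.choose 2 : ℕ) - (#V : ℝ) ^ 2 ≤ #(edgesInside V)ᶜ := by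
    have hcard := card_add_card_compl (edgesInside V)
    rw [card_KEdge] at hcard
    have hinside : (#(edgesInside V) : ℝ) ≤ (#V : ℝ) ^ 2 := by
      exact_mod_cast card_edgesInside_le V
    have hcard' : (#(edgesInside V) : ℝ) + #(edgesInside V)ᶜ = (n.choose 2 : ℕ) := by
      exact_mod_cast hcard
    linarith
  refine (processLaw_real_early_good_le hkn (disjoint_compl_right.mono_left hTV) hT hm₀ hm₁
    (fun e S => if e ∈ D then 2 ≤ #(S ∩ I) else ¬ Disjoint S I) (fun S => Disjoint S I) hz).trans ?_
  gcongr
  · exact prod_colourProb_le hk hkn hDT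
  · refine hx.trans ?_
    gcongr
    exact colourProb_disjoint_le_sq hk I

theorem processLaw_real_avoidedCut_le (hk : 2 ≤ k) (hkn : k ≤ n - 1) (hX : #X ≤ m₀)
    (hm₀ : m₀ ≤ n.choose 2) (hm₁ : m₁ ≤ n.choose 2) (hXU : X ⊆ cutEdges U)
    (hz : z = (m₀ - #X) / (n.choose 2 : ℕ))
    (hx : x ≤ ((#U * (n - #U) : ℕ) - #X) *
      (1 - (((n - 1 - #I : ℕ) : ℝ) / (n - 1 : ℕ)) ^ 2) * (z - z ^ 2 / 2)) :
    (processLaw n k).real {ω | AvoidedCut ω m₀ m₁ I U X} ≤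
      ((m₁ : ℝ) / (n.choose 2 : ℕ)) ^ #X *
        ((((n - 1 - #I : ℕ) : ℝ) / (n - 1 : ℕ)) ^ 2) ^ #X * Real.exp (-x) := by
  have hz₀ := sub_sq_div_two_nonneg hX hm₀ hz
  have hcross : (#(cutEdges U \ X) : ℝ) = (#U * (n - #U) : ℕ) - #X := by
    rw [card_sdiff_of_subset hXU, Nat.cast_sub (card_le_card hXU), card_cutEdges_top,
      Fintype.card_fin]
  refine (processLaw_real_early_good_le hkn disjoint_sdiff hX hm₀ hm₁
    (fun _ S => Disjoint S I) (fun S => Disjoint S I) hz).trans ?_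
  rw [prod_const]
  rw [← hcross] at hx
  gcongr
  · exact colourProb_nonneg _
  · exact colourProb_disjoint_le_sq hk I
  · refine hx.trans ?_
    gcongr
    exact colourProb_disjoint_le_sq hk I

end Probability

end UnionBounds

section SecondMoment

open Finset

variable {Ω ι : Type*} [MeasurableSpace Ω] {μ : Measure Ω} [IsProbabilityMeasure μ] [Fintype ι]
  {S : ι → Set Ω} {a b : ℝ}

lemma integral_sum_indicator (hS : ∀ i, MeasurableSet (S i)) (ha : ∀ i, μ.real (S i) = a) :
    ∫ ω, ∑ i, (S i).indicator 1 ω ∂μ = Fintype.card ι * a := by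
  have hint (i : ι) : Integrable ((S i).indicator (1 : Ω → ℝ)) μ :=
    (integrable_const (1 : ℝ)).indicator (hS i)
  rw [integral_finsetSum _ fun i _ => hint i]
  simp only [integral_indicator_one (hS _), ha, sum_const, card_univ, nsmul_eq_mul]

lemma integral_sum_indicator_sq_le (hS : ∀ i, MeasurableSet (S i)) (ha : ∀ i, μ.real (S i) = a)
    (hb : ∀ i j, i ≠ j → μ.real (S i ∩ S j) ≤ b) (hb₀ : 0 ≤ b) :
    ∫ ω, (∑ i, (S i).indicator 1 ω) ^ 2 ∂μ ≤
      Fintype.card ι * a + (Fintype.card ι : ℝ) ^ 2 * b := by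
  classical
  have hexpand (ω : Ω) : (∑ i, (S i).indicator (1 : Ω → ℝ) ω) ^ 2 =
      ∑ i, ∑ j, (S i ∩ S j).indicator 1 ω := by
    simp only [sq, sum_mul_sum, Set.inter_indicator_one, Pi.mul_apply]
  have hpair (i j : ι) : μ.real (S i ∩ S j) ≤ (if i = j then a else 0) + b := by
    split_ifs with hij
    · rw [hij, Set.inter_self, ha]
      linarith
    · rw [zero_add]
      exact hb i j hij
  have hint (i j : ι) : Integrable ((S i ∩ S j).indicator (1 : Ω → ℝ)) μ :=
    (integrable_const (1 : ℝ)).indicator ((hS i).inter (hS j))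
  calc ∫ ω, (∑ i, (S i).indicator 1 ω) ^ 2 ∂μ
      = ∑ i, ∑ j, μ.real (S i ∩ S j) := by
        simp_rw [hexpand]
        rw [integral_finsetSum _ fun i _ => integrable_finsetSum _ fun j _ => hint i j]
        refine sum_congr rfl fun i _ => ?_
        rw [integral_finsetSum _ fun j _ => hint i j]
        exact sum_congr rfl fun j _ => integral_indicator_one ((hS i).inter (hS j))
    _ ≤ ∑ i : ι, ∑ j : ι, ((if i = j then a else 0) + b) :=
        sum_le_sum fun i _ => sum_le_sum fun j _ => hpair i j
    _ = Fintype.card ι * a + (Fintype.card ι : ℝ) ^ 2 * b := by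
        simp only [sum_add_distrib, sum_ite_eq, mem_univ, if_true, sum_const, card_univ,
          nsmul_eq_mul]
        ring

theorem measureReal_forall_notMem_le (hS : ∀ i, MeasurableSet (S i)) (ha : ∀ i, μ.real (S i) = a)
    (ha₀ : 0 < a) (hb : ∀ i j, i ≠ j → μ.real (S i ∩ S j) ≤ b) (hb₀ : 0 ≤ b) [Nonempty ι] :
    μ.real {ω | ∀ i, ω ∉ S i} ≤ 1 / (Fintype.card ι * a) + (b / a ^ 2 - 1) := by
  set X : Ω → ℝ := fun ω => ∑ i, (S i).indicator 1 ω
  have hX : MemLp X 2 μ := memLp_finsetSum _ fun i _ => (memLp_const (1 : ℝ)).indicator (hS i)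
  have hmean : μ[X] = Fintype.card ι * a := integral_sum_indicator hS ha
  have hpos : 0 < Fintype.card ι * a := mul_pos (by exact_mod_cast Fintype.card_pos) ha₀
  have hvar : Var[X; μ] ≤
      Fintype.card ι * a + (Fintype.card ι : ℝ) ^ 2 * b - (Fintype.card ι * a) ^ 2 := by
    rw [variance_eq_sub hX, hmean]
    exact sub_le_sub_right (integral_sum_indicator_sq_le hS ha hb hb₀) _
  have hsub : {ω | ∀ i, ω ∉ S i} ⊆ {ω | Fintype.card ι * a ≤ |X ω - μ[X]|} := fun ω hω => by
    have hzero : X ω = 0 := sum_eq_zero fun i _ => Set.indicator_of_notMem (hω i) 1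
    rw [Set.mem_ofPred_eq, hmean, hzero, zero_sub, abs_neg, abs_of_pos hpos]
  have hchebyshev := meas_ge_le_variance_div_sq hX hpos
  calc μ.real {ω | ∀ i, ω ∉ S i}
      ≤ μ.real {ω | Fintype.card ι * a ≤ |X ω - μ[X]|} := measureReal_mono hsub
    _ ≤ Var[X; μ] / (Fintype.card ι * a) ^ 2 :=
        ENNReal.toReal_le_of_le_ofReal (div_nonneg (variance_nonneg _ _) (sq_nonneg _)) hchebyshev
    _ ≤ (Fintype.card ι * a + (Fintype.card ι : ℝ) ^ 2 * b - (Fintype.card ι * a) ^ 2) /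
          (Fintype.card ι * a) ^ 2 := by gcongr
    _ = 1 / (Fintype.card ι * a) + (b / a ^ 2 - 1) := by field_simp; ring

end SecondMoment

section IsolatedVertices

open Finset

variable {n k m : ℕ}

/-- No edge at `v` is among the first `m`. -/
def isolatedAt (m : ℕ) (v : Fin n) : Set (EdgeOrder n) :=
  {σ | ∀ e ∈ cutEdges {v}, m ≤ (σ.position e : ℕ)}

lemma card_cutEdges_singleton (v : Fin n) : #(cutEdges {v} : Finset (KEdge n)) = n - 1 := by
  rw [card_cutEdges_top, card_singleton, one_mul, Fintype.card_fin]

lemma uniformOn_isolatedAt_real (hm : m ≤ n.choose 2) (v : Fin n) :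
    (uniformOn Set.univ).real (isolatedAt m v) =
      descRatio (n.choose 2) (n.choose 2 - m) (n - 1) := by
  rw [isolatedAt, uniformOn_late_real _ hm, card_cutEdges_singleton]

lemma card_cutEdges_inter_singleton_le_one {v w : Fin n} (hvw : v ≠ w) :
    #(cutEdges {v} ∩ cutEdges {w} : Finset (KEdge n)) ≤ 1 := by
  have hmem {e : KEdge n} (he : e ∈ cutEdges {v} ∩ cutEdges {w}) :
      (e : Sym2 (Fin n)) = s(v, w) := by
    rw [mem_inter, mem_cutEdges, mem_cutEdges] at he
    obtain ⟨⟨⟨x, hx, hxv⟩, -⟩, ⟨y, hy, hyw⟩, -⟩ := he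
    rw [mem_singleton] at hxv hyw
    subst hxv hyw
    exact (Sym2.mem_and_mem_iff hvw).1 ⟨hx, hy⟩
  exact card_le_one.2 fun e he e' he' => Subtype.ext ((hmem he).trans (hmem he').symm)

lemma uniformOn_isolatedAt_inter_real_le (hn : 2 ≤ n) (hm : m ≤ n.choose 2) {v w : Fin n}
    (hvw : v ≠ w) : (uniformOn Set.univ).real (isolatedAt m v ∩ isolatedAt m w) ≤
      descRatio (n.choose 2) (n.choose 2 - m) (n - 1 + (n - 2)) := by
  have hunion := card_union_add_card_inter (cutEdges {v} : Finset (KEdge n)) (cutEdges {w})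
  rw [card_cutEdges_singleton, card_cutEdges_singleton] at hunion
  have hinter := card_cutEdges_inter_singleton_le_one hvw
  obtain ⟨Q, hQ, hcard⟩ := exists_subset_card_eq
    (s := (cutEdges {v} ∪ cutEdges {w} : Finset (KEdge n))) (n := n - 1 + (n - 2)) (by omega)
  rw [← hcard, ← uniformOn_late_real Q hm]
  refine measureReal_mono fun σ hσ e he => ?_
  exact (mem_union.1 (hQ he)).elim (hσ.1 e) (hσ.2 e)

lemma notMem_isolatedAt_of_isConn (hn : 2 ≤ n) {ω : Outcome n k} (hω : ω.IsConn m) (v : Fin n) :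
    ω.1 ∉ isolatedAt m v := fun hv => by
  have : Nontrivial (Fin n) := Fin.nontrivial_iff_two_le.2 hn
  obtain ⟨y, hy⟩ := exists_ne v
  have hconn : (graphOf (firstEdges ω m)).Connected := by rwa [graphOf_firstEdges]
  obtain ⟨e, he, hcut⟩ := exists_mem_cutEdges_of_connected hconn (mem_singleton_self v)
    (mt mem_singleton.1 hy)
  exact (hv e hcut).not_gt (mem_edges_iff.1 (mem_firstEdges.1 he))

lemma processLaw_real_isConn_le_of_ratio (hk : k ≤ n - 1) (hn : 2 ≤ n)
    (hm : m + (n - 2) < n.choose 2) {f : ℝ}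
    (hf : f = (n.choose 2 - m - (n - 2) : ℕ) / (n.choose 2 - (n - 2) : ℕ)) :
    (processLaw n k).real {ω | ω.IsConn m} ≤ 1 / (n * f ^ (n - 1)) + (1 / f - 1) := by
  have : Nonempty (Fin n) := ⟨0, by omega⟩
  have := isProbabilityMeasure_processLaw (k := k) hk
  have hJ : n.choose 2 - m ≤ n.choose 2 := Nat.sub_le _ _
  have hfpos : 0 < f := by
    rw [hf]
    exact div_pos (Nat.cast_pos.2 (by omega)) (Nat.cast_pos.2 (by omega))
  set a := descRatio (n.choose 2) (n.choose 2 - m) (n - 1)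
  set b := descRatio (n.choose 2) (n.choose 2 - m) (n - 1 + (n - 2))
  have ha : f ^ (n - 1) ≤ a := hf ▸ pow_le_descRatio hJ (by omega)
  have ha₀ : 0 < a := (pow_pos hfpos _).trans_le ha
  have hb : b ≤ a ^ 2 / f := by
    have hsucc : a = descRatio (n.choose 2) (n.choose 2 - m) (n - 2) * f := by
      rw [hf, ← descRatio_succ, show n - 2 + 1 = n - 1 by omega]
    calc b ≤ a * descRatio (n.choose 2) (n.choose 2 - m) (n - 2) := descRatio_add_le hJ _ _
      _ = a ^ 2 / f := by rw [eq_div_iff hfpos.ne', mul_assoc, ← hsucc, sq]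
  have hnone := measureReal_forall_notMem_le (μ := uniformOn (Set.univ : Set (EdgeOrder n)))
    (fun v => (Set.toFinite _).measurableSet) (uniformOn_isolatedAt_real (by omega)) ha₀
    (fun v w => uniformOn_isolatedAt_inter_real_le hn (by omega)) (descRatio_nonneg _ _ _)
  rw [Fintype.card_fin] at hnone
  calc (processLaw n k).real {ω | ω.IsConn m}
      ≤ (processLaw n k).real {ω | ω.1 ∈ {σ | ∀ v, σ ∉ isolatedAt m v}} :=
        measureReal_mono fun ω hω v => notMem_isolatedAt_of_isConn hn hω v
    _ ≤ 1 / (n * a) + (b / a ^ 2 - 1) := (processLaw_real_order hk _).trans_le hnone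
    _ ≤ 1 / (n * f ^ (n - 1)) + (1 / f - 1) := by
        gcongr ?_ + (?_ - 1)
        · have : (0 : ℝ) < n := by exact_mod_cast (by omega : 0 < n)
          gcongr
        · rw [div_le_div_iff₀ (by positivity) hfpos, one_mul, ← le_div_iff₀ hfpos]
          exact hb

theorem processLaw_real_isConn_le (hk : k ≤ n - 1) (hn : 2 ≤ n) (hm : m + (n - 2) < n.choose 2)
    {g : ℝ} (hg : g = m / (n.choose 2 - m - (n - 2) : ℕ)) :
    (processLaw n k).real {ω | ω.IsConn m} ≤ Real.exp ((n - 1 : ℕ) * g) / n + g := by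
  have hD : (0 : ℝ) < (n.choose 2 - m - (n - 2) : ℕ) := Nat.cast_pos.2 (by omega)
  have hE : ((n.choose 2 - (n - 2) : ℕ) : ℝ) = (n.choose 2 - m - (n - 2) : ℕ) + m := by
    exact_mod_cast (by omega : n.choose 2 - (n - 2) = n.choose 2 - m - (n - 2) + m)
  have hg₀ : 0 ≤ g := hg ▸ by positivity
  have hf : (1 + g)⁻¹ = (n.choose 2 - m - (n - 2) : ℕ) / (n.choose 2 - (n - 2) : ℕ) := by
    rw [hg, hE]
    field_simp
  have hexp : (1 + g) ^ (n - 1) ≤ Real.exp ((n - 1 : ℕ) * g) := by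
    rw [Real.exp_nat_mul]
    exact pow_le_pow_left₀ (by positivity) (by linarith [Real.add_one_le_exp g]) _
  calc (processLaw n k).real {ω | ω.IsConn m}
      ≤ 1 / (n * (1 + g)⁻¹ ^ (n - 1)) + (1 / (1 + g)⁻¹ - 1) :=
        processLaw_real_isConn_le_of_ratio hk hn hm hf
    _ = (1 + g) ^ (n - 1) / n + g := by
        rw [inv_pow, one_div, mul_inv, inv_inv, one_div, inv_inv, add_sub_cancel_left,
          div_eq_inv_mul]
    _ ≤ Real.exp ((n - 1 : ℕ) * g) / n + g := by gcongr

end IsolatedVertices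

section Parameters

variable {n : ℕ}

/-- A time `m₀` just before the connectivity threshold: `𝒢(n, m₀)` is with high probability
disconnected, because of its isolated vertices. -/
noncomputable def earlyTime (n : ℕ) : ℕ :=
  ⌊(n : ℝ) * (Real.log n - Real.log (Real.log n) / 2) / 2⌋₊

/-- A time `m₁` well after both thresholds: `𝒢(n, m₁)` is with high probability connected and
contains every colour. -/
noncomputable def lateTime (n : ℕ) : ℕ := ⌊3 * (n : ℝ) * Real.log n⌋₊

/-- The size that separates small sets of colours from sets of linear size. -/
noncomputable def sizeThreshold (n : ℕ) : ℕ := ⌊(n : ℝ) / √(Real.log n)⌋₊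

lemma le_earlyTime (n : ℕ) :
    (n : ℝ) * (Real.log n - Real.log (Real.log n) / 2) / 2 - 1 ≤ earlyTime n :=
  (Nat.sub_one_lt_floor _).le

lemma sizeThreshold_le_div_sqrt (n : ℕ) : (sizeThreshold n : ℝ) ≤ n / √(Real.log n) :=
  Nat.floor_le (by positivity)

lemma tendsto_log_natCast : Tendsto (fun n : ℕ => Real.log n) atTop atTop :=
  Real.tendsto_log_atTop.comp tendsto_natCast_atTop_atTop

lemma tendsto_exp_neg_log_div {c : ℝ} (hc : 0 < c) :
    Tendsto (fun n : ℕ => Real.exp (-(Real.log n / c))) atTop (𝓝 0) :=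
  Real.tendsto_exp_neg_atTop_nhds_zero.comp (tendsto_log_natCast.atTop_div_const hc)

lemma eventually_mul_pow_le_exp (C : ℝ) (p : ℕ) {ε : ℝ} (hε : 0 < ε) :
    ∀ᶠ x : ℝ in atTop, C * x ^ p ≤ Real.exp (ε * x) := by
  filter_upwards [((isLittleO_pow_exp_pos_mul_atTop p hε).const_mul_left C).bound one_pos] with x hx
  rw [one_mul, Real.norm_of_nonneg (Real.exp_pos _).le] at hx
  exact (le_abs_self _).trans hx

lemma eventually_mul_log_pow_le_exp (C : ℝ) (p : ℕ) {ε : ℝ} (hε : 0 < ε) :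
    ∀ᶠ n : ℕ in atTop, C * Real.log n ^ p ≤ Real.exp (ε * Real.log n) :=
  tendsto_log_natCast.eventually (eventually_mul_pow_le_exp C p hε)

lemma eventually_mul_log_le_exp_sqrt (C : ℝ) {ε : ℝ} (hε : 0 < ε) :
    ∀ᶠ n : ℕ in atTop, C * Real.log n ≤ Real.exp (ε * √(Real.log n)) := by
  filter_upwards [(Real.tendsto_sqrt_atTop.comp tendsto_log_natCast).eventually
    (eventually_mul_pow_le_exp C 2 hε), tendsto_log_natCast.eventually_ge_atTop 0] with n hn hlog
  rwa [Function.comp_apply, Real.sq_sqrt hlog] at hn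

lemma eventually_mul_log_pow_le (C : ℝ) (p : ℕ) :
    ∀ᶠ n : ℕ in atTop, C * Real.log n ^ p ≤ n := by
  filter_upwards [eventually_mul_log_pow_le_exp C p one_pos, eventually_gt_atTop 0] with n hn hpos
  rwa [one_mul, Real.exp_log (by exact_mod_cast hpos)] at hn

lemma eventually_loglog_le {ε : ℝ} (hε : 0 < ε) :
    ∀ᶠ n : ℕ in atTop, Real.log (Real.log n) ≤ ε * Real.log n := by
  filter_upwards [tendsto_log_natCast.eventually (Real.isLittleO_log_id_atTop.bound hε),
    tendsto_log_natCast.eventually_ge_atTop 0] with n hn hpos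
  rw [id, Real.norm_of_nonneg hpos] at hn
  exact (le_abs_self _).trans hn

lemma eventually_le_pred (k : ℕ) : ∀ᶠ n : ℕ in atTop, k ≤ n - 1 := by
  filter_upwards [eventually_gt_atTop k] with n hn
  omega

lemma mul_one_sub_le_sub_sq_div_two {a z δ : ℝ} (ha : 0 ≤ a) (haz : a ≤ z) (hz : z ≤ 2 * δ)
    (hδ : δ ≤ 1) : a * (1 - δ) ≤ z - z ^ 2 / 2 := by
  calc a * (1 - δ) ≤ z * (1 - z / 2) := by
        gcongr
        · exact ha.trans haz
        · linarith
    _ = z - z ^ 2 / 2 := by ring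

/-- The numerical relations between `n`, `log n` and `log (log n)` on which all the estimates at
the three parameters rest; they hold for all large `n`. -/
structure IsLarge (n : ℕ) : Prop where
  le_log : (1000 : ℝ) ≤ Real.log n
  loglog_nonneg : 0 ≤ Real.log (Real.log n)
  loglog_le : Real.log (Real.log n) ≤ (1 / 200) * Real.log n
  log_sq_le : 1000 * Real.log n ^ 2 ≤ n

lemma eventually_isLarge : ∀ᶠ n : ℕ in atTop, IsLarge n := by
  filter_upwards [tendsto_log_natCast.eventually_ge_atTop 1000,
    eventually_loglog_le (by norm_num : (0 : ℝ) < 1 / 200), eventually_mul_log_pow_le 1000 2]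
    with n hlog hloglog hsq
  exact ⟨hlog, Real.log_nonneg (by linarith), hloglog, hsq⟩

namespace IsLarge

lemma log_le (h : IsLarge n) : 1000000 * Real.log n ≤ n := by
  nlinarith [h.le_log, h.log_sq_le]

lemma le_natCast (h : IsLarge n) : (1000000000 : ℝ) ≤ n := by
  linarith [h.le_log, h.log_le]

lemma natCast_pos (h : IsLarge n) : (0 : ℝ) < n := by linarith [h.le_natCast]

lemma exp_log_eq (h : IsLarge n) : Real.exp (Real.log n) = n := Real.exp_log h.natCast_pos

lemma two_le (h : IsLarge n) : 2 ≤ n := by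
  have : (2 : ℝ) ≤ n := by linarith [h.le_natCast]
  exact_mod_cast this

lemma cast_pred (h : IsLarge n) : ((n - 1 : ℕ) : ℝ) = n - 1 :=
  Nat.cast_pred (by have := h.two_le; omega)

lemma choose_two_pos (h : IsLarge n) : (0 : ℝ) < (n.choose 2 : ℕ) :=
  Nat.cast_pos.2 (Nat.choose_pos h.two_le)

lemma thirty_le_sqrt_log (h : IsLarge n) : 30 ≤ √(Real.log n) :=
  Real.le_sqrt_of_sq_le (by linarith [h.le_log])

lemma sizeThreshold_le_div (h : IsLarge n) : (sizeThreshold n : ℝ) ≤ n / 30 :=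
  (sizeThreshold_le_div_sqrt n).trans
    (div_le_div_of_nonneg_left n.cast_nonneg (by norm_num) h.thirty_le_sqrt_log)

lemma two_mul_sizeThreshold_le (h : IsLarge n) : 2 * sizeThreshold n ≤ n := by
  have : 2 * (sizeThreshold n : ℝ) ≤ n := by linarith [h.sizeThreshold_le_div, h.natCast_pos]
  exact_mod_cast this

lemma earlyTime_le (h : IsLarge n) :
    (earlyTime n : ℝ) ≤ (n : ℝ) * (Real.log n - Real.log (Real.log n) / 2) / 2 := by
  refine Nat.floor_le (div_nonneg (mul_nonneg n.cast_nonneg ?_) zero_le_two)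
  linarith [h.le_log, h.loglog_le]

lemma earlyTime_le_log (h : IsLarge n) : (earlyTime n : ℝ) ≤ (n : ℝ) * Real.log n / 2 := by
  refine h.earlyTime_le.trans ?_
  gcongr
  linarith [h.loglog_nonneg]

lemma lateTime_le (h : IsLarge n) : (lateTime n : ℝ) ≤ 3 * (n : ℝ) * Real.log n :=
  Nat.floor_le (by have := h.le_log; positivity)

lemma lateTime_le_choose (h : IsLarge n) : lateTime n ≤ n.choose 2 := by
  have : (lateTime n : ℝ) ≤ (n.choose 2 : ℕ) := by
    rw [Nat.cast_choose_two ℝ n]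
    nlinarith [h.lateTime_le, h.log_le, h.le_natCast]
  exact_mod_cast this

lemma earlyTime_le_choose (h : IsLarge n) : earlyTime n ≤ n.choose 2 := by
  have : (earlyTime n : ℝ) ≤ (n.choose 2 : ℕ) := by
    rw [Nat.cast_choose_two ℝ n]
    nlinarith [h.earlyTime_le_log, h.log_le, h.le_natCast]
  exact_mod_cast this

lemma sizeThreshold_lt_earlyTime (h : IsLarge n) : sizeThreshold n < earlyTime n := by
  have : (sizeThreshold n : ℝ) < earlyTime n := by
    nlinarith [h.sizeThreshold_le_div, le_earlyTime n, h.loglog_le, h.le_log, h.le_natCast]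
  exact_mod_cast this

lemma lateTime_div_le (h : IsLarge n) :
    (lateTime n : ℝ) / (n.choose 2 : ℕ) ≤ 7 * Real.log n / n := by
  have hn := h.le_natCast
  have hlog : (0 : ℝ) ≤ Real.log n * n := mul_nonneg (by linarith [h.le_log]) n.cast_nonneg
  rw [div_le_div_iff₀ h.choose_two_pos h.natCast_pos, Nat.cast_choose_two ℝ n]
  calc (lateTime n : ℝ) * n ≤ 3 * n * Real.log n * n := by gcongr; exact h.lateTime_le
    _ ≤ 7 * Real.log n * (n * (n - 1) / 2) := by nlinarith

lemma log_div_le_earlyTime (h : IsLarge n) {s z : ℝ} (hs₀ : 0 ≤ s) (hs : s ≤ n / 30 + 1)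
    (hz : z = (earlyTime n - s) / (n.choose 2 : ℕ)) :
    0.98 * Real.log n / n ≤ z - z ^ 2 / 2 := by
  have hn := h.natCast_pos
  have hlog := h.le_log
  have hm : 0.99 * n * Real.log n / 2 ≤ earlyTime n - s := by
    linarith [le_earlyTime n, mul_le_mul_of_nonneg_left h.loglog_le hn.le,
      mul_le_mul_of_nonneg_left hlog hn.le, h.le_natCast]
  have hlow : 0.99 * (Real.log n / n) ≤ z := by
    rw [hz, le_div_iff₀ h.choose_two_pos, Nat.cast_choose_two ℝ n]
    calc 0.99 * (Real.log n / n) * (n * (n - 1) / 2) = 0.99 * (n - 1) * Real.log n / 2 := by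
          field_simp
      _ ≤ 0.99 * n * Real.log n / 2 := by gcongr; linarith
      _ ≤ earlyTime n - s := hm
  have hhigh : z ≤ 2 * (1 / 200) := by
    rw [hz, div_le_iff₀ h.choose_two_pos, Nat.cast_choose_two ℝ n]
    nlinarith [h.earlyTime_le_log, h.log_le]
  calc 0.98 * Real.log n / n = 0.98 * (Real.log n / n) := mul_div_assoc _ _ _
    _ ≤ 0.99 * (Real.log n / n) * (1 - 1 / 200) := by
        nlinarith [div_nonneg (by linarith : 0 ≤ Real.log n) hn.le]
    _ ≤ z - z ^ 2 / 2 :=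
        mul_one_sub_le_sub_sq_div_two (by positivity) hlow hhigh (by norm_num)

lemma log_div_le_lateTime (h : IsLarge n) {z : ℝ} (hz : z = lateTime n / (n.choose 2 : ℕ)) :
    3 * Real.log n / n ≤ z - z ^ 2 / 2 := by
  have hn := h.le_natCast
  have hlog := h.le_log
  have hm : 3 * n * Real.log n - 1 ≤ (lateTime n : ℝ) := (Nat.sub_one_lt_floor _).le
  have hlow : 5 * (Real.log n / n) ≤ z := by
    rw [hz, le_div_iff₀ h.choose_two_pos, Nat.cast_choose_two ℝ n]
    calc 5 * (Real.log n / n) * (n * (n - 1) / 2) = 5 / 2 * (n - 1) * Real.log n := by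
          field_simp
      _ ≤ 3 * n * Real.log n - 1 := by nlinarith
      _ ≤ lateTime n := hm
  have hhigh : z ≤ 2 * (1 / 4) := by
    refine (hz.trans_le h.lateTime_div_le).trans ?_
    rw [div_le_iff₀ h.natCast_pos]
    linarith [h.log_le]
  calc 3 * Real.log n / n = 3 * (Real.log n / n) := mul_div_assoc _ _ _
    _ ≤ 5 * (Real.log n / n) * (1 - 1 / 4) := by
        nlinarith [div_nonneg (by linarith : 0 ≤ Real.log n) h.natCast_pos.le]
    _ ≤ z - z ^ 2 / 2 :=
        mul_one_sub_le_sub_sq_div_two (by positivity) hlow hhigh (by norm_num)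

end IsLarge

end Parameters

section Thresholds

open Finset

variable {n k : ℕ}

namespace IsLarge

lemma earlyTime_mul_log_le (h : IsLarge n) {D : ℝ}
    (hD : D = n.choose 2 - earlyTime n - (n - 2)) : earlyTime n * Real.log n ≤ 2 * D := by
  have hn := h.le_natCast
  have hlog := h.le_log
  rw [hD, Nat.cast_choose_two ℝ n]
  have hsq : n * (1000 * Real.log n ^ 2) ≤ (n : ℝ) * n :=
    mul_le_mul_of_nonneg_left h.log_sq_le n.cast_nonneg
  have hm : earlyTime n * Real.log n ≤ n * Real.log n / 2 * Real.log n :=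
    mul_le_mul_of_nonneg_right h.earlyTime_le_log (by linarith)
  nlinarith [h.earlyTime_le_log, h.log_le]

lemma pred_mul_earlyTime_le (h : IsLarge n) {D : ℝ}
    (hD : D = n.choose 2 - earlyTime n - (n - 2)) :
    (n - 1) * earlyTime n ≤ (Real.log n - Real.log (Real.log n) / 2 + 2) * D := by
  have hn := h.le_natCast
  set w := Real.log n - Real.log (Real.log n) / 2 with hw
  have hw₀ : 0 ≤ w := by linarith [h.le_log, h.loglog_le]
  have hwlog : w ≤ Real.log n := by linarith [h.loglog_nonneg]
  have hquad : (w + 2) * (w / 2 + 1) ≤ n - 1 := by nlinarith [h.log_sq_le, h.le_log]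
  calc (n - 1) * (earlyTime n : ℝ) ≤ (n - 1) * (n * w / 2) :=
        mul_le_mul_of_nonneg_left h.earlyTime_le (by linarith)
    _ = (w + 2) * (n * (n - 1) / 2) - n * (n - 1) := by ring
    _ ≤ (w + 2) * (n * (n - 1) / 2) - n * ((w + 2) * (w / 2 + 1)) := by gcongr
    _ = (w + 2) * (n * (n - 1) / 2 - n * w / 2 - n) := by ring
    _ ≤ (w + 2) * D := by
        rw [hD, Nat.cast_choose_two ℝ n]
        gcongr
        · exact h.earlyTime_le
        · linarith

lemma processLaw_real_isConn_earlyTime_le (h : IsLarge n) (hk : k ≤ n - 1) :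
    (processLaw n k).real {ω | ω.IsConn (earlyTime n)} ≤
      Real.exp 2 * Real.exp (-(Real.log (Real.log n) / 2)) + 2 / Real.log n := by
  have hlog := h.le_log
  have hnpos := h.natCast_pos
  have hcast₂ : ((n - 2 : ℕ) : ℝ) = n - 2 := Nat.cast_sub h.two_le
  have hcond : earlyTime n + (n - 2) < n.choose 2 := by
    have : (earlyTime n : ℝ) + (n - 2 : ℕ) < (n.choose 2 : ℕ) := by
      rw [hcast₂, Nat.cast_choose_two ℝ n]
      nlinarith [h.earlyTime_le_log, h.log_le, h.le_natCast]
    exact_mod_cast this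
  have hD : ((n.choose 2 - earlyTime n - (n - 2) : ℕ) : ℝ) =
      n.choose 2 - earlyTime n - (n - 2) := by
    rw [Nat.cast_sub (by omega), Nat.cast_sub (by omega), hcast₂]
  have hDpos : (0 : ℝ) < (n.choose 2 - earlyTime n - (n - 2) : ℕ) := Nat.cast_pos.2 (by omega)
  refine (processLaw_real_isConn_le hk h.two_le hcond rfl).trans (add_le_add ?_ ?_)
  · rw [← mul_div_assoc, h.cast_pred]
    calc _ ≤ Real.exp (Real.log n - Real.log (Real.log n) / 2 + 2) / n := by
          gcongr
          exact (div_le_iff₀ hDpos).2 (h.pred_mul_earlyTime_le hD)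
      _ = Real.exp 2 * Real.exp (-(Real.log (Real.log n) / 2)) := by
          rw [show Real.log n - Real.log (Real.log n) / 2 + 2 =
            Real.log n + (2 + -(Real.log (Real.log n) / 2)) by ring, Real.exp_add, h.exp_log_eq,
            mul_div_cancel_left₀ _ hnpos.ne', Real.exp_add]
  · rw [div_le_div_iff₀ hDpos (by linarith)]
    exact h.earlyTime_mul_log_le hD

end IsLarge

theorem tendsto_isConn_earlyTime (k : ℕ) :
    Tendsto (fun n => (processLaw n k).real {ω | ω.IsConn (earlyTime n)}) atTop (𝓝 0) := by
  have hloglog : Tendsto (fun n : ℕ => Real.log (Real.log n) / 2) atTop atTop :=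
    (Real.tendsto_log_atTop.comp tendsto_log_natCast).atTop_div_const two_pos
  have hlim := ((Real.tendsto_exp_neg_atTop_nhds_zero.comp hloglog).const_mul (Real.exp 2)).add
    ((tendsto_const_nhds (x := (2 : ℝ))).div_atTop tendsto_log_natCast)
  rw [mul_zero, add_zero] at hlim
  refine squeeze_zero' (Eventually.of_forall fun n => measureReal_nonneg) ?_ hlim
  filter_upwards [eventually_isLarge, eventually_le_pred k] with n h hk
  exact h.processLaw_real_isConn_earlyTime_le hk

lemma sum_pow_Icc_le {x : ℝ} (hx₀ : 0 ≤ x) (hx : x ≤ 1 / 2) (M : ℕ) :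
    ∑ u ∈ Icc 1 M, x ^ u ≤ 2 * x := by
  have hgeom : ∑ u ∈ range M, x ^ u ≤ 2 := by
    nlinarith [mul_neg_geom_sum x M, pow_nonneg hx₀ M,
      sum_nonneg fun u (_ : u ∈ range M) => pow_nonneg hx₀ u]
  calc ∑ u ∈ Icc 1 M, x ^ u = (∑ u ∈ range M, x ^ u) * x := by
        rw [sum_mul, ← Ico_add_one_right_eq_Icc, sum_Ico_eq_sum_range]
        simp only [Nat.add_sub_cancel, add_comm 1, pow_succ]
    _ ≤ 2 * x := mul_le_mul_of_nonneg_right hgeom hx₀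

lemma exists_empty_cut_of_not_isConn (hn : n ≠ 0) {ω : Outcome n k} {m : ℕ} (hω : ¬ω.IsConn m) :
    ∃ u ∈ Icc 1 (n / 2), ∃ U ∈ powersetCard u (univ : Finset (Fin n)),
      ∀ e ∈ cutEdges U, e ∉ ω.edges m := by
  have : NeZero n := ⟨hn⟩
  have hcomps : 2 ≤ numComps (firstEdges ω m) := by
    by_contra! hlt
    have hconn := connected_of_numComps_le_one (E := firstEdges ω m) (by omega)
    rw [graphOf_firstEdges] at hconn
    exact hω hconn
  obtain ⟨U, hU, hUn, hdisj⟩ := exists_balanced_cut (firstEdges ω m)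
  rw [Fintype.card_fin] at hUn
  exact ⟨#U, mem_Icc.2 ⟨by omega, by omega⟩, U, mem_powersetCard.2 ⟨subset_univ U, rfl⟩,
    fun e hcut he => disjoint_left.1 hdisj (mem_firstEdges.2 he) hcut⟩

namespace IsLarge

lemma choose_le_exp_mul_log (h : IsLarge n) (u : ℕ) :
    (n.choose u : ℝ) ≤ Real.exp (u * Real.log n) := by
  rw [Real.exp_nat_mul, h.exp_log_eq]
  exact_mod_cast Nat.choose_le_pow n u

lemma processLaw_real_cutEdges_lateTime_le (h : IsLarge n) (hk : k ≤ n - 1)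
    {U : Finset (Fin n)} (hU : 2 * #U ≤ n) :
    (processLaw n k).real {ω | ∀ e ∈ cutEdges U, e ∉ ω.edges (lateTime n)} ≤
      Real.exp (-(3 / 2 * Real.log n)) ^ #U := by
  refine (processLaw_real_forall_early_good_le hk (cutEdges U) h.lateTime_le_choose
    (fun _ => False) rfl).trans ?_
  have hcut : (#U : ℝ) * (n / 2) ≤ (#U * (n - #U) : ℕ) := by
    have hU' : 2 * (#U : ℝ) ≤ n := by exact_mod_cast hU
    rw [Nat.cast_mul, Nat.cast_sub (by omega : #U ≤ n)]
    gcongr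
    linarith
  have hlog := h.le_log
  have hnpos := h.natCast_pos
  rw [← Real.exp_nat_mul, Real.exp_le_exp, mul_neg, neg_le_neg_iff, colourProb_false, sub_zero,
    mul_one, card_cutEdges_top, Fintype.card_fin]
  calc #U * (3 / 2 * Real.log n) = #U * (n / 2) * (3 * Real.log n / n) := by field_simp
    _ ≤ _ := by
        gcongr
        exact h.log_div_le_lateTime rfl

lemma processLaw_real_not_isConn_lateTime_le (h : IsLarge n) (hk : k ≤ n - 1) :
    (processLaw n k).real {ω | ¬ω.IsConn (lateTime n)} ≤ 2 * Real.exp (-(Real.log n / 2)) := by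
  have := isProbabilityMeasure_processLaw hk
  have hhalf : Real.exp (-(Real.log n / 2)) ≤ 1 / 2 := by
    rw [Real.exp_neg, one_div]
    exact inv_anti₀ two_pos (by linarith [h.le_log, Real.add_one_le_exp (Real.log n / 2)])
  refine le_trans ?_ (sum_pow_Icc_le (Real.exp_pos _).le hhalf (n / 2))
  refine (measureReal_mono fun ω hω =>
    exists_empty_cut_of_not_isConn (by have := h.two_le; omega) hω).trans
    (measureReal_exists_le_sum fun u hu => ?_)
  rw [mem_Icc] at hu
  refine (measureReal_exists_mem_powersetCard_le (N := n) (card_fin n).le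
    (by positivity) fun U _ hUu => hUu ▸ h.processLaw_real_cutEdges_lateTime_le hk
    (by omega)).trans ?_
  calc n.choose u * Real.exp (-(3 / 2 * Real.log n)) ^ u
      ≤ Real.exp (u * Real.log n) * Real.exp (-(3 / 2 * Real.log n)) ^ u := by
        gcongr
        exact h.choose_le_exp_mul_log u
    _ = Real.exp (-(Real.log n / 2)) ^ u := by
        rw [Real.exp_nat_mul, ← mul_pow, ← Real.exp_add]
        ring_nf

end IsLarge

theorem tendsto_not_isConn_lateTime (k : ℕ) :
    Tendsto (fun n => (processLaw n k).real {ω | ¬ω.IsConn (lateTime n)}) atTop (𝓝 0) := by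
  have hlim := (tendsto_exp_neg_log_div two_pos).const_mul 2
  rw [mul_zero] at hlim
  refine squeeze_zero' (Eventually.of_forall fun n => measureReal_nonneg) ?_ hlim
  filter_upwards [eventually_isLarge, eventually_le_pred k] with n h hk
  exact h.processLaw_real_not_isConn_lateTime_le hk

namespace IsLarge

lemma processLaw_real_colour_missing_lateTime_le (h : IsLarge n) (hk : 2 ≤ k) (hkn : k ≤ n - 1)
    (w : Fin (n - 1)) :
    (processLaw n k).real {ω | ∀ e ∈ ω.edges (lateTime n), w ∉ ω.colours e} ≤
      Real.exp (-(3 / 2 * Real.log n)) := by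
  have hn := h.le_natCast
  have hlog := h.le_log
  have hpred : (0 : ℝ) < n - 1 := by linarith
  have havoid : 1 / ((n : ℝ) - 1) ≤ 1 - colourProb n k (fun S => Disjoint S {w}) := by
    have hsq := colourProb_disjoint_le_sq hk {w}
    rw [card_singleton, Nat.cast_pred (by omega), h.cast_pred] at hsq
    have hle : (((n : ℝ) - 1 - 1) / (n - 1)) ^ 2 ≤ (n - 1 - 1) / (n - 1) :=
      pow_le_of_le_one (div_nonneg (by linarith) hpred.le)
        (div_le_one_of_le₀ (by linarith) hpred.le) two_ne_zero
    rw [sub_div _ 1, div_self hpred.ne'] at hle hsq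
    linarith
  have hevent : {ω : Outcome n k | ∀ e ∈ ω.edges (lateTime n), w ∉ ω.colours e} =
      {ω | ∀ e ∈ (univ : Finset (KEdge n)), e ∈ ω.edges (lateTime n) →
        Disjoint (ω.colours e) {w}} := by
    simp only [mem_univ, true_imp_iff, disjoint_singleton_right]
  rw [hevent]
  refine (processLaw_real_forall_early_good_le hkn univ h.lateTime_le_choose
    (fun S => Disjoint S {w}) rfl).trans ?_
  rw [Real.exp_le_exp, neg_le_neg_iff, card_univ, card_KEdge]
  calc 3 / 2 * Real.log n
      = (n.choose 2 : ℕ) * (1 / ((n : ℝ) - 1)) * (3 * Real.log n / n) := by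
        rw [Nat.cast_choose_two ℝ n]
        field_simp
    _ ≤ _ := by
        gcongr
        · exact mul_nonneg (Nat.cast_nonneg _) ((one_div_pos.2 hpred).le.trans havoid)
        · exact h.log_div_le_lateTime rfl

lemma processLaw_real_not_allColours_lateTime_le (h : IsLarge n) (hk : 2 ≤ k) (hkn : k ≤ n - 1) :
    (processLaw n k).real {ω | ¬ω.AllColours (lateTime n)} ≤ Real.exp (-(Real.log n / 2)) := by
  have := isProbabilityMeasure_processLaw hkn
  calc (processLaw n k).real {ω | ¬ω.AllColours (lateTime n)}
      ≤ (processLaw n k).real {ω | ∃ w ∈ (univ : Finset (Fin (n - 1))),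
          ∀ e ∈ ω.edges (lateTime n), w ∉ ω.colours e} := measureReal_mono fun ω hω => by
        obtain ⟨w, hw⟩ := not_forall.1 hω
        exact ⟨w, mem_univ w, fun e he hwe => hw ⟨e, he, hwe⟩⟩
    _ ≤ (n - 1 : ℕ) * Real.exp (-(3 / 2 * Real.log n)) :=
        (measureReal_exists_le_card_mul fun w _ =>
          h.processLaw_real_colour_missing_lateTime_le hk hkn w).trans_eq (by rw [card_fin])
    _ ≤ n * Real.exp (-(3 / 2 * Real.log n)) := by
        gcongr
        exact n.sub_le 1
    _ = Real.exp (-(Real.log n / 2)) := by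
        nth_rw 1 [← h.exp_log_eq]
        rw [← Real.exp_add]
        ring_nf

end IsLarge

theorem tendsto_not_allColours_lateTime (hk : 2 ≤ k) :
    Tendsto (fun n => (processLaw n k).real {ω | ¬ω.AllColours (lateTime n)}) atTop (𝓝 0) := by
  refine squeeze_zero' (Eventually.of_forall fun n => measureReal_nonneg) ?_
    (tendsto_exp_neg_log_div two_pos)
  filter_upwards [eventually_isLarge, eventually_le_pred k] with n h hkn
  exact h.processLaw_real_not_allColours_lateTime_le hk hkn

end Thresholds

section SmallColourSets

open Finset

variable {n k r d v s : ℕ}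

lemma choose_le_exp_mul_div_pow (a : ℕ) {b : ℕ} (hb : 0 < b) :
    (a.choose b : ℝ) ≤ (Real.exp 1 * a / b) ^ b := by
  have hb' : (0 : ℝ) < b := Nat.cast_pos.2 hb
  have hfact : (0 : ℝ) < b.factorial := Nat.cast_pos.2 b.factorial_pos
  have hstirling : (b : ℝ) ^ b ≤ Real.exp b * b.factorial :=
    (div_le_iff₀ hfact).1 (Real.pow_div_factorial_le_exp b hb'.le b)
  calc (a.choose b : ℝ) ≤ (a : ℝ) ^ b / b.factorial := Nat.choose_le_pow_div b a
    _ ≤ (a : ℝ) ^ b * Real.exp b / (b : ℝ) ^ b := by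
        rw [div_le_div_iff₀ hfact (by positivity), mul_assoc]
        gcongr
    _ = (Real.exp 1 * a / b) ^ b := by
        rw [div_pow, mul_pow, ← Real.exp_nat_mul, mul_one, mul_comm]

lemma one_le_sqrt_exp_mul_div (hr : 0 < r) (hrn : r ≤ n) : 1 ≤ √(Real.exp 1 * n / r) := by
  have hrn' : (r : ℝ) ≤ n := by exact_mod_cast hrn
  rw [Real.one_le_sqrt, one_le_div (Nat.cast_pos.2 hr)]
  nlinarith [Real.one_le_exp zero_le_one, (Nat.cast_pos.2 hr : (0 : ℝ) < r)]

lemma choose_le_sqrt_pow (hr : 0 < r) (hrn : r ≤ n) (hrv : r ≤ v) (hvs : 2 * v ≤ s) :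
    (n.choose v : ℝ) ≤ √(Real.exp 1 * n / r) ^ s := by
  calc (n.choose v : ℝ) ≤ (Real.exp 1 * n / v) ^ v := choose_le_exp_mul_div_pow n (by omega)
    _ ≤ (√(Real.exp 1 * n / r) ^ 2) ^ v := by
        rw [Real.sq_sqrt (by positivity)]
        gcongr
    _ = √(Real.exp 1 * n / r) ^ (2 * v) := (pow_mul _ _ _).symm
    _ ≤ √(Real.exp 1 * n / r) ^ s := pow_le_pow_right₀ (one_le_sqrt_exp_mul_div hr hrn) hvs

lemma choose_sq_le_pow (hr : 0 < r) (hv : v ≤ 2 * r) :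
    ((v ^ 2).choose r : ℝ) ≤ (4 * Real.exp 1 * r) ^ r := by
  have hv' : (v : ℝ) ≤ 2 * r := by exact_mod_cast hv
  refine (choose_le_exp_mul_div_pow (v ^ 2) hr).trans (pow_le_pow_left₀ (by positivity) ?_ r)
  rw [div_le_iff₀ (Nat.cast_pos.2 hr), Nat.cast_pow]
  calc Real.exp 1 * (v : ℝ) ^ 2 ≤ Real.exp 1 * (2 * r) ^ 2 := by gcongr
    _ = 4 * Real.exp 1 * r * r := by ring

lemma placements_eq (hr : 0 < r) (hrn : r ≤ n) {q : ℝ} (hq : q ≠ 0)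
    (hq₂ : q ^ 2 = Real.exp 1 * n / r) (K L : ℝ) :
    q ^ (3 * r + d) * ((4 * Real.exp 1 * r) ^ r * (2 ^ r * ((7 * L / n) ^ r *
      (K * r / n) ^ (r + d)))) =
    (56 * Real.exp 1 ^ 2 * L) ^ r * (K * Real.exp 1) ^ (r + d) * (1 / q) ^ (r + d) := by
  have hrn₀ : (r : ℝ) / n = Real.exp 1 / q ^ 2 := by
    have : (n : ℝ) ≠ 0 := Nat.cast_ne_zero.2 (by omega)
    have : (r : ℝ) ≠ 0 := Nat.cast_ne_zero.2 hr.ne'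
    rw [hq₂]
    field_simp
  have hedges : (4 * Real.exp 1 * r) ^ r * (2 ^ r * (7 * L / n) ^ r) =
      (56 * Real.exp 1 ^ 2 * L / q ^ 2) ^ r := by
    rw [← mul_pow, ← mul_pow]
    congr 1
    calc 4 * Real.exp 1 * r * (2 * (7 * L / n)) = 56 * Real.exp 1 * L * (r / n) := by ring
      _ = 56 * Real.exp 1 ^ 2 * L / q ^ 2 := by rw [hrn₀]; ring
  calc q ^ (3 * r + d) * ((4 * Real.exp 1 * r) ^ r * (2 ^ r * ((7 * L / n) ^ r *
        (K * r / n) ^ (r + d))))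
      = q ^ (3 * r + d) * ((4 * Real.exp 1 * r) ^ r * (2 ^ r * (7 * L / n) ^ r) *
        (K * (r / n)) ^ (r + d)) := by ring
    _ = q ^ (3 * r + d) * ((56 * Real.exp 1 ^ 2 * L / q ^ 2) ^ r *
        (K * (Real.exp 1 / q ^ 2)) ^ (r + d)) := by rw [hedges, hrn₀]
    _ = _ := by
        simp only [div_pow, mul_pow, one_pow, ← pow_mul]
        field_simp
        ring

lemma placements_le (hr : 0 < r) (hd : d ≤ r) (hrn : r ≤ n) {K L : ℝ} (hK : 1 ≤ K)
    (hL : 0 ≤ L) :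
    √(Real.exp 1 * n / r) ^ (3 * r + d) * ((4 * Real.exp 1 * r) ^ r * (2 ^ r *
      ((7 * L / n) ^ r * (K * r / n) ^ (r + d)))) ≤
    (56 * Real.exp 1 ^ 2 * (K * Real.exp 1) ^ 2 * L / √(Real.exp 1 * n / r)) ^ r := by
  have hq : 1 ≤ √(Real.exp 1 * n / r) := one_le_sqrt_exp_mul_div hr hrn
  have hKe : 1 ≤ K * Real.exp 1 := one_le_mul_of_one_le_of_one_le hK (Real.one_le_exp zero_le_one)
  rw [placements_eq hr hrn (by positivity) (Real.sq_sqrt (by positivity))]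
  calc (56 * Real.exp 1 ^ 2 * L) ^ r * (K * Real.exp 1) ^ (r + d) *
        (1 / √(Real.exp 1 * n / r)) ^ (r + d)
      ≤ (56 * Real.exp 1 ^ 2 * L) ^ r * (K * Real.exp 1) ^ (2 * r) *
        (1 / √(Real.exp 1 * n / r)) ^ r := by
        gcongr ?_ * ?_ * ?_
        · exact pow_le_pow_right₀ hKe (by omega)
        · exact pow_le_pow_of_le_one (by positivity)
            ((div_le_one (by positivity)).2 hq) (by omega)
    _ = _ := by
        rw [pow_mul, ← mul_pow, ← mul_pow]
        congr 1
        ring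

lemma choose_pred_mul_inv_pow_le (hr : 0 < r) {t : ℝ} (ht₀ : 0 < t) (ht : t ^ 16 = n) :
    ((n - 1).choose (r + 1) : ℝ) * ((t ^ 15) ^ (r + 1))⁻¹ ≤
      (Real.exp 1 * t / r) ^ r * (Real.exp 1 * t) := by
  have _ : (0 : ℝ) < r := Nat.cast_pos.2 hr
  calc ((n - 1).choose (r + 1) : ℝ) * ((t ^ 15) ^ (r + 1))⁻¹
      ≤ (Real.exp 1 * n / (r + 1 : ℕ)) ^ (r + 1) * ((t ^ 15) ^ (r + 1))⁻¹ := by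
        gcongr
        exact (Nat.cast_le.2 (Nat.choose_le_choose _ n.pred_le)).trans
          (choose_le_exp_mul_div_pow n r.succ_pos)
    _ = (Real.exp 1 * t / (r + 1 : ℕ)) ^ r * (Real.exp 1 * t / (r + 1 : ℕ)) := by
        rw [← inv_pow, ← mul_pow, ← pow_succ, ← ht]
        congr 1
        field_simp
    _ ≤ (Real.exp 1 * t / r) ^ r * (Real.exp 1 * t) := by
        gcongr
        · exact r.le_succ
        · exact div_le_self (by positivity) (by exact_mod_cast r.succ_pos)

lemma pow_eight_le_mul_sqrt (hr : 0 < r) {t : ℝ} (ht : t ^ 16 = n) :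
    t ^ 8 ≤ r * √(Real.exp 1 * n / r) := by
  have hr' : (1 : ℝ) ≤ r := by exact_mod_cast hr
  refine (pow_le_pow_iff_left₀ (by positivity) (by positivity) two_ne_zero).1 ?_
  calc (t ^ 8) ^ 2 = 1 * 1 * (n : ℝ) := by rw [← ht]; ring
    _ ≤ r * Real.exp 1 * n := by
        gcongr
        exact Real.one_le_exp zero_le_one
    _ = (r * √(Real.exp 1 * n / r)) ^ 2 := by
        rw [mul_pow, Real.sq_sqrt (by positivity)]
        field_simp

lemma smallObstruction_term_le (hr : 0 < r) (hd : d ≤ r) (hrn : r ≤ n) {t K L p y : ℝ} (ht₀ : 0 < t)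
    (ht : t ^ 16 = n) (hK : 1 ≤ K) (hp₀ : 0 ≤ p) (hp : p ≤ 7 * L / n) (hy₀ : 0 ≤ y)
    (hy : y ≤ K * r / n) :
    ((n - 1).choose (r + 1) : ℝ) * ((n.choose ((3 * r + d) / 2) : ℝ) *
      (((((3 * r + d) / 2) ^ 2).choose r : ℝ) * ((r.choose d : ℝ) *
        (p ^ r * y ^ (r + d) * ((t ^ 15) ^ (r + 1))⁻¹)))) ≤
      Real.exp 1 * t * (56 * Real.exp 1 ^ 3 * (K * Real.exp 1) ^ 2 * L * t / t ^ 8) ^ r := by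
  have hn : (0 : ℝ) < n := Nat.cast_pos.2 (hr.trans_le hrn)
  have hL : 0 ≤ L := by
    have := (le_div_iff₀ hn).1 (hp₀.trans hp)
    linarith
  calc _ = ((n - 1).choose (r + 1) : ℝ) * ((t ^ 15) ^ (r + 1))⁻¹ *
        ((n.choose ((3 * r + d) / 2) : ℝ) * (((((3 * r + d) / 2) ^ 2).choose r : ℝ) *
          ((r.choose d : ℝ) * (p ^ r * y ^ (r + d))))) := by ring
    _ ≤ (Real.exp 1 * t / r) ^ r * (Real.exp 1 * t) *
        (√(Real.exp 1 * n / r) ^ (3 * r + d) * ((4 * Real.exp 1 * r) ^ r * (2 ^ r *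
          ((7 * L / n) ^ r * (K * r / n) ^ (r + d))))) := by
        refine mul_le_mul (choose_pred_mul_inv_pow_le hr ht₀ ht) ?_ (by positivity) (by positivity)
        gcongr
        · exact choose_le_sqrt_pow hr hrn (by omega) (by omega)
        · exact choose_sq_le_pow hr (by omega)
        · exact_mod_cast r.choose_le_two_pow d
    _ ≤ (Real.exp 1 * t / r) ^ r * (Real.exp 1 * t) *
        (56 * Real.exp 1 ^ 2 * (K * Real.exp 1) ^ 2 * L / √(Real.exp 1 * n / r)) ^ r := by
        gcongr
        exact placements_le hr hd hrn hK hL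
    _ = Real.exp 1 * t *
        (56 * Real.exp 1 ^ 3 * (K * Real.exp 1) ^ 2 * L * t /
          (r * √(Real.exp 1 * n / r))) ^ r := by
        rw [mul_comm (_ ^ r) (Real.exp 1 * t), mul_assoc, ← mul_pow, div_mul_div_comm]
        congr 3
        ring
    _ ≤ _ := by
        gcongr
        exact pow_eight_le_mul_sqrt hr ht

lemma one_sub_div_sq_eq {M i : ℕ} (hM : M ≠ 0) (hi : i ≤ M) :
    1 - (((M - i : ℕ) : ℝ) / M) ^ 2 = i / M * (2 - i / M) := by
  rw [Nat.cast_sub hi, sub_div, div_self (Nat.cast_ne_zero.2 hM)]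
  ring

namespace IsLarge

lemma smallObstruction_exponent_le (h : IsLarge n) (hr : r < sizeThreshold n)
    (hv : v ≤ 2 * (r + 1)) {z : ℝ} (hz : z = (earlyTime n - r) / (n.choose 2 : ℕ)) :
    15 / 16 * (r + 1 : ℕ) * Real.log n ≤ ((n.choose 2 : ℕ) - (v : ℝ) ^ 2) *
      (1 - (((n - 1 - (r + 1) : ℕ) : ℝ) / (n - 1 : ℕ)) ^ 2) * (z - z ^ 2 / 2) := by
  have hn := h.le_natCast
  have hpred : (0 : ℝ) < n - 1 := by linarith
  have hsize : ((r + 1 : ℕ) : ℝ) ≤ n / 30 :=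
    (Nat.cast_le.2 hr).trans h.sizeThreshold_le_div
  have hlt : r + 1 ≤ n - 1 := by
    have : ((r + 1 : ℕ) : ℝ) ≤ (n - 1 : ℕ) := by rw [h.cast_pred]; linarith
    exact_mod_cast this
  set i := r + 1 with hi
  have hearly := h.log_div_le_earlyTime r.cast_nonneg
    (by rw [hi, Nat.cast_succ] at hsize; linarith) hz
  have havoid : 1.96 * ((i : ℝ) / (n - 1)) ≤
      1 - (((n - 1 - i : ℕ) : ℝ) / (n - 1 : ℕ)) ^ 2 := by
    rw [one_sub_div_sq_eq (by omega) hlt, h.cast_pred, mul_comm]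
    gcongr
    have : (i : ℝ) / (n - 1) ≤ 0.04 := (div_le_iff₀ hpred).2 (by linarith)
    linarith
  have hedges : 0.99 * ((n : ℝ) * (n - 1) / 2) ≤ (n.choose 2 : ℕ) - (v : ℝ) ^ 2 := by
    have : (v : ℝ) ^ 2 ≤ (2 * (n / 30)) ^ 2 := by
      have hv' : (v : ℝ) ≤ 2 * i := by exact_mod_cast hv
      gcongr
      linarith
    rw [Nat.cast_choose_two ℝ n]
    nlinarith
  have hlog : 0 ≤ Real.log n := by linarith [h.le_log]
  calc 15 / 16 * (i : ℝ) * Real.log n ≤ 0.99 * 1.96 * 0.98 / 2 * i * Real.log n := by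
        linarith [mul_nonneg i.cast_nonneg hlog]
    _ = 0.99 * ((n : ℝ) * (n - 1) / 2) * (1.96 * ((i : ℝ) / (n - 1))) *
        (0.98 * Real.log n / n) := by field_simp
    _ ≤ _ := by
        have havoid₀ : 0 ≤ 1.96 * ((i : ℝ) / (n - 1)) := by positivity
        have hedges₀ : 0 ≤ 0.99 * ((n : ℝ) * (n - 1) / 2) := by positivity
        exact mul_le_mul (mul_le_mul hedges havoid havoid₀ (hedges₀.trans hedges)) hearly
          (by positivity) (mul_nonneg (hedges₀.trans hedges) (havoid₀.trans havoid))

lemma colour_ratio_le (h : IsLarge n) (k : ℕ) (hr : 0 < r) :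
    (k * (r + 1 : ℕ) : ℝ) / (n - 1 : ℕ) ≤ 4 * k * r / n := by
  have hr' : (1 : ℝ) ≤ r := by exact_mod_cast hr
  have hle : ((r + 1 : ℕ) : ℝ) * n ≤ 4 * r * (n - 1) := by
    push_cast
    nlinarith [h.le_natCast]
  rw [h.cast_pred, div_le_div_iff₀ (by linarith [h.le_natCast]) h.natCast_pos]
  linarith [mul_le_mul_of_nonneg_left hle (k.cast_nonneg (α := ℝ))]

lemma smallObstruction_sum_le (h : IsLarge n) (hk : 1 ≤ k)
    (hC : 56 * Real.exp 1 ^ 3 * (4 * k * Real.exp 1) ^ 2 * Real.log n ≤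
      Real.exp (1 / 16 * Real.log n)) (hr : 0 < r) (hrn : r ≤ n) :
    ((n - 1).choose (r + 1) : ℝ) * ∑ d ∈ range (r + 1), (n.choose ((3 * r + d) / 2) : ℝ) *
      (((((3 * r + d) / 2) ^ 2).choose r : ℝ) * ((r.choose d : ℝ) *
        (((lateTime n : ℝ) / (n.choose 2 : ℕ)) ^ r *
          ((k * (r + 1 : ℕ) : ℝ) / (n - 1 : ℕ)) ^ (r + d) *
          Real.exp (-(15 / 16 * (r + 1 : ℕ) * Real.log n))))) ≤
      Real.exp (1 / 8 * Real.log n) * (2 * Real.exp (-(3 / 8 * Real.log n))) ^ r := by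
  have hlog := h.le_log
  set t := Real.exp (1 / 16 * Real.log n) with ht
  have hpow (a : ℕ) : t ^ a = Real.exp (a / 16 * Real.log n) := by
    rw [ht, ← Real.exp_nat_mul]
    ring_nf
  have ht₁₆ : t ^ 16 = n := by rw [hpow, ← h.exp_log_eq, Real.log_exp]; norm_num
  have he : Real.exp 1 ≤ t := Real.exp_le_exp.2 (by linarith)
  have hprob : Real.exp (-(15 / 16 * (r + 1 : ℕ) * Real.log n)) = ((t ^ 15) ^ (r + 1))⁻¹ := by
    rw [hpow, ← Real.exp_nat_mul, ← Real.exp_neg]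
    push_cast
    ring_nf
  have hK : (1 : ℝ) ≤ 4 * k := by exact_mod_cast (by omega : 1 ≤ 4 * k)
  have hterm := fun d (hd : d ∈ range (r + 1)) =>
    smallObstruction_term_le hr (Nat.lt_succ_iff.1 (mem_range.1 hd)) hrn (Real.exp_pos _) ht₁₆
      hK (by positivity) h.lateTime_div_le (by positivity) (h.colour_ratio_le k hr)
  rw [mul_sum, hprob]
  refine (sum_le_sum hterm).trans ?_
  rw [sum_const, card_range, nsmul_eq_mul]
  calc ((r + 1 : ℕ) : ℝ) * (Real.exp 1 * t *
        (56 * Real.exp 1 ^ 3 * (4 * k * Real.exp 1) ^ 2 * Real.log n * t / t ^ 8) ^ r)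
      ≤ 2 ^ r * (t * t * (t * t / t ^ 8) ^ r) := by
        gcongr
        exact_mod_cast Nat.lt_two_pow_self
    _ = t ^ 2 * (2 * (t ^ 6)⁻¹) ^ r := by
        rw [mul_pow 2]
        field_simp
    _ = _ := by
        rw [hpow, hpow, ← Real.exp_neg]
        norm_num

lemma processLaw_real_smallObstruction_le (h : IsLarge n) (hk : 2 ≤ k) (hkn : k ≤ n - 1)
    (hC : 56 * Real.exp 1 ^ 3 * (4 * k * Real.exp 1) ^ 2 * Real.log n ≤
      Real.exp (1 / 16 * Real.log n)) :
    (processLaw n k).real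
        (smallObstruction n k (earlyTime n) (lateTime n) (sizeThreshold n)) ≤
      4 * Real.exp (-(Real.log n / 4)) := by
  have hsize := h.sizeThreshold_lt_earlyTime
  have hsize_le := h.two_mul_sizeThreshold_le
  refine (measureReal_smallObstruction_le (B := fun r d =>
    ((lateTime n : ℝ) / (n.choose 2 : ℕ)) ^ r * ((k * (r + 1 : ℕ) : ℝ) / (n - 1 : ℕ)) ^ (r + d) *
      Real.exp (-(15 / 16 * (r + 1 : ℕ) * Real.log n))) (fun r d => by positivity)
    fun I V T D hT hI hV hTV hDT => ?_).trans ?_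
  · rw [mem_Ico] at hT
    have hD := card_le_card hDT
    refine (processLaw_real_confinedColours_le hk hkn (by omega) h.earlyTime_le_choose
      h.lateTime_le_choose hTV hDT rfl ?_).trans_eq (by rw [hI])
    rw [hI]
    exact h.smallObstruction_exponent_le hT.2 (by omega) rfl
  have hlog := h.le_log
  have hhalf : 2 * Real.exp (-(3 / 8 * Real.log n)) ≤ 1 / 2 := by
    rw [Real.exp_neg, ← div_eq_mul_inv, div_le_div_iff₀ (Real.exp_pos _) two_pos]
    linarith [Real.add_one_le_exp (3 / 8 * Real.log n)]
  calc _ ≤ ∑ r ∈ Ico 1 (sizeThreshold n),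
        Real.exp (1 / 8 * Real.log n) * (2 * Real.exp (-(3 / 8 * Real.log n))) ^ r :=
        sum_le_sum fun r hr => by
          rw [mem_Ico] at hr
          exact h.smallObstruction_sum_le (by omega) hC hr.1 (by omega)
    _ ≤ Real.exp (1 / 8 * Real.log n) * (2 * (2 * Real.exp (-(3 / 8 * Real.log n)))) := by
        rw [← mul_sum]
        gcongr
        exact (sum_le_sum_of_subset_of_nonneg Ico_subset_Icc_self fun _ _ _ => by
          positivity).trans (sum_pow_Icc_le (by positivity) hhalf _)
    _ = 4 * Real.exp (-(Real.log n / 4)) := by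
        rw [← mul_assoc 2 2, mul_left_comm, ← Real.exp_add]
        ring_nf

end IsLarge

theorem tendsto_smallObstruction (hk : 2 ≤ k) :
    Tendsto (fun n => (processLaw n k).real
      (smallObstruction n k (earlyTime n) (lateTime n) (sizeThreshold n))) atTop (𝓝 0) := by
  have hlim := (tendsto_exp_neg_log_div four_pos).const_mul 4
  rw [mul_zero] at hlim
  refine squeeze_zero' (Eventually.of_forall fun n => measureReal_nonneg) ?_ hlim
  filter_upwards [eventually_isLarge, eventually_le_pred k,
    eventually_mul_log_pow_le_exp (56 * Real.exp 1 ^ 3 * (4 * k * Real.exp 1) ^ 2) 1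
      (by norm_num : (0 : ℝ) < 1 / 16)] with n h hkn hC
  rw [pow_one] at hC
  exact h.processLaw_real_smallObstruction_le hk hkn hC

end SmallColourSets

section BalancedCuts

open Finset

variable {n k i u : ℕ}

lemma div_sqrt_log_le_of_sizeThreshold_lt (h : sizeThreshold n < i) : (n : ℝ) / √(Real.log n) ≤ i :=
  (Nat.lt_floor_add_one _).le.trans (by exact_mod_cast h)

namespace IsLarge

lemma div_sqrt_log_mul_le (h : IsLarge n) {j : ℕ} (hi : sizeThreshold n < i)
    (hj : sizeThreshold n < j) (hij : i + j = n - 1) :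
    (n : ℝ) / √(Real.log n) * (n / 3) ≤ i * j := by
  have hsum : (i : ℝ) + j = n - 1 := by rw [← h.cast_pred, ← hij, Nat.cast_add]
  have hn := h.le_natCast
  rcases le_total (i : ℝ) j with hle | hle
  · exact mul_le_mul (div_sqrt_log_le_of_sizeThreshold_lt hi) (by linarith) (by positivity)
      i.cast_nonneg
  · rw [mul_comm (i : ℝ)]
    exact mul_le_mul (div_sqrt_log_le_of_sizeThreshold_lt hj) (by linarith) (by positivity)
      j.cast_nonneg

lemma balancedObstruction_exponent_le (h : IsLarge n) (hi : sizeThreshold n < i)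
    (hj : sizeThreshold n < n - 1 - i) (hu : n - 1 - i + 1 ≤ 2 * u) (hun : 2 * u ≤ n) {z : ℝ}
    (hz : z = earlyTime n / (n.choose 2 : ℕ)) :
    2 * (n : ℝ) ≤ (u * (n - u) : ℕ) * (1 - (((n - 1 - i : ℕ) : ℝ) / (n - 1 : ℕ)) ^ 2) *
      (z - z ^ 2 / 2) := by
  have hn := h.natCast_pos
  have hearly := h.log_div_le_earlyTime le_rfl (by positivity) (z := z) (by rw [hz, sub_zero])
  have hpred : (0 : ℝ) < (n - 1 : ℕ) := by rw [h.cast_pred]; linarith [h.le_natCast]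
  have havoid : (i : ℝ) / n ≤ 1 - (((n - 1 - i : ℕ) : ℝ) / (n - 1 : ℕ)) ^ 2 := by
    have hi' : (i : ℝ) / (n - 1 : ℕ) ≤ 1 :=
      (div_le_one hpred).2 (by exact_mod_cast (by omega : i ≤ n - 1))
    rw [one_sub_div_sq_eq (by omega) (by omega)]
    calc (i : ℝ) / n ≤ i / (n - 1 : ℕ) * 1 := by
          rw [mul_one]
          gcongr
          exact n.sub_le 1
      _ ≤ i / (n - 1 : ℕ) * (2 - i / (n - 1 : ℕ)) := by gcongr; linarith
  have hprod := h.div_sqrt_log_mul_le hi hj (by omega)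
  set j := n - 1 - i
  have hcut : (j : ℝ) / 2 * (n / 2) ≤ (u * (n - u) : ℕ) := by
    have hju : (j : ℝ) ≤ 2 * u := by exact_mod_cast (by omega : j ≤ 2 * u)
    have hun' : 2 * (u : ℝ) ≤ n := by exact_mod_cast hun
    rw [Nat.cast_mul, Nat.cast_sub (by omega : u ≤ n)]
    exact mul_le_mul (by linarith) (by linarith) (by positivity) u.cast_nonneg
  have hlog : 0 < Real.log n := by linarith [h.le_log]
  calc 2 * (n : ℝ) ≤ 0.98 / 12 * √(Real.log n) * n := by
        gcongr
        linarith [h.thirty_le_sqrt_log]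
    _ = 0.98 / 4 * Real.log n / n * (n / √(Real.log n) * (n / 3)) := by
        nth_rewrite 2 [← Real.mul_self_sqrt hlog.le]
        field_simp
        norm_num
    _ ≤ 0.98 / 4 * Real.log n / n * (i * j) := by gcongr
    _ = (j : ℝ) / 2 * (n / 2) * (i / n) * (0.98 * Real.log n / n) := by field_simp; ring
    _ ≤ _ := by
        have hcut₀ : 0 ≤ (j : ℝ) / 2 * (n / 2) := by positivity
        have havoid₀ : 0 ≤ (i : ℝ) / n := by positivity
        exact mul_le_mul (mul_le_mul hcut havoid havoid₀ (hcut₀.trans hcut)) hearly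
          (by positivity) (mul_nonneg (hcut₀.trans hcut) (havoid₀.trans havoid))

lemma processLaw_real_balancedObstruction_le (h : IsLarge n) (hk : 2 ≤ k) (hkn : k ≤ n - 1) :
    (processLaw n k).real (balancedObstruction n k (earlyTime n) (sizeThreshold n)) ≤
      (4 / Real.exp 2) ^ n := by
  refine (measureReal_balancedObstruction_le (Real.exp_pos (-(2 * n : ℝ))).le
    fun I U hI hJ hU hUn => ?_).trans_eq ?_
  · refine (processLaw_real_avoidedCut_le hk hkn (Nat.zero_le _) h.earlyTime_le_choose
      h.earlyTime_le_choose (empty_subset _) rfl (x := 2 * n) ?_).trans_eq ?_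
    · rw [card_empty, Nat.cast_zero, sub_zero, sub_zero]
      exact h.balancedObstruction_exponent_le hI hJ hU hUn rfl
    · rw [card_empty, pow_zero, pow_zero, one_mul, one_mul]
  · rw [Real.exp_neg, mul_comm (2 : ℝ) n, Real.exp_nat_mul, ← inv_pow, ← mul_pow, ← mul_pow]
    congr 1
    ring

end IsLarge

theorem tendsto_balancedObstruction (hk : 2 ≤ k) :
    Tendsto (fun n => (processLaw n k).real
      (balancedObstruction n k (earlyTime n) (sizeThreshold n))) atTop (𝓝 0) := by
  have hlt : 4 / Real.exp 2 < 1 := by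
    rw [div_lt_one (Real.exp_pos _), show (2 : ℝ) = 1 + 1 by norm_num, Real.exp_add]
    nlinarith [Real.exp_one_gt_d9]
  refine squeeze_zero' (Eventually.of_forall fun n => measureReal_nonneg) ?_
    (tendsto_pow_atTop_nhds_zero_of_lt_one (by positivity) hlt)
  filter_upwards [eventually_isLarge, eventually_le_pred k] with n h hkn
  exact h.processLaw_real_balancedObstruction_le hk hkn

end BalancedCuts

section LargeColourSets

open Finset

variable {n k j u : ℕ}

/-- The part `u(n - u) (log n - log log n / 2) / n - 5u` of the exponent in the probability that a
set of `u` vertices has an avoided cut at the early time; a union bound over the `j + 1` exceptional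
edges costs a further `j + 1`. -/
noncomputable def cutExponent (n u : ℕ) : ℝ :=
  u * (n - u) * (Real.log n - Real.log (Real.log n) / 2) / n - 5 * u

lemma choose_le_exp_mul_div_pow_succ (hj : 1 ≤ j) (hjn : j ≤ n - 1) :
    ((n - 1).choose (n - 1 - j) : ℝ) ≤ (Real.exp 1 * n / j) ^ (j + 1) := by
  have hj₀ : (0 : ℝ) < j := by exact_mod_cast hj
  have hjn' : (j : ℝ) ≤ n := by exact_mod_cast (by omega : j ≤ n)
  have hbase : 1 ≤ Real.exp 1 * n / j := by
    rw [one_le_div hj₀]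
    exact hjn'.trans (le_mul_of_one_le_left n.cast_nonneg (Real.one_le_exp zero_le_one))
  calc ((n - 1).choose (n - 1 - j) : ℝ) ≤ n.choose j := by
        rw [Nat.choose_symm hjn]
        exact_mod_cast Nat.choose_le_choose _ n.pred_le
    _ ≤ (Real.exp 1 * n / j) ^ j := choose_le_exp_mul_div_pow n hj
    _ ≤ (Real.exp 1 * n / j) ^ (j + 1) := pow_le_pow_right₀ hbase j.le_succ

lemma choose_mul_sub_succ_le (hj : 1 ≤ j) :
    ((u * (n - u)).choose (j + 1) : ℝ) ≤ (Real.exp 1 * (u * n) / j) ^ (j + 1) := by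
  refine (choose_le_exp_mul_div_pow _ j.succ_pos).trans ?_
  have _ : (0 : ℝ) < j := by exact_mod_cast hj
  gcongr
  · exact_mod_cast Nat.mul_le_mul_left u (n.sub_le u)
  · exact j.le_succ

lemma largeObstruction_term_le (hj : 1 ≤ j) (hjn : j ≤ n - 1) {L p y g : ℝ} (hp₀ : 0 ≤ p)
    (hp : p ≤ 7 * L / n) (hy₀ : 0 ≤ y) (hy : y ≤ 2 * j / n) :
    ((n - 1).choose (n - 1 - j) : ℝ) * ((n.choose u : ℝ) * (((u * (n - u)).choose (j + 1) : ℝ) *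
      (p ^ (j + 1) * (y ^ 2) ^ (j + 1) * Real.exp (-(g - (j + 1 : ℕ)))))) ≤
      (n : ℝ) ^ u / u.factorial * Real.exp (-g) *
        (28 * Real.exp 1 ^ 3 * u * L / n) ^ (j + 1) := by
  have _ : (0 : ℝ) < j := by exact_mod_cast hj
  have hn : (0 : ℝ) < n := by exact_mod_cast (by omega : 0 < n)
  have hexp : Real.exp (-(g - (j + 1 : ℕ))) = Real.exp (-g) * Real.exp 1 ^ (j + 1) := by
    rw [← Real.exp_nat_mul, mul_one, ← Real.exp_add, neg_sub, sub_eq_neg_add]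
  calc _ ≤ (Real.exp 1 * n / j) ^ (j + 1) * ((n : ℝ) ^ u / u.factorial *
        ((Real.exp 1 * (u * n) / j) ^ (j + 1) * ((7 * L / n) ^ (j + 1) *
          ((2 * j / n) ^ 2) ^ (j + 1) * Real.exp (-(g - (j + 1 : ℕ)))))) := by
        gcongr
        · exact choose_le_exp_mul_div_pow_succ hj hjn
        · exact Nat.choose_le_pow_div u n
        · exact choose_mul_sub_succ_le hj
        · exact pow_nonneg (hp₀.trans hp) _
    _ = (n : ℝ) ^ u / u.factorial * Real.exp (-g) * ((Real.exp 1 * n / j) *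
        (Real.exp 1 * (u * n) / j) * (7 * L / n) * (2 * j / n) ^ 2 * Real.exp 1) ^ (j + 1) := by
        rw [hexp]
        simp only [mul_pow]
        ring
    _ = _ := by
        congr 2
        field_simp
        ring

lemma mul_one_sub_mul_ge {M s x z : ℝ} (hM : 0 ≤ M) (hs : 0 ≤ s) (hx₀ : 0 ≤ x) (hx : x ≤ 1)
    (hz₀ : 0 ≤ z) (hz : z ≤ 1) :
    M * z - M * z ^ 2 / 2 - x * (M * z) - s ≤ (M - s) * (1 - x) * (z - z ^ 2 / 2) := by
  have hzz₀ : 0 ≤ z - z ^ 2 / 2 := by nlinarith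
  have hMx : x * (M * (z - z ^ 2 / 2)) ≤ x * (M * z) := by
    gcongr
    linarith [sq_nonneg z]
  have hsx : s * ((1 - x) * (z - z ^ 2 / 2)) ≤ s := by
    have _ : 0 ≤ 1 - x := sub_nonneg.2 hx
    refine mul_le_of_le_one_right hs (mul_le_one₀ (sub_le_self 1 hx₀) hzz₀ ?_)
    linarith [sq_nonneg z]
  linarith

namespace IsLarge

lemma sq_div_pred_mul_log_le (h : IsLarge n) (hj : j ≤ sizeThreshold n) :
    ((j : ℝ) / (n - 1 : ℕ)) ^ 2 * Real.log n ≤ 1.03 := by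
  have hn := h.le_natCast
  have hlog : 0 < Real.log n := by linarith [h.le_log]
  have hj' : (j : ℝ) * √(Real.log n) ≤ n := (le_div_iff₀ (by positivity)).1
    ((Nat.cast_le.2 hj).trans (sizeThreshold_le_div_sqrt n))
  calc ((j : ℝ) / (n - 1 : ℕ)) ^ 2 * Real.log n
      = (j * √(Real.log n) / (n - 1 : ℕ)) ^ 2 := by
        rw [div_pow, div_pow, mul_pow, Real.sq_sqrt hlog.le, div_mul_eq_mul_div]
    _ ≤ 1.01 ^ 2 := by
        gcongr
        rw [h.cast_pred, div_le_iff₀ (by linarith)]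
        linarith
    _ ≤ 1.03 := by norm_num

lemma sub_two_div_le_earlyTime (h : IsLarge n) {s z : ℝ} (hs : s ≤ n / 30 + 1)
    (hz : z = (earlyTime n - s) / (n.choose 2 : ℕ)) :
    (Real.log n - Real.log (Real.log n) / 2 - 2) / n ≤ z := by
  have hn := h.le_natCast
  have hlog := h.le_log
  rw [hz, div_le_div_iff₀ h.natCast_pos h.choose_two_pos, Nat.cast_choose_two ℝ n]
  set w := Real.log n - Real.log (Real.log n) / 2 with hw
  have hearly : n * w / 2 - 1 ≤ earlyTime n := le_earlyTime n
  calc (w - 2) * (n * (n - 1) / 2) = (n * w / 2 - w / 2 - (n - 1)) * n := by ring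
    _ ≤ (earlyTime n - s) * n := by
        refine mul_le_mul_of_nonneg_right ?_ n.cast_nonneg
        linarith [h.loglog_le, h.loglog_nonneg]

lemma mul_natCast_le_of_earlyTime (h : IsLarge n) {s z : ℝ} (hs : 0 ≤ s)
    (hz : z = (earlyTime n - s) / (n.choose 2 : ℕ)) : z * n ≤ 1.01 * Real.log n := by
  have hn := h.le_natCast
  have hlog := h.le_log
  rw [hz, div_mul_eq_mul_div, div_le_iff₀ h.choose_two_pos, Nat.cast_choose_two ℝ n]
  calc (earlyTime n - s) * n ≤ n * Real.log n / 2 * n := by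
        gcongr
        linarith [h.earlyTime_le_log]
    _ ≤ 1.01 * Real.log n * (n * (n - 1) / 2) := by
        nlinarith [mul_nonneg (mul_nonneg (by linarith : 0 ≤ Real.log n) n.cast_nonneg)
          (by linarith : 0 ≤ (n : ℝ) - 101)]

lemma largeObstruction_exponent_le (h : IsLarge n) (hj : j ≤ sizeThreshold n) (hu : 2 * u ≤ n)
    {z : ℝ} (hz : z = (earlyTime n - (j + 1 : ℕ)) / (n.choose 2 : ℕ)) :
    cutExponent n u - (j + 1 : ℕ) ≤ ((u * (n - u) : ℕ) - (j + 1 : ℕ)) *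
      (1 - ((j : ℝ) / (n - 1 : ℕ)) ^ 2) * (z - z ^ 2 / 2) := by
  have hlog := h.le_log
  have hn := h.natCast_pos
  have hj' : ((j + 1 : ℕ) : ℝ) ≤ n / 30 + 1 := by
    rw [Nat.cast_succ]
    linarith [h.sizeThreshold_le_div, (Nat.cast_le (α := ℝ)).2 hj]
  have hzge := h.sub_two_div_le_earlyTime hj' hz
  have hz₀ : 0 ≤ z := le_trans (div_nonneg (by linarith [h.loglog_le]) hn.le) hzge
  have hzn := h.mul_natCast_le_of_earlyTime (Nat.cast_nonneg _) hz
  have hznz : n * z ^ 2 ≤ 1 := by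
    refine le_of_mul_le_mul_right ?_ hn
    calc n * z ^ 2 * n = (z * n) ^ 2 := by ring
      _ ≤ (1.01 * Real.log n) ^ 2 := by gcongr
      _ ≤ 1 * n := by nlinarith [h.log_sq_le]
  have hz₁ : z ≤ 1 := by nlinarith [h.le_natCast]
  have hx := h.sq_div_pred_mul_log_le hj
  have hu' : 2 * (u : ℝ) ≤ n := by exact_mod_cast hu
  rw [Nat.cast_mul, Nat.cast_sub (by omega : u ≤ n)]
  set M : ℝ := u * (n - u)
  set x := ((j : ℝ) / (n - 1 : ℕ)) ^ 2
  have hM₀ : 0 ≤ M := mul_nonneg u.cast_nonneg (by linarith)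
  have hM : M ≤ u * n := mul_le_mul_of_nonneg_left (by linarith) u.cast_nonneg
  have hx₁ : x ≤ 1 := by nlinarith
  have hMzge : cutExponent n u + 3 * u ≤ M * z := by
    calc cutExponent n u + 3 * u = M * ((Real.log n - Real.log (Real.log n) / 2 - 2) / n) +
          2 * (M / n) - 2 * u := by
          simp only [cutExponent, M]
          ring
      _ ≤ M * z + 2 * u - 2 * u := by
          gcongr
          rwa [div_le_iff₀ hn]
      _ = M * z := add_sub_cancel_right _ _
  have hMz₂ : M * z ^ 2 ≤ u :=
    calc M * z ^ 2 ≤ u * n * z ^ 2 := by gcongr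
      _ = u * (n * z ^ 2) := mul_assoc _ _ _
      _ ≤ u := mul_le_of_le_one_right u.cast_nonneg hznz
  have hxMz : x * (M * z) ≤ 2 * u :=
    calc x * (M * z) ≤ x * (u * n * z) := by gcongr
      _ = u * (x * (z * n)) := by ring
      _ ≤ u * (x * (1.01 * Real.log n)) := by gcongr
      _ ≤ 2 * u := by nlinarith [u.cast_nonneg (α := ℝ)]
  have := mul_one_sub_mul_ge hM₀ (Nat.cast_nonneg (j + 1)) (sq_nonneg _) hx₁ hz₀ hz₁
  linarith

lemma pow_div_factorial_mul_exp_neg_cutExponent_le (h : IsLarge n) :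
    (n : ℝ) ^ u / u.factorial * Real.exp (-cutExponent n u) ≤
      (Real.exp 5 * √(Real.log n)) ^ u / u.factorial *
        Real.exp ((u : ℝ) ^ 2 * Real.log n / n) := by
  have hn := h.natCast_pos
  have hlog : 0 < Real.log n := by linarith [h.le_log]
  have hpow : (n : ℝ) ^ u = Real.exp (u * Real.log n) := by
    rw [Real.exp_nat_mul, h.exp_log_eq]
  have hsqrt : (Real.exp 5 * √(Real.log n)) ^ u =
      Real.exp (u * (5 + Real.log (Real.log n) / 2)) := by
    rw [Real.exp_nat_mul, Real.exp_add, Real.exp_half, Real.exp_log hlog]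
  rw [hpow, hsqrt, div_mul_eq_mul_div, div_mul_eq_mul_div, ← Real.exp_add, ← Real.exp_add]
  refine div_le_div_of_nonneg_right (Real.exp_le_exp.2 ?_) (by positivity)
  calc u * Real.log n + -cutExponent n u
      = u * (5 + Real.log (Real.log n) / 2) + u ^ 2 * Real.log n / n -
          u ^ 2 * (Real.log (Real.log n) / 2) / n := by
        rw [cutExponent]
        field_simp
        ring
    _ ≤ _ := sub_le_self _ (by have := h.loglog_nonneg; positivity)

end IsLarge

lemma cast_sq_le_four_pow (u : ℕ) : (u : ℝ) ^ 2 ≤ 4 ^ u := by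
  calc (u : ℝ) ^ 2 ≤ (2 ^ u) ^ 2 := by
        gcongr
        exact_mod_cast Nat.lt_two_pow_self.le
    _ = 4 ^ u := by rw [← pow_mul, mul_comm, pow_mul]; norm_num

lemma pow_succ_le_sq_mul_half_pow {x : ℝ} (hj : 1 ≤ j) (hx₀ : 0 ≤ x) (hx : x ≤ 1 / 2) :
    x ^ (j + 1) ≤ x ^ 2 * (2 * (1 / 2) ^ j) := by
  obtain ⟨i, rfl⟩ := Nat.exists_eq_add_of_le' hj
  calc x ^ (i + 1 + 1) = x ^ 2 * x ^ i := by ring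
    _ ≤ x ^ 2 * (1 / 2) ^ i := by gcongr
    _ = x ^ 2 * (2 * (1 / 2) ^ (i + 1)) := by rw [pow_succ (1 / 2 : ℝ)]; ring

lemma smallCut_term_le {L C : ℝ} (hn : 0 < n) (hL : 0 ≤ L) (hC : 1 ≤ C) (hj : 1 ≤ j)
    (hu : 2 * C * u * L ≤ n) :
    (Real.exp 5 * √L) ^ u / u.factorial * Real.exp ((u : ℝ) ^ 2 * L / n) *
      (C * u * L / n) ^ (j + 1) ≤
    (4 * Real.exp 6 * √L) ^ u / u.factorial * (2 * C ^ 2 * L ^ 2 / n ^ 2 * (1 / 2) ^ j) := by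
  have hn₀ : (0 : ℝ) < n := by exact_mod_cast hn
  have huL : u * L ≤ n := by nlinarith [mul_nonneg u.cast_nonneg hL]
  have hexp : Real.exp ((u : ℝ) ^ 2 * L / n) ≤ Real.exp 1 ^ u := by
    rw [← Real.exp_nat_mul, Real.exp_le_exp, div_le_iff₀ hn₀]
    calc (u : ℝ) ^ 2 * L = u * (u * L) := by ring
      _ ≤ u * n := by gcongr
      _ = u * 1 * n := by rw [mul_one]
  have hratio : (C * u * L / n) ^ (j + 1) ≤
      4 ^ u * (C ^ 2 * L ^ 2 / n ^ 2) * (2 * (1 / 2) ^ j) :=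
    calc (C * u * L / n) ^ (j + 1) ≤ (C * u * L / n) ^ 2 * (2 * (1 / 2) ^ j) := by
          refine pow_succ_le_sq_mul_half_pow hj (by positivity) ?_
          rw [div_le_iff₀ hn₀]
          linarith
      _ = (u : ℝ) ^ 2 * (C ^ 2 * L ^ 2 / n ^ 2) * (2 * (1 / 2) ^ j) := by ring
      _ ≤ _ := by
          gcongr
          exact cast_sq_le_four_pow u
  calc _ ≤ (Real.exp 5 * √L) ^ u / u.factorial * Real.exp 1 ^ u *
        (4 ^ u * (C ^ 2 * L ^ 2 / n ^ 2) * (2 * (1 / 2) ^ j)) := by gcongr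
    _ = (4 * (Real.exp 5 * Real.exp 1) * √L) ^ u / u.factorial *
        (2 * C ^ 2 * L ^ 2 / n ^ 2 * (1 / 2) ^ j) := by
        simp only [mul_pow]
        ring
    _ = _ := by rw [← Real.exp_add]; norm_num

lemma one_div_factorial_le (u : ℕ) : 1 / (u.factorial : ℝ) ≤ (Real.exp 1 / u) ^ u := by
  rcases u.eq_zero_or_pos with rfl | hu
  · simp
  have hu₀ : (0 : ℝ) < u := by exact_mod_cast hu
  have hexp := Real.pow_div_factorial_le_exp u hu₀.le u
  rw [div_pow, ← Real.exp_nat_mul, mul_one, div_le_div_iff₀ (by positivity) (by positivity),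
    one_mul]
  rwa [div_le_iff₀ (by positivity)] at hexp

namespace IsLarge

lemma largeCut_vertex_factor_le (h : IsLarge n) {C : ℝ} (hC : 0 < C) (hun : 2 * u ≤ n)
    (hu : (n : ℝ) < 2 * C * u * Real.log n)
    (hClog : 2 * C * Real.exp 6 * Real.log n ^ 2 ≤ Real.exp (1 / 4 * Real.log n)) :
    (Real.exp 5 * √(Real.log n)) ^ u / u.factorial * Real.exp ((u : ℝ) ^ 2 * Real.log n / n) ≤
      Real.exp (-(n / (8 * C))) := by
  have hn := h.natCast_pos
  have hlog := h.le_log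
  have hexp_log := h.exp_log_eq
  set L := Real.log n
  have hu₀ : (0 : ℝ) < u := by
    refine Nat.cast_pos.2 (Nat.pos_of_ne_zero ?_)
    rintro rfl
    rw [Nat.cast_zero, mul_zero, zero_mul] at hu
    linarith
  have hexp : Real.exp ((u : ℝ) ^ 2 * L / n) ≤ Real.exp (L / 2) ^ u := by
    rw [← Real.exp_nat_mul, Real.exp_le_exp, div_le_iff₀ hn]
    have hun' : 2 * (u : ℝ) ≤ n := by exact_mod_cast hun
    calc (u : ℝ) ^ 2 * L = u * L / 2 * (2 * u) := by ring
      _ ≤ u * L / 2 * n := by gcongr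
      _ = u * (L / 2) * n := by ring
  have hbase : Real.exp 5 * √L * (Real.exp 1 / u) * Real.exp (L / 2) ≤ Real.exp (-(L / 4)) := by
    have hinv : 1 / (u : ℝ) ≤ 2 * C * L / n := by
      rw [div_le_div_iff₀ hu₀ hn]
      linarith
    have hsqrt : √L ≤ L := Real.sqrt_le_self_iff.2 (Or.inr (by linarith))
    calc Real.exp 5 * √L * (Real.exp 1 / u) * Real.exp (L / 2)
        = Real.exp 5 * Real.exp 1 * √L * Real.exp (L / 2) * (1 / u) := by ring
      _ ≤ Real.exp 5 * Real.exp 1 * L * Real.exp (L / 2) * (2 * C * L / n) := by gcongr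
      _ = 2 * C * Real.exp 6 * L ^ 2 * (Real.exp (L / 2) / Real.exp L) := by
          rw [← Real.exp_add, hexp_log]
          norm_num
          ring
      _ ≤ Real.exp (1 / 4 * L) * (Real.exp (L / 2) / Real.exp L) := by gcongr
      _ = Real.exp (-(L / 4)) := by
          rw [← Real.exp_sub, ← Real.exp_add]
          ring_nf
  calc (Real.exp 5 * √L) ^ u / u.factorial * Real.exp ((u : ℝ) ^ 2 * L / n)
      = (Real.exp 5 * √L) ^ u * (1 / u.factorial) * Real.exp ((u : ℝ) ^ 2 * L / n) := by ring
    _ ≤ (Real.exp 5 * √L) ^ u * (Real.exp 1 / u) ^ u * Real.exp (L / 2) ^ u := by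
        gcongr
        exact one_div_factorial_le u
    _ = (Real.exp 5 * √L * (Real.exp 1 / u) * Real.exp (L / 2)) ^ u := by
        rw [← mul_pow, ← mul_pow]
    _ ≤ Real.exp (-(L / 4)) ^ u := by gcongr
    _ ≤ Real.exp (-(n / (8 * C))) := by
        rw [← Real.exp_nat_mul, Real.exp_le_exp, mul_neg, neg_le_neg_iff,
          div_le_iff₀ (by positivity)]
        linarith

lemma largeCut_colour_factor_le (h : IsLarge n) {C : ℝ} (hC : 0 < C) (hj : j ≤ sizeThreshold n)
    (hun : u ≤ n) (hClog : C * Real.log n ≤ Real.exp (1 / (32 * C) * √(Real.log n))) :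
    (C * u * Real.log n / n) ^ (j + 1) ≤ Real.exp (n / (16 * C)) := by
  have hn := h.natCast_pos
  have hlog := h.le_log
  have hsqrt : √(Real.log n) ≤ n :=
    (Real.sqrt_le_self_iff.2 (Or.inr (by linarith))).trans (by linarith [h.log_le])
  have hj' : (j : ℝ) * √(Real.log n) ≤ n :=
    (le_div_iff₀ (by positivity)).1 ((Nat.cast_le.2 hj).trans (sizeThreshold_le_div_sqrt n))
  calc (C * u * Real.log n / n) ^ (j + 1) ≤ (C * Real.log n) ^ (j + 1) := by
        gcongr
        rw [div_le_iff₀ hn, mul_right_comm]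
        gcongr
    _ ≤ Real.exp (1 / (32 * C) * √(Real.log n)) ^ (j + 1) := by gcongr
    _ = Real.exp (1 / (32 * C) * (j * √(Real.log n) + √(Real.log n))) := by
        rw [← Real.exp_nat_mul, Nat.cast_succ]
        ring_nf
    _ ≤ Real.exp (1 / (32 * C) * (n + n)) := by gcongr
    _ = Real.exp (n / (16 * C)) := by
        congr 1
        field_simp
        norm_num

lemma largeCut_term_le (h : IsLarge n) {C : ℝ} (hC : 0 < C) (hj : j ≤ sizeThreshold n)
    (hun : 2 * u ≤ n) (hu : (n : ℝ) < 2 * C * u * Real.log n)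
    (hClog : 2 * C * Real.exp 6 * Real.log n ^ 2 ≤ Real.exp (1 / 4 * Real.log n))
    (hCsqrt : C * Real.log n ≤ Real.exp (1 / (32 * C) * √(Real.log n))) :
    (Real.exp 5 * √(Real.log n)) ^ u / u.factorial * Real.exp ((u : ℝ) ^ 2 * Real.log n / n) *
      (C * u * Real.log n / n) ^ (j + 1) ≤ Real.exp (-(n / (16 * C))) := by
  have _ : 0 ≤ Real.log n := by linarith [h.le_log]
  calc _ ≤ Real.exp (-(n / (8 * C))) * Real.exp (n / (16 * C)) :=
        mul_le_mul (h.largeCut_vertex_factor_le hC hun hu hClog)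
          (h.largeCut_colour_factor_le hC hj (by omega) hCsqrt) (by positivity) (by positivity)
    _ = Real.exp (-(n / (16 * C))) := by
        rw [← Real.exp_add]
        congr 1
        field_simp
        norm_num

lemma largeObstruction_summand_le (h : IsLarge n) {C : ℝ} (hC : 28 * Real.exp 1 ^ 3 ≤ C)
    (hj : j ≤ sizeThreshold n) (hun : 2 * u ≤ n)
    (hClog : 2 * C * Real.exp 6 * Real.log n ^ 2 ≤ Real.exp (1 / 4 * Real.log n))
    (hCsqrt : C * Real.log n ≤ Real.exp (1 / (32 * C) * √(Real.log n))) :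
    ((n - 1).choose (n - 1 - j) : ℝ) * ((n.choose u : ℝ) * (((u * (n - u)).choose (j + 1) : ℝ) *
      (((lateTime n : ℝ) / (n.choose 2 : ℕ)) ^ (j + 1) * (((j : ℝ) / (n - 1 : ℕ)) ^ 2) ^ (j + 1) *
        Real.exp (-(cutExponent n u - (j + 1 : ℕ)))))) ≤
      (4 * Real.exp 6 * √(Real.log n)) ^ u / u.factorial *
        (2 * C ^ 2 * Real.log n ^ 2 / n ^ 2 * (1 / 2) ^ j) + Real.exp (-(n / (16 * C))) := by
  have hn := h.natCast_pos
  have hlog : 0 ≤ Real.log n := by linarith [h.le_log]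
  have hC₁ : 1 ≤ C := by linarith [one_le_pow₀ (n := 3) (Real.one_le_exp zero_le_one)]
  rcases j.eq_zero_or_pos with rfl | hj₁
  · simp only [Nat.cast_zero, zero_div, zero_pow two_ne_zero, zero_add, pow_one, mul_zero,
      zero_mul]
    positivity
  have hy : (j : ℝ) / (n - 1 : ℕ) ≤ 2 * j / n := by
    rw [h.cast_pred, div_le_div_iff₀ (by linarith [h.le_natCast]) hn]
    nlinarith [j.cast_nonneg (α := ℝ), h.le_natCast]
  have hjn : j ≤ n - 1 := by
    have := h.two_mul_sizeThreshold_le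
    have := h.two_le
    omega
  calc _ ≤ (n : ℝ) ^ u / u.factorial * Real.exp (-cutExponent n u) *
        (28 * Real.exp 1 ^ 3 * u * Real.log n / n) ^ (j + 1) :=
        largeObstruction_term_le hj₁ hjn (by positivity) h.lateTime_div_le (by positivity) hy
    _ ≤ (Real.exp 5 * √(Real.log n)) ^ u / u.factorial * Real.exp ((u : ℝ) ^ 2 * Real.log n / n) *
        (C * u * Real.log n / n) ^ (j + 1) := by
        refine mul_le_mul h.pow_div_factorial_mul_exp_neg_cutExponent_le ?_ (by positivity)
          (by positivity)
        gcongr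
    _ ≤ _ := by
        rcases le_or_gt (2 * C * u * Real.log n) n with hu | hu
        · exact (smallCut_term_le (by exact_mod_cast hn) hlog hC₁ hj₁ hu).trans
            (le_add_of_nonneg_right (Real.exp_pos _).le)
        · exact (h.largeCut_term_le (by linarith) hj hun hu hClog hCsqrt).trans
            (le_add_of_nonneg_left (by positivity))

end IsLarge

lemma sum_range_half_pow_le (b : ℕ) : ∑ j ∈ range b, (1 / 2 : ℝ) ^ j ≤ 2 := by
  have := mul_neg_geom_sum (1 / 2 : ℝ) b
  have : (0 : ℝ) ≤ (1 / 2) ^ b := by positivity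
  linarith

lemma sum_Icc_pow_div_factorial_le {a : ℝ} (ha : 0 ≤ a) (M : ℕ) :
    ∑ u ∈ Icc 1 M, a ^ u / u.factorial ≤ Real.exp a := by
  refine (sum_le_sum_of_subset_of_nonneg (t := range (M + 1)) (fun u hu => ?_)
    fun _ _ _ => by positivity).trans (Real.sum_le_exp_of_nonneg ha _)
  rw [mem_Icc] at hu
  exact mem_range.2 (Nat.lt_succ_of_le hu.2)

lemma sum_sum_add_const_le {a c ε : ℝ} (ha : 0 ≤ a) (hc : 0 ≤ c) (b M : ℕ) :
    ∑ j ∈ range b, ∑ u ∈ Icc 1 M, (a ^ u / u.factorial * (c * (1 / 2) ^ j) + ε) ≤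
      2 * c * Real.exp a + b * M * ε := by
  calc ∑ j ∈ range b, ∑ u ∈ Icc 1 M, (a ^ u / u.factorial * (c * (1 / 2) ^ j) + ε)
      = (∑ j ∈ range b, (1 / 2 : ℝ) ^ j) * c * (∑ u ∈ Icc 1 M, a ^ u / u.factorial) +
        b * M * ε := by
        simp only [sum_add_distrib, sum_const, card_range, nsmul_eq_mul, Nat.card_Icc,
          Nat.add_sub_cancel, ← sum_mul]
        rw [← mul_sum, ← mul_sum]
        ring
    _ ≤ _ := by
        gcongr
        · exact sum_range_half_pow_le b
        · exact sum_Icc_pow_div_factorial_le ha M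

namespace IsLarge

lemma exp_mul_sqrt_log_le (h : IsLarge n) {a : ℝ} (ha : a ^ 2 ≤ Real.log n) :
    Real.exp (a * √(Real.log n)) ≤ n := by
  calc Real.exp (a * √(Real.log n)) ≤ Real.exp (√(Real.log n) * √(Real.log n)) := by
        gcongr
        exact Real.le_sqrt_of_sq_le ha
    _ = n := by rw [Real.mul_self_sqrt (by linarith [h.le_log]), h.exp_log_eq]

lemma processLaw_real_largeObstruction_le (h : IsLarge n) (hk : 2 ≤ k) (hkn : k ≤ n - 1) {C : ℝ}
    (hC : 28 * Real.exp 1 ^ 3 ≤ C) (hlog : (4 * Real.exp 6) ^ 2 ≤ Real.log n)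
    (hClog : 2 * C * Real.exp 6 * Real.log n ^ 2 ≤ Real.exp (1 / 4 * Real.log n))
    (hCsqrt : C * Real.log n ≤ Real.exp (1 / (32 * C) * √(Real.log n)))
    (hCn : 4 * C ^ 2 * Real.log n ^ 3 ≤ n) :
    (processLaw n k).real (largeObstruction n k (earlyTime n) (lateTime n) (sizeThreshold n)) ≤
      1 / Real.log n + n ^ 2 * Real.exp (-(n / (16 * C))) := by
  have hn := h.natCast_pos
  have hlog₀ : 0 < Real.log n := by linarith [h.le_log]
  have hsize := h.sizeThreshold_lt_earlyTime
  have hthreshold : ((sizeThreshold n + 1 : ℕ) : ℝ) ≤ n := by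
    rw [Nat.cast_succ]
    linarith [h.sizeThreshold_le_div, h.le_natCast]
  have hhalf : ((n / 2 : ℕ) : ℝ) ≤ n := by exact_mod_cast n.div_le_self 2
  refine (measureReal_largeObstruction_le (B := fun j u =>
    ((lateTime n : ℝ) / (n.choose 2 : ℕ)) ^ (j + 1) * (((j : ℝ) / (n - 1 : ℕ)) ^ 2) ^ (j + 1) *
      Real.exp (-(cutExponent n u - (j + 1 : ℕ)))) (fun j u => by positivity)
    fun j hj I U X hI hU hXU hX => ?_).trans ?_
  · have hI' : n - 1 - #I = j := by
      have := h.two_mul_sizeThreshold_le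
      have := h.two_le
      omega
    have hexp := h.largeObstruction_exponent_le hj (u := #U)
      (by have := (mem_Icc.1 hU).2; omega) rfl
    refine (processLaw_real_avoidedCut_le hk hkn (by omega) h.earlyTime_le_choose
      h.lateTime_le_choose hXU rfl (x := cutExponent n #U - (j + 1 : ℕ)) ?_).trans_eq ?_
    · rwa [hX, hI']
    · rw [hX, hI']
  calc _ ≤ ∑ j ∈ range (sizeThreshold n + 1), ∑ u ∈ Icc 1 (n / 2),
        ((4 * Real.exp 6 * √(Real.log n)) ^ u / u.factorial *
          (2 * C ^ 2 * Real.log n ^ 2 / n ^ 2 * (1 / 2) ^ j) + Real.exp (-(n / (16 * C)))) := by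
        refine sum_le_sum fun j hj => ?_
        rw [mul_sum]
        refine sum_le_sum fun u hu => h.largeObstruction_summand_le hC ?_ ?_ hClog hCsqrt
        · exact Nat.lt_succ_iff.1 (mem_range.1 hj)
        · have := (mem_Icc.1 hu).2
          omega
    _ ≤ 2 * (2 * C ^ 2 * Real.log n ^ 2 / n ^ 2) * n + n * n * Real.exp (-(n / (16 * C))) := by
        refine (sum_sum_add_const_le (by positivity) (by positivity) _ _).trans ?_
        gcongr
        exact h.exp_mul_sqrt_log_le hlog
    _ = 4 * C ^ 2 * Real.log n ^ 3 / n / Real.log n + n ^ 2 * Real.exp (-(n / (16 * C))) := by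
        field_simp
        ring
    _ ≤ _ := by
        gcongr
        exact (div_le_one hn).2 hCn

end IsLarge

lemma tendsto_sq_mul_exp_neg_div {c : ℝ} (hc : 0 < c) :
    Tendsto (fun n : ℕ => (n : ℝ) ^ 2 * Real.exp (-(n / c))) atTop (𝓝 0) := by
  have hdiv : Tendsto (fun n : ℕ => (n : ℝ) / c) atTop atTop :=
    tendsto_natCast_atTop_atTop.atTop_div_const hc
  have hlim := ((Real.tendsto_pow_mul_exp_neg_atTop_nhds_zero 2).comp hdiv).const_mul (c ^ 2)
  rw [mul_zero] at hlim
  refine hlim.congr fun n => ?_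
  rw [Function.comp_apply, ← mul_assoc, ← mul_pow, mul_div_cancel₀ _ hc.ne']

theorem tendsto_largeObstruction (hk : 2 ≤ k) :
    Tendsto (fun n => (processLaw n k).real
      (largeObstruction n k (earlyTime n) (lateTime n) (sizeThreshold n))) atTop (𝓝 0) := by
  have hlim : Tendsto (fun n : ℕ => 1 / Real.log n +
      n ^ 2 * Real.exp (-(n / (16 * (28 * Real.exp 1 ^ 3))))) atTop (𝓝 0) := by
    simpa only [add_zero] using (tendsto_const_nhds.div_atTop tendsto_log_natCast).add
      (tendsto_sq_mul_exp_neg_div (by positivity))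
  refine squeeze_zero' (Eventually.of_forall fun n => measureReal_nonneg) ?_ hlim
  filter_upwards [eventually_isLarge, eventually_le_pred k,
    tendsto_log_natCast.eventually_ge_atTop ((4 * Real.exp 6) ^ 2),
    eventually_mul_log_pow_le_exp _ 2 (by norm_num : (0 : ℝ) < 1 / 4),
    eventually_mul_log_le_exp_sqrt _ (by positivity : 0 < 1 / (32 * (28 * Real.exp 1 ^ 3))),
    eventually_mul_log_pow_le _ 3] with n h hkn hlog hClog hCsqrt hCn
  exact h.processLaw_real_largeObstruction_le hk hkn le_rfl hlog hClog hCsqrt hCn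

end LargeColourSets

section HittingTimes

variable {n k m m₀ m₁ b : ℕ}

lemma isConn_mono (ω : Outcome n k) : Monotone ω.IsConn := fun _ _ h =>
  SimpleGraph.Connected.mono (SimpleGraph.fromEdgeSet_mono (Set.image_mono (edges_mono ω h)))

lemma allColours_mono (ω : Outcome n k) : Monotone ω.AllColours := fun _ _ h hall w =>
  let ⟨e, he, hw⟩ := hall w
  ⟨e, edges_mono ω h he, hw⟩

lemma exists_isFirstTime {E : ℕ → Prop} (hm : m ≤ n.choose 2) (hE : E m) :
    ∃ t ≤ m, IsFirstTime n E t := by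
  classical
  have hex : ∃ m, m ≤ n.choose 2 ∧ E m := ⟨m, hm, hE⟩
  exact ⟨Nat.find hex, Nat.find_min' hex ⟨hm, hE⟩, Nat.find_spec hex,
    fun t ht => Nat.find_min' hex ht⟩

lemma exists_isFirstTime_eq_max {ω : Outcome n k} (hn : 2 ≤ n) (hb : 2 * b ≤ n)
    (hm₁ : m₁ ≤ n.choose 2) (hearly : ¬ω.IsConn m₀) (hconn : ω.IsConn m₁)
    (hall : ω.AllColours m₁) (hsmall : ω ∉ smallObstruction n k m₀ m₁ b)
    (hbalanced : ω ∉ balancedObstruction n k m₀ b)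
    (hlarge : ω ∉ largeObstruction n k m₀ m₁ b) :
    ∃ mR mC mN : ℕ, IsFirstTime n ω.HasRainbowTree mR ∧ IsFirstTime n ω.IsConn mC ∧
      IsFirstTime n ω.AllColours mN ∧ mR = max mC mN := by
  obtain ⟨mC, hmC, hC⟩ := exists_isFirstTime hm₁ hconn
  obtain ⟨mN, hmN, hN⟩ := exists_isFirstTime hm₁ hall
  have hm₀ : m₀ ≤ mC := by
    by_contra! hlt
    exact hearly (isConn_mono ω hlt.le hC.1.2)
  have htree : ω.HasRainbowTree (max mC mN) :=
    hasRainbowTree_of_notMem_obstructions hn hb (le_max_of_le_left hm₀) (max_le hmC hmN)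
      (isConn_mono ω (le_max_left _ _) hC.1.2) (allColours_mono ω (le_max_right _ _) hN.1.2)
      hsmall hbalanced hlarge
  refine ⟨max mC mN, mC, mN, ⟨⟨(max_le hmC hmN).trans hm₁, htree⟩, ?_⟩, hC, hN, rfl⟩
  rintro m ⟨hm, hR⟩
  exact max_le (hC.2 ⟨hm, isConn_of_hasRainbowTree hR⟩)
    (hN.2 ⟨hm, allColours_of_hasRainbowTree hR⟩)

end HittingTimes

section VanishingEvents

variable {ι : Type*} {l : Filter ι} {Ω : ι → Type*} [∀ i, MeasurableSpace (Ω i)]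
  {μ : ∀ i, Measure (Ω i)} {s t : ∀ i, Set (Ω i)}

lemma tendsto_measureReal_union (hs : Tendsto (fun i => (μ i).real (s i)) l (𝓝 0))
    (ht : Tendsto (fun i => (μ i).real (t i)) l (𝓝 0)) :
    Tendsto (fun i => (μ i).real (s i ∪ t i)) l (𝓝 0) :=
  squeeze_zero (fun _ => measureReal_nonneg) (fun _ => measureReal_union_le _ _)
    (by simpa only [add_zero] using hs.add ht)

lemma tendsto_measure_one_of_compl_subset (hμ : ∀ᶠ i in l, IsProbabilityMeasure (μ i))
    (hst : ∀ᶠ i in l, (s i)ᶜ ⊆ t i) (ht : Tendsto (fun i => (μ i).real (t i)) l (𝓝 0)) :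
    Tendsto (fun i => μ i (s i)) l (𝓝 1) := by
  have hlim : Tendsto (fun i => ENNReal.ofReal (1 - (μ i).real (t i))) l (𝓝 1) := by
    simpa only [sub_zero, ENNReal.ofReal_one] using ENNReal.tendsto_ofReal (ht.const_sub 1)
  refine tendsto_of_tendsto_of_tendsto_of_le_of_le' hlim tendsto_const_nhds ?_
    (hμ.mono fun i _ => prob_le_one)
  filter_upwards [hμ, hst] with i _ hsub
  have hone : 1 ≤ (μ i).real (s i) + (μ i).real (t i) :=
    calc 1 = (μ i).real (s i ∪ (s i)ᶜ) := by rw [Set.union_compl_self, probReal_univ]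
      _ ≤ (μ i).real (s i ∪ t i) := measureReal_mono (Set.union_subset_union_right _ hsub)
      _ ≤ (μ i).real (s i) + (μ i).real (t i) := measureReal_union_le _ _
  exact ENNReal.ofReal_le_of_le_toReal (sub_le_iff_le_add.2 hone)

end VanishingEvents

theorem theorem1p1 (k : ℕ) (hk : 2 ≤ k) :
    Tendsto
      (fun n : ℕ => processLaw n k
        {ω : Outcome n k | ∃ mR mC mN : ℕ,
          IsFirstTime n ω.HasRainbowTree mR ∧
          IsFirstTime n ω.IsConn mC ∧
          IsFirstTime n ω.AllColours mN ∧
          mR = max mC mN})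
      atTop (𝓝 1) := by
  have hprob : ∀ᶠ n in atTop, IsProbabilityMeasure (processLaw n k) :=
    (eventually_le_pred k).mono fun n => isProbabilityMeasure_processLaw
  have hthresholds := tendsto_measureReal_union (tendsto_isConn_earlyTime k)
    (tendsto_measureReal_union (tendsto_not_isConn_lateTime k) (tendsto_not_allColours_lateTime hk))
  have hobstructions := tendsto_measureReal_union (tendsto_smallObstruction hk)
    (tendsto_measureReal_union (tendsto_balancedObstruction hk) (tendsto_largeObstruction hk))
  refine tendsto_measure_one_of_compl_subset hprob ?_
    (tendsto_measureReal_union hthresholds hobstructions)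
  filter_upwards [eventually_isLarge] with n h ω hω
  by_contra hgood
  simp only [Set.mem_union, Set.mem_ofPred_eq, not_or, not_not] at hgood
  obtain ⟨⟨hearly, hconn, hall⟩, hsmall, hbalanced, hlarge⟩ := hgood
  exact hω (exists_isFirstTime_eq_max h.two_le h.two_mul_sizeThreshold_le h.lateTime_le_choose
    hearly hconn hall hsmall hbalanced hlarge)
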